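/- **Theorem.** Let $\mathrm{Diff}(S^1)$ be the group of orientation preserving $C^\infty$ diffeomorphisms of $S^1=\mathbb R/2\pi\mathbb Z$, a Fréchet Lie group, let $\text{Möb}(S^1)\cong PSL(2,\mathbb R)$ be the subgroup of Möbius transformations of the unit disc restricted to the circle, and let $M=\mathrm{Diff}(S^1)/\text{Möb}(S^1)$ be the Fréchet manifold of the cosets $[\varphi]=\text{Möb}(S^1)\circ\varphi$, on which $\mathrm{Diff}(S^1)$ acts by the right translations $R_\varphi:[\psi]\mapsto[\psi\circ\varphi]$. The tangent space of $M$ at the origin $[\mathrm{id}]$ is the space of the smooth real vector fields $v=u(\theta)\,\partial/\partial\theta$, $u=\sum_m u_me^{im\theta}$, with $u_{-1}=u_0=u_1=0$; $M$ carries the almost complex structure $J$ that is given at the origin by $$J\Big(u\,\frac{\partial}{\partial\theta}\Big)=u^*\frac{\partial}{\partial\theta},\qquad u^*=-\sum_m i\,\mathrm{sgn}(m)\,u_me^{im\theta},$$ and elsewhere by right translation. Let $V_{\mathbb C}=C^\infty(S^1,\mathbb C)/\mathbb C$ with the symplectic form $S(\sigma,\tau)=\int_{S^1}\sigma\,\frac{d\tau}{d\theta}\,d\theta$,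 let $W_\pm\subset V_{\mathbb C}$ be the subspaces of the classes with Fourier components of positive (negative) index only, completed to Hilbert spaces with the orthonormal bases $e_{\pm k}=e^{\pm ik\theta}/\sqrt k$ ($k\ge1$), and let $\pi_-$ be the projection of $V_{\mathbb C}=W_+\oplus W_-$ onto $W_-$. Let $D_\infty$ be the Siegel disc of the Hilbert–Schmidt operators $Z:W_+\to W_-$ that are symmetric with respect to $S$ and for which $I-Z\overline Z$ is positive definite; it is an open subset of the complex Hilbert space of the symmetric Hilbert–Schmidt operators. Then there is exactly one map $\Pi:M\to D_\infty$ such that for every $\varphi\in\mathrm{Diff}(S^1)$ the graph of $\Pi([\varphi])$ is the closure of $\{\sigma\circ\varphi:\sigma\in W_+\}$ in the completion of $V_{\mathbb C}=W_+\oplus W_-$. This map $\Pi$ is holomorphic, i.e. it is $C^1$ and at every point $p$ of $M$ its derivative satisfies $d\Pi_p\circ J=i\,d\Pi_p$; and it is an immersion, i.e. its derivative at every point of $M$ is injective. At the origin, $d\Pi(v)=\eta_v$ with $\eta_v(\sigma)=\pi_-(u\,\sigma')$ for $v=u\,\partial/\partial\theta$ and $\sigma\in W_+$ (so that in particular $\eta_{Jv}=i\,\eta_v$).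 -/

import Mathlib

open Real Filter Topology MeasureTheory
open scoped ContDiff ComplexConjugate ENNReal

noncomputable section

namespace PeriodMap

/-! ### Smooth functions on the circle -/

instance factTwoPiPos : Fact (0 < 2 * π) := ⟨Real.two_pi_pos⟩

/-- The circle `S¹ = ℝ / 2πℤ`, with angular coordinate `θ`. -/
abbrev S1 : Type := AddCircle (2 * π)

/-- The `𝕜`-valued functions on the circle that are `C^∞` in the angular coordinate. -/
def smoothSubmodule (𝕜 : Type) [RCLike 𝕜] : Submodule 𝕜 (S1 → 𝕜) where
  carrier := {f | ContDiff ℝ ∞ (fun x : ℝ => f (x : S1))}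
  add_mem' {f g} hf hg := by
    change ContDiff ℝ ∞ (fun x : ℝ => f (x : S1) + g (x : S1))
    exact ContDiff.add hf hg
  zero_mem' := by
    change ContDiff ℝ ∞ (fun _ : ℝ => (0 : 𝕜))
    exact contDiff_const
  smul_mem' c f hf := by
    change ContDiff ℝ ∞ (fun x : ℝ => c • f (x : S1))
    exact ContDiff.const_smul c hf

/-- `C^∞(S¹, 𝕜)`. It is a type of its own because it carries the topology of uniform convergence
of all derivatives (below), and not the topology of pointwise convergence. -/
def CircleFun (𝕜 : Type) [RCLike 𝕜] : Type := ↥(smoothSubmodule 𝕜)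

instance (𝕜 : Type) [RCLike 𝕜] : AddCommGroup (CircleFun 𝕜) :=
  inferInstanceAs (AddCommGroup ↥(smoothSubmodule 𝕜))

instance (𝕜 : Type) [RCLike 𝕜] : Module 𝕜 (CircleFun 𝕜) :=
  inferInstanceAs (Module 𝕜 ↥(smoothSubmodule 𝕜))

/-- The underlying function. -/
def CircleFun.toFun {𝕜 : Type} [RCLike 𝕜] (f : CircleFun 𝕜) : S1 → 𝕜 := f.1

instance (𝕜 : Type) [RCLike 𝕜] : CoeFun (CircleFun 𝕜) (fun _ => S1 → 𝕜) := ⟨CircleFun.toFun⟩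

/-- Build an element of `C^∞(S¹, 𝕜)` from a function. -/
def CircleFun.ofFun {𝕜 : Type} [RCLike 𝕜] (f : S1 → 𝕜)
    (hf : ContDiff ℝ ∞ (fun x : ℝ => f (x : S1))) : CircleFun 𝕜 := ⟨f, hf⟩

section Basic

variable {𝕜 : Type} [RCLike 𝕜]

theorem CircleFun.contDiff (f : CircleFun 𝕜) : ContDiff ℝ ∞ (fun x : ℝ => f (x : S1)) := f.2

theorem CircleFun.ext {f g : CircleFun 𝕜} (h : ∀ x : ℝ, f (x : S1) = g (x : S1)) : f = g := by
  apply Subtype.ext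
  funext x
  induction x using QuotientAddGroup.induction_on with
  | H x => exact h x

@[simp] theorem CircleFun.add_apply (f g : CircleFun 𝕜) (x : S1) : (f + g) x = f x + g x := rfl

@[simp] theorem CircleFun.smul_apply (c : 𝕜) (f : CircleFun 𝕜) (x : S1) :
    (c • f) x = c * f x := rfl

@[simp] theorem CircleFun.zero_apply (x : S1) : (0 : CircleFun 𝕜) x = 0 := rfl

theorem CircleFun.continuous (f : CircleFun 𝕜) : Continuous (f : S1 → 𝕜) :=
  (QuotientAddGroup.isQuotientMap_mk (AddSubgroup.zmultiples (2 * π))).continuous_iff.2 f.contDiff.continuous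

/-- A smooth function on the circle as a continuous function (with the sup norm). -/
def CircleFun.toC (f : CircleFun 𝕜) : C(S1, 𝕜) := ⟨f, f.continuous⟩

theorem periodic_deriv (f : CircleFun 𝕜) :
    Function.Periodic (deriv (fun x : ℝ => f (x : S1))) (2 * π) := by
  intro x
  rw [← deriv_comp_add_const (f := fun x : ℝ => f (x : S1))]
  congr 1
  funext y
  rw [AddCircle.coe_add_period]

/-- The derivative `f' = df/dθ` of a smooth function on the circle. -/
def CircleFun.D (f : CircleFun 𝕜) : CircleFun 𝕜 :=
  CircleFun.ofFun (periodic_deriv f).lift (contDiff_infty_iff_deriv.1 f.contDiff).2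

theorem CircleFun.D_coe (f : CircleFun 𝕜) (x : ℝ) :
    f.D (x : S1) = deriv (fun x : ℝ => f (x : S1)) x := rfl

theorem CircleFun.hasDerivAt (f : CircleFun 𝕜) (x : ℝ) :
    HasDerivAt (fun x : ℝ => f (x : S1)) (f.D (x : S1)) x :=
  ((f.contDiff.differentiable (by simp)) x).hasDerivAt

/-- The Fréchet topology of `C^∞(S¹, 𝕜)`: uniform convergence of all derivatives. -/
instance : TopologicalSpace (CircleFun 𝕜) :=
  TopologicalSpace.induced (fun f (k : ℕ) => (CircleFun.D^[k] f).toC) inferInstance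

end Basic

/-- A real function as a complex one. -/
def CircleFun.toComplex (f : CircleFun ℝ) : CircleFun ℂ :=
  CircleFun.ofFun (fun x => (f x : ℂ)) (Complex.ofRealCLM.contDiff.comp f.contDiff)

/-- Pointwise product. -/
def CircleFun.mul (f g : CircleFun ℂ) : CircleFun ℂ :=
  CircleFun.ofFun (fun x => f x * g x) (ContDiff.mul f.contDiff g.contDiff)

/-- The `n`-th Fourier coefficient `(1/2π) ∫ f(θ) e^{-inθ} dθ`. -/
def fhat (f : CircleFun ℂ) (n : ℤ) : ℂ := fourierCoeff (f : S1 → ℂ) n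

theorem integrable_circle (f : CircleFun ℂ) :
    Integrable (f : S1 → ℂ) AddCircle.haarAddCircle :=
  f.continuous.integrable_of_hasCompactSupport (HasCompactSupport.of_compactSpace _)

theorem fhat_add (f g : CircleFun ℂ) (n : ℤ) : fhat (f + g) n = fhat f n + fhat g n :=
  congrFun (fourierCoeff.add (integrable_circle f) (integrable_circle g)) n

theorem fhat_smul (c : ℂ) (f : CircleFun ℂ) (n : ℤ) : fhat (c • f) n = c * fhat f n :=
  fourierCoeff.const_mul (f : S1 → ℂ) c n

theorem fhat_eq (f : CircleFun ℂ) (n : ℤ) :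
    fhat f n = (1 / (2 * π)) • ∫ x in (0 : ℝ)..0 + 2 * π, fourier (T := 2 * π) (-n) x • f x :=
  fourierCoeff_eq_intervalIntegral _ n 0

theorem fourier_expr (n : ℤ) (x : ℝ) :
    fourier (T := 2 * π) n (x : S1) = Complex.exp (Complex.I * n * x) := by
  rw [fourier_coe_apply]
  congr 1
  have : (π : ℂ) ≠ 0 := by exact_mod_cast Real.pi_ne_zero
  push_cast
  field_simp

theorem fhat_D (f : CircleFun ℂ) (n : ℤ) : fhat f.D n = Complex.I * n * fhat f n := by
  have h1 : ∀ x : ℝ, HasDerivAt (fun x : ℝ => fourier (T := 2 * π) (-n) (x : S1))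
      (-(Complex.I * n) * fourier (T := 2 * π) (-n) (x : S1)) x := by
    intro x
    have : (fun x : ℝ => fourier (T := 2 * π) (-n) (x : S1))
        = fun x : ℝ => Complex.exp (-(Complex.I * n) * x) := by
      funext x
      rw [fourier_expr]
      push_cast
      ring_nf
    rw [this, fourier_expr]
    have h := ((hasDerivAt_id x).ofReal_comp.const_mul (-(Complex.I * (n : ℂ)))).cexp
    convert h using 1
    simp only [id]
    ring_nf
    simp
  have hc1 : Continuous (fun x : ℝ => fourier (T := 2 * π) (-n) (x : S1)) :=
    (map_continuous _).comp (AddCircle.continuous_mk' _)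
  have h := intervalIntegral.integral_mul_deriv_eq_deriv_mul (a := 0) (b := 0 + 2 * π)
    (u := fun x : ℝ => fourier (T := 2 * π) (-n) (x : S1))
    (v := fun x : ℝ => f (x : S1)) (fun x _ => h1 x) (fun x _ => f.hasDerivAt x)
    ((continuous_const.mul hc1).intervalIntegrable _ _)
    ((f.D.contDiff.continuous).intervalIntegrable _ _)
  rw [fhat_eq, fhat_eq]
  simp only [smul_eq_mul] at h ⊢
  rw [h]
  simp only [mul_assoc, neg_mul]
  rw [AddCircle.coe_add_period, intervalIntegral.integral_neg,
    sub_self, zero_sub, neg_neg, intervalIntegral.integral_const_mul,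
    intervalIntegral.integral_const_mul]
  simp only [Complex.real_smul]
  ring

theorem norm_fhat_le (f : CircleFun ℂ) (n : ℤ) : ‖fhat f n‖ ≤ ‖f.toC‖ := by
  unfold fhat fourierCoeff
  refine (norm_integral_le_of_norm_le_const (C := ‖f.toC‖) ?_).trans (by simp)
  refine Eventually.of_forall fun x => ?_
  rw [norm_smul]
  have : ‖fourier (T := 2 * π) (-n) x‖ = 1 := by
    rw [fourier_apply, Circle.norm_coe]
  rw [this, one_mul]
  exact f.toC.norm_coe_le_norm x

theorem fhat_iterate_D (f : CircleFun ℂ) (k : ℕ) (n : ℤ) :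
    fhat (CircleFun.D^[k] f) n = (Complex.I * n) ^ k * fhat f n := by
  induction k with
  | zero => simp
  | succ k ih => rw [Function.iterate_succ_apply', fhat_D, ih]; ring

/-- The Fourier coefficients of a smooth function decay rapidly. -/
theorem summable_pow_mul_fhat (f : CircleFun ℂ) (k : ℕ) :
    Summable (fun n : ℤ => |(n : ℝ)| ^ k * ‖fhat f n‖) := by
  have hs : Summable (fun n : ℤ => ‖(CircleFun.D^[k + 2] f).toC‖ * (1 / |(n : ℝ)| ^ 2)) := by
    refine Summable.mul_left _ ?_
    simpa using Real.summable_one_div_int_pow.2 (by norm_num : 1 < 2)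
  refine hs.of_norm_bounded_eventually ?_
  have : ({0} : Set ℤ)ᶜ ∈ (cofinite : Filter ℤ) := (Set.finite_singleton 0).compl_mem_cofinite
  filter_upwards [this] with n hn
  have hn0 : 0 < |(n : ℝ)| := by simpa using hn
  have h := norm_fhat_le (CircleFun.D^[k + 2] f) n
  rw [fhat_iterate_D, norm_mul, norm_pow, norm_mul, Complex.norm_I, one_mul,
    Complex.norm_intCast] at h
  rw [Real.norm_of_nonneg (by positivity), mul_one_div, le_div_iff₀ (by positivity)]
  calc _ = |(n : ℝ)| ^ (k + 2) * ‖fhat f n‖ := by ring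
    _ ≤ _ := h

/-- The smooth function `∑ₙ cₙ e^{inθ}` with rapidly decreasing coefficients `c`. -/
def synthFun (c : ℤ → ℂ) (x : S1) : ℂ := ∑' n : ℤ, c n * fourier (T := 2 * π) n x

theorem iteratedDeriv_mul_fourier (a : ℂ) (n : ℤ) (k : ℕ) :
    iteratedDeriv k (fun x : ℝ => a * fourier (T := 2 * π) n (x : S1))
      = fun x : ℝ => (a * (Complex.I * n) ^ k) * fourier (T := 2 * π) n (x : S1) := by
  induction k with
  | zero => funext x; simp
  | succ k ih =>
    rw [iteratedDeriv_succ, ih]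
    funext x
    have : (fun x : ℝ => (a * (Complex.I * n) ^ k) * fourier (T := 2 * π) n (x : S1))
        = fun x : ℝ => (a * (Complex.I * n) ^ k) * Complex.exp ((Complex.I * n) * x) := by
      funext x
      rw [fourier_expr]
    rw [this, fourier_expr]
    have h := (((hasDerivAt_id x).ofReal_comp.const_mul (Complex.I * (n : ℂ))).cexp).const_mul
      (a * (Complex.I * n) ^ k)
    simp only [id] at h
    rw [h.deriv]
    push_cast
    ring

theorem norm_fourier_apply (n : ℤ) (x : S1) : ‖fourier (T := 2 * π) n x‖ = 1 := by
  rw [fourier_apply, Circle.norm_coe]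

theorem contDiff_synthFun {c : ℤ → ℂ} (hc : ∀ k : ℕ, Summable (fun n : ℤ => |(n : ℝ)| ^ k * ‖c n‖)) :
    ContDiff ℝ ∞ (fun x : ℝ => synthFun c (x : S1)) := by
  unfold synthFun
  refine contDiff_tsum (v := fun (k : ℕ) (n : ℤ) => |(n : ℝ)| ^ k * ‖c n‖) (fun n => ?_) (fun k _ => hc k)
    (fun k n x _ => ?_)
  · have : (fun x : ℝ => c n * fourier (T := 2 * π) n (x : S1))
        = fun x : ℝ => c n * Complex.exp ((Complex.I * n) * x) := by
      funext x
      rw [fourier_expr]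
    rw [this]
    exact contDiff_const.mul (Complex.contDiff_exp.comp
      (contDiff_const.mul Complex.ofRealCLM.contDiff))
  · rw [norm_iteratedFDeriv_eq_norm_iteratedDeriv, iteratedDeriv_mul_fourier, norm_mul,
      norm_fourier_apply, norm_mul, norm_pow, norm_mul, Complex.norm_I, one_mul,
      Complex.norm_intCast, mul_one, mul_comm]

/-- The smooth function with given rapidly decreasing Fourier coefficients. -/
def synth (c : ℤ → ℂ) (hc : ∀ k : ℕ, Summable (fun n : ℤ => |(n : ℝ)| ^ k * ‖c n‖)) :
    CircleFun ℂ := CircleFun.ofFun (synthFun c) (contDiff_synthFun hc)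

theorem fhat_synth (c : ℤ → ℂ) (hc : ∀ k : ℕ, Summable (fun n : ℤ => |(n : ℝ)| ^ k * ‖c n‖))
    (m : ℤ) : fhat (synth c hc) m = c m := by
  have hcont : ∀ n : ℤ, Continuous fun x : S1 =>
      fourier (T := 2 * π) (-m) x * (c n * fourier (T := 2 * π) n x) := fun n => by fun_prop
  have hnorm : ∀ (n : ℤ) (x : S1),
      ‖fourier (T := 2 * π) (-m) x * (c n * fourier (T := 2 * π) n x)‖ = ‖c n‖ := fun n x => by
    rw [norm_mul, norm_mul, norm_fourier_apply, norm_fourier_apply, one_mul, mul_one]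
  have h0 : Summable fun n : ℤ => ‖c n‖ := by simpa using hc 0
  have h := hasSum_integral_of_summable_integral_norm (μ := AddCircle.haarAddCircle (T := 2 * π))
    (F := fun (n : ℤ) (x : S1) => fourier (T := 2 * π) (-m) x * (c n * fourier (T := 2 * π) n x))
    (fun n => (hcont n).integrable_of_hasCompactSupport (HasCompactSupport.of_compactSpace _))
    (by simpa only [hnorm, integral_const, probReal_univ, one_smul] using h0)
  have hF : ∀ n : ℤ, ∫ x : S1, fourier (T := 2 * π) (-m) x * (c n * fourier (T := 2 * π) n x)
      ∂AddCircle.haarAddCircle = if n = m then c m else 0 := by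
    intro n
    have h1 : ∫ x : S1, fourier (T := 2 * π) (-m) x * (c n * fourier (T := 2 * π) n x)
        ∂AddCircle.haarAddCircle
        = c n * fourierCoeff (T := 2 * π) (fourier (T := 2 * π) n) m := by
      rw [fourierCoeff, ← integral_const_mul]
      congr 1
      funext x
      simp only [smul_eq_mul]
      ring
    rw [h1, fourierCoeff_fourier, Pi.single_apply]
    by_cases hnm : n = m
    · subst hnm; simp
    · simp [hnm, Ne.symm hnm]
  simp only [hF] at h
  have h2 : ∑' n : ℤ, (if n = m then c m else 0) = c m := tsum_ite_eq m (fun _ => c m)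
  have h3 := h.tsum_eq
  rw [h2] at h3
  rw [h3]
  unfold fhat fourierCoeff
  congr 1
  funext x
  simp only [smul_eq_mul]
  rw [tsum_mul_left]
  rfl

/-! ### The complex structure at the origin -/

/-- The Fourier coefficients `u_m` of a real function. -/
def rhat (u : CircleFun ℝ) (m : ℤ) : ℂ := fhat u.toComplex m

theorem rhat_neg (u : CircleFun ℝ) (m : ℤ) : rhat u (-m) = conj (rhat u m) := by
  unfold rhat fhat fourierCoeff
  rw [← integral_conj]
  congr 1
  funext x
  simp only [smul_eq_mul, map_mul, ← fourier_neg]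
  congr 1
  exact (Complex.conj_ofReal _).symm

/-- The Fourier coefficients `-i sgn(m) u_m` of the conjugate series. -/
def conjCoeff (u : CircleFun ℝ) (m : ℤ) : ℂ := -(Complex.I * (m.sign : ℂ) * rhat u m)

theorem norm_sign_le (m : ℤ) : ‖((m.sign : ℤ) : ℂ)‖ ≤ 1 := by
  rcases lt_trichotomy m 0 with h | h | h
  · simp [Int.sign_eq_neg_one_of_neg h]
  · simp [h]
  · simp [Int.sign_eq_one_of_pos h]

theorem conjCoeff_decay (u : CircleFun ℝ) (k : ℕ) :
    Summable (fun n : ℤ => |(n : ℝ)| ^ k * ‖conjCoeff u n‖) := by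
  refine (summable_pow_mul_fhat u.toComplex k).of_nonneg_of_le (fun n => by positivity)
    (fun n => ?_)
  refine mul_le_mul_of_nonneg_left ?_ (by positivity)
  rw [conjCoeff, norm_neg, norm_mul, norm_mul, Complex.norm_I, one_mul]
  calc _ ≤ 1 * ‖rhat u n‖ := mul_le_mul_of_nonneg_right (norm_sign_le n) (norm_nonneg _)
    _ = _ := one_mul _

theorem conjCoeff_neg (u : CircleFun ℝ) (m : ℤ) : conjCoeff u (-m) = conj (conjCoeff u m) := by
  simp [conjCoeff, rhat_neg]

/-- Conjugation of Fourier series: `u = ∑ u_m e^{imθ}` goes to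
`u* = -∑ i sgn(m) u_m e^{imθ}`. The sum is real (see `rhat_conjFun`). -/
def conjFun (u : CircleFun ℝ) : CircleFun ℝ :=
  CircleFun.ofFun (fun x => (synthFun (conjCoeff u) x).re)
    (Complex.reCLM.contDiff.comp (contDiff_synthFun (conjCoeff_decay u)))

theorem synthFun_conjCoeff_real (u : CircleFun ℝ) (x : S1) :
    ((synthFun (conjCoeff u) x).re : ℂ) = synthFun (conjCoeff u) x := by
  rw [← Complex.conj_eq_iff_re]
  unfold synthFun
  rw [Complex.conj_tsum, ← (Equiv.neg ℤ).tsum_eq]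
  congr 1
  funext n
  simp only [Equiv.neg_apply, map_mul, ← conjCoeff_neg, ← fourier_neg, neg_neg]

theorem rhat_conjFun (u : CircleFun ℝ) (m : ℤ) :
    rhat (conjFun u) m = -(Complex.I * (m.sign : ℂ) * rhat u m) := by
  have : (conjFun u).toComplex = synth (conjCoeff u) (conjCoeff_decay u) :=
    CircleFun.ext fun x => synthFun_conjCoeff_real u x
  rw [rhat, this, fhat_synth, conjCoeff]

theorem rhat_add (u v : CircleFun ℝ) (m : ℤ) : rhat (u + v) m = rhat u m + rhat v m := by
  have : (u + v).toComplex = u.toComplex + v.toComplex :=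
    CircleFun.ext fun x => Complex.ofReal_add _ _
  rw [rhat, this, fhat_add, rhat, rhat]

theorem rhat_smul (c : ℝ) (u : CircleFun ℝ) (m : ℤ) : rhat (c • u) m = c * rhat u m := by
  have : (c • u).toComplex = (c : ℂ) • u.toComplex :=
    CircleFun.ext fun x => Complex.ofReal_mul _ _
  rw [rhat, this, fhat_smul, rhat]

theorem rhat_zero (m : ℤ) : rhat 0 m = 0 := by
  have h := rhat_smul 0 0 m
  simpa using h

/-- The tangent space at the origin of `M`: the smooth real vector fields `u(θ) ∂/∂θ` with
`u₋₁ = u₀ = u₁ = 0`. -/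
def TangentOrigin : Submodule ℝ (CircleFun ℝ) where
  carrier := {u | rhat u (-1) = 0 ∧ rhat u 0 = 0 ∧ rhat u 1 = 0}
  add_mem' {u v} hu hv := by
    obtain ⟨a, b, c⟩ := hu
    obtain ⟨a', b', c'⟩ := hv
    simp [rhat_add, *]
  zero_mem' := ⟨rhat_zero _, rhat_zero _, rhat_zero _⟩
  smul_mem' r u hu := by
    obtain ⟨a, b, c⟩ := hu
    simp [rhat_smul, *]

/-- The almost complex structure `J` at the origin of `M`. -/
def J (u : TangentOrigin) : TangentOrigin :=
  ⟨conjFun u.1, by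
    obtain ⟨a, b, c⟩ := u.2
    refine ⟨?_, ?_, ?_⟩ <;> rw [rhat_conjFun] <;> simp [a, b, c]⟩

/-! ### The group of diffeomorphisms of the circle and the homogeneous space `M` -/

/-- `φ : ℝ → ℝ` is the lift of an orientation preserving `C^∞` diffeomorphism of `S¹`. -/
structure IsDiffeoLift (φ : ℝ → ℝ) : Prop where
  smooth : ContDiff ℝ ∞ φ
  deriv_pos : ∀ x, 0 < deriv φ x
  period : ∀ x, φ (x + 2 * π) = φ x + 2 * π

theorem IsDiffeoLift.id : IsDiffeoLift (fun x => x) where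
  smooth := contDiff_id
  deriv_pos x := by simp
  period x := rfl

theorem IsDiffeoLift.comp {φ ψ : ℝ → ℝ} (hφ : IsDiffeoLift φ) (hψ : IsDiffeoLift ψ) :
    IsDiffeoLift (fun x => φ (ψ x)) where
  smooth := hφ.smooth.comp hψ.smooth
  deriv_pos x := by
    have h := ((hφ.smooth.differentiable (by simp)) (ψ x)).hasDerivAt.comp x
      ((hψ.smooth.differentiable (by simp)) x).hasDerivAt
    rw [show (fun x => φ (ψ x)) = φ ∘ ψ from rfl, h.deriv]
    exact mul_pos (hφ.deriv_pos _) (hψ.deriv_pos _)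
  period x := by rw [hψ.period, hφ.period]

theorem IsDiffeoLift.exists_inverse {φ : ℝ → ℝ} (hφ : IsDiffeoLift φ) :
    ∃ ψ, IsDiffeoLift ψ ∧ (∀ x, φ (ψ x) = x) ∧ ∀ x, ψ (φ x) = x := by
  have hmono : StrictMono φ := strictMono_of_deriv_pos hφ.deriv_pos
  have hper : Function.Periodic (fun x => φ x - x) (2 * π) := fun x => by
    simp only [hφ.period]; ring
  have hint : ∀ n : ℤ, φ (n * (2 * π)) = φ 0 + n * (2 * π) := fun n => by
    have h := hper.int_mul n 0
    simp only [zero_add, sub_zero] at h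
    linarith
  have hsurj : Function.Surjective φ := by
    intro y
    obtain ⟨n, hn⟩ := exists_int_gt ((y - φ 0) / (2 * π))
    obtain ⟨m, hm⟩ := exists_int_lt ((y - φ 0) / (2 * π))
    rw [div_lt_iff₀ Real.two_pi_pos] at hn
    rw [lt_div_iff₀ Real.two_pi_pos] at hm
    refine mem_range_of_exists_le_of_exists_ge hφ.smooth.continuous ⟨m * (2 * π), ?_⟩
      ⟨n * (2 * π), ?_⟩
    · rw [hint]; linarith
    · rw [hint]; linarith
  let e : ℝ ≃o ℝ := hmono.orderIsoOfSurjective φ hsurj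
  have he : ∀ x, e x = φ x := fun x => rfl
  have h1 : ∀ x, φ (e.symm x) = x := fun x => e.apply_symm_apply x
  have h2 : ∀ x, e.symm (φ x) = x := fun x => e.symm_apply_apply x
  have hd : ∀ x, HasDerivAt φ (deriv φ x) x := fun x =>
    ((hφ.smooth.differentiable (by simp)) x).hasDerivAt
  have hs : ContDiff ℝ ∞ (fun x => e.symm x) :=
    e.toHomeomorph.contDiff_symm_deriv (f' := deriv φ) (fun x => (hφ.deriv_pos x).ne') hd
      hφ.smooth
  refine ⟨fun x => e.symm x, ⟨hs, fun x => ?_, fun x => ?_⟩, h1, h2⟩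
  · have h3 := (hd (e.symm x)).comp x ((hs.differentiable (by simp)) x).hasDerivAt
    have h4 : (φ ∘ fun x => e.symm x) = fun x => x := funext h1
    rw [h4] at h3
    have h5 := h3.unique (hasDerivAt_id' x)
    by_contra hneg
    have := mul_nonpos_of_nonneg_of_nonpos (hφ.deriv_pos (e.symm x)).le (not_lt.1 hneg)
    linarith
  · apply hmono.injective
    simp only [h1, hφ.period]

/-- The map of the circle with lift `φ`. -/
def circleMapOfLift (φ : ℝ → ℝ) (hφ : IsDiffeoLift φ) : S1 → S1 :=
  Function.Periodic.lift (f := fun x : ℝ => ((φ x : ℝ) : S1)) (c := 2 * π) fun x => by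
    simp only [hφ.period, AddCircle.coe_add_period]

theorem circleMapOfLift_coe {φ : ℝ → ℝ} (hφ : IsDiffeoLift φ) (x : ℝ) :
    circleMapOfLift φ hφ (x : S1) = ((φ x : ℝ) : S1) := rfl

/-- `Diff(S¹)`: the orientation preserving `C^∞` diffeomorphisms of the circle, under
composition. -/
def DiffS1 : Subgroup (Equiv.Perm S1) where
  carrier := {F | ∃ φ : ℝ → ℝ, IsDiffeoLift φ ∧ ∀ x : ℝ, F (x : S1) = ((φ x : ℝ) : S1)}
  mul_mem' := by
    rintro F G ⟨φ, hφ, hF⟩ ⟨ψ, hψ, hG⟩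
    exact ⟨_, hφ.comp hψ, fun x => by rw [Equiv.Perm.mul_apply, hG, hF]⟩
  one_mem' := ⟨_, IsDiffeoLift.id, fun x => rfl⟩
  inv_mem' := by
    rintro F ⟨φ, hφ, hF⟩
    obtain ⟨ψ, hψ, h1, -⟩ := hφ.exists_inverse
    refine ⟨ψ, hψ, fun x => ?_⟩
    rw [Equiv.Perm.inv_eq_iff_eq, hF, h1]

instance : CoeFun DiffS1 (fun _ => S1 → S1) := ⟨fun F => F.1⟩

theorem exists_diffS1_of_lift {φ : ℝ → ℝ} (hφ : IsDiffeoLift φ) :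
    ∃ F : DiffS1, ∀ x : ℝ, F (x : S1) = ((φ x : ℝ) : S1) := by
  obtain ⟨ψ, hψ, h1, h2⟩ := hφ.exists_inverse
  let e : Equiv.Perm S1 :=
    { toFun := circleMapOfLift φ hφ
      invFun := circleMapOfLift ψ hψ
      left_inv := fun x => by
        induction x using QuotientAddGroup.induction_on with
        | H x => exact congrArg _ (h2 x)
      right_inv := fun x => by
        induction x using QuotientAddGroup.induction_on with
        | H x => exact congrArg _ (h1 x) }
  exact ⟨⟨e, φ, hφ, fun x => rfl⟩, fun x => rfl⟩

theorem moebius_denom_ne {a b : ℂ} (h : ‖b‖ < ‖a‖) (z : Circle) : conj b * z + conj a ≠ 0 := by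
  intro h0
  have h1 : conj a = -(conj b * z) := by linear_combination h0
  have h2 := congrArg norm h1
  rw [norm_neg, norm_mul, Circle.norm_coe, mul_one, RCLike.norm_conj, RCLike.norm_conj] at h2
  exact h.ne h2.symm

theorem norm_lt_norm_iff_normSq (a b : ℂ) : ‖b‖ < ‖a‖ ↔ Complex.normSq b < Complex.normSq a := by
  rw [Complex.normSq_eq_norm_sq, Complex.normSq_eq_norm_sq]
  exact (sq_lt_sq₀ (norm_nonneg _) (norm_nonneg _)).symm

/-- `Möb(S¹) ≅ PSL(2, ℝ)`: the diffeomorphisms of the circle `|z| = 1`, `z = e^{iθ}`, that are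
given by a Möbius transformation `z ↦ (az + b)/(b̄z + ā)`, `|b| < |a|`, of the unit disc. -/
def Moeb : Subgroup DiffS1 where
  carrier := {F | ∃ a b : ℂ, ‖b‖ < ‖a‖ ∧ ∀ x : S1, ((F x).toCircle : ℂ) =
    (a * (x.toCircle : ℂ) + b) / (conj b * (x.toCircle : ℂ) + conj a)}
  mul_mem' := by
    rintro F G ⟨a, b, h, hF⟩ ⟨c, d, h', hG⟩
    have key : ‖a * d + b * conj c‖ < ‖a * c + b * conj d‖ := by
      rw [norm_lt_norm_iff_normSq] at *
      have : Complex.normSq (a * c + b * conj d) - Complex.normSq (a * d + b * conj c)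
          = (Complex.normSq a - Complex.normSq b) * (Complex.normSq c - Complex.normSq d) := by
        simp only [Complex.normSq_apply, Complex.add_re, Complex.add_im, Complex.mul_re,
          Complex.mul_im, Complex.conj_re, Complex.conj_im]
        ring
      have h2 := mul_pos (sub_pos.2 h) (sub_pos.2 h')
      linarith
    refine ⟨a * c + b * conj d, a * d + b * conj c, key, fun x => ?_⟩
    have e : (F * G : DiffS1) x = F (G x) := rfl
    have n1 := moebius_denom_ne h' x.toCircle
    have n2 := moebius_denom_ne h (G x).toCircle
    have n3 := moebius_denom_ne key x.toCircle
    have hw := hG x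
    rw [eq_div_iff n1] at hw
    rw [e, hF, div_eq_div_iff n2 n3]
    simp only [map_add, map_mul, Complex.conj_conj]
    linear_combination (a * conj a - b * conj b) * hw
  one_mem' := ⟨1, 0, by simp, fun x => by
    have e : (1 : DiffS1) x = x := rfl
    rw [e]; simp⟩
  inv_mem' := by
    rintro F ⟨a, b, h, hF⟩
    have key : ‖-b‖ < ‖conj a‖ := by rwa [norm_neg, RCLike.norm_conj]
    refine ⟨conj a, -b, key, fun x => ?_⟩
    obtain ⟨y, rfl⟩ : ∃ y, F y = x := F.1.surjective x
    have e : (F⁻¹ : DiffS1) (F y) = y := F.1.symm_apply_apply y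
    have n1 := moebius_denom_ne h y.toCircle
    have n2 := moebius_denom_ne key (F y).toCircle
    have hw := hF y
    rw [eq_div_iff n1] at hw
    rw [e, eq_div_iff n2]
    simp only [map_neg, Complex.conj_conj]
    linear_combination -hw

/-- `M = Diff(S¹)/Möb(S¹)`, the space of cosets `Möb(S¹) ∘ φ`, on which `Diff(S¹)` acts by right
translations. -/
def M : Type := Quotient (QuotientGroup.rightRel Moeb)

/-- The projection `Diff(S¹) → M`. -/
def toM (φ : DiffS1) : M := Quotient.mk _ φ

/-- The vector fields `f(θ) ∂/∂θ` for which `θ ↦ θ + f(θ)` is a diffeomorphism. This is an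
open convex subset of the Fréchet space `C^∞(S¹, ℝ)`. -/
def diffDomain : Set (CircleFun ℝ) := {f | ∀ x : S1, -1 < f.D x}

theorem isDiffeoLift_of_mem {f : CircleFun ℝ} (hf : f ∈ diffDomain) :
    IsDiffeoLift (fun x : ℝ => x + f (x : S1)) where
  smooth := contDiff_id.add f.contDiff
  deriv_pos x := by
    have h : HasDerivAt (fun x : ℝ => x + f (x : S1)) (1 + f.D (x : S1)) x :=
      (hasDerivAt_id' x).add (f.hasDerivAt x)
    rw [h.deriv]
    linarith [hf (x : S1)]
  period x := by rw [AddCircle.coe_add_period]; ring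

open Classical in
/-- The diffeomorphism `θ ↦ θ + f(θ)` (for `f ∈ diffDomain`; the identity otherwise).
On `diffDomain` this is the universal covering of the Fréchet Lie group `Diff(S¹)`. -/
def toDiff (f : CircleFun ℝ) : DiffS1 :=
  if hf : f ∈ diffDomain then (exists_diffS1_of_lift (isDiffeoLift_of_mem hf)).choose else 1

theorem toDiff_apply {f : CircleFun ℝ} (hf : f ∈ diffDomain) (x : ℝ) :
    toDiff f (x : S1) = ((x + f (x : S1) : ℝ) : S1) := by
  rw [toDiff, dif_pos hf]
  exact (exists_diffS1_of_lift (isDiffeoLift_of_mem hf)).choose_spec x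

/-! ### The symplectic space `V` and its polarizations -/

/-- The constant functions. -/
def constFun : Submodule ℂ (CircleFun ℂ) where
  carrier := {f | ∃ c : ℂ, ∀ x, f x = c}
  add_mem' := by
    rintro f g ⟨c, hc⟩ ⟨d, hd⟩
    exact ⟨c + d, fun x => by rw [CircleFun.add_apply, hc, hd]⟩
  zero_mem' := ⟨0, fun x => rfl⟩
  smul_mem' := by
    rintro r f ⟨c, hc⟩
    exact ⟨r * c, fun x => by rw [CircleFun.smul_apply, hc]⟩

/-- `V_ℂ = C^∞(S¹, ℂ)/ℂ`, the complexification of `V = C^∞(S¹, ℝ)/ℝ`. -/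
abbrev VC : Type := CircleFun ℂ ⧸ constFun

/-- Precomposition `σ ↦ σ ∘ φ` on functions. -/
def precomp (φ : DiffS1) : CircleFun ℂ →ₗ[ℂ] CircleFun ℂ where
  toFun σ := CircleFun.ofFun (fun x => σ (φ x)) <| by
    obtain ⟨ψ, hψ, h⟩ := φ.2
    have : (fun x : ℝ => σ (φ (x : S1))) = (fun x : ℝ => σ (x : S1)) ∘ ψ := by
      funext x
      exact congrArg σ.toFun (h x)
    rw [this]
    exact σ.contDiff.comp hψ.smooth
  map_add' _ _ := rfl
  map_smul' _ _ := rfl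

/-- The (symplectic) automorphism `T_φ : σ ↦ σ ∘ φ` of `V_ℂ`. -/
def T (φ : DiffS1) : VC →ₗ[ℂ] VC :=
  constFun.mapQ constFun (precomp φ) (by
    rintro f ⟨c, hc⟩
    exact ⟨c, fun x => hc (φ x)⟩)

/-- `W₊ ⊆ V_ℂ`: the classes of the functions without Fourier components of negative index
(modulo constants: with components of positive index only). -/
def Wplus : Submodule ℂ VC :=
  Submodule.map constFun.mkQ
    { carrier := {σ | ∀ n < 0, fhat σ n = 0}
      add_mem' := fun hf hg n hn => by rw [fhat_add, hf n hn, hg n hn, add_zero]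
      zero_mem' := fun n _ => by simpa using fhat_smul 0 0 n
      smul_mem' := fun c f hf n hn => by rw [fhat_smul, hf n hn, mul_zero] }

theorem fhat_const {f : CircleFun ℂ} (hf : f ∈ constFun) {n : ℤ} (hn : n ≠ 0) : fhat f n = 0 := by
  obtain ⟨c, hc⟩ := hf
  have hD : f.D = (0 : ℂ) • f := CircleFun.ext fun x => by
    rw [CircleFun.D_coe, show (fun x : ℝ => f (x : S1)) = fun _ => c from funext fun x => hc x]
    simp
  have h := fhat_D f n
  rw [hD, fhat_smul, zero_mul] at h
  have hn' : (n : ℂ) ≠ 0 := by exact_mod_cast hn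
  simpa [hn'] using h.symm

/-! The Hermitian form `⟨w₁, w₂⟩ = -(i/2π) S(w̄₁, w₂)` on `W₊` is positive definite with orthonormal
basis `e_k = e^{ikθ}/√k`, `k ≥ 1`. Hence the completion of `W₊` is `ℓ²`, with `σ = ∑ σ_n e^{inθ}`
corresponding to the sequence `(√k σ_k)_{k ≥ 1}`; likewise the completion of `W₋ = conj W₊`
with the orthonormal basis `e_{-k} = e^{-ikθ}/√k`. -/

/-- The Hilbert space completion of `W₊` (and of `W₋`), in the coordinates given by the basis
`(e_k)` (respectively `(e_{-k})`). -/
abbrev Hilb : Type := lp (fun _ : ℕ+ => ℂ) 2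

theorem memℓp_coord (ε : ℤ) (hε : |(ε : ℝ)| = 1) (σ : CircleFun ℂ) :
    Memℓp (fun k : ℕ+ => ((√(k : ℝ) : ℝ) : ℂ) * fhat σ (ε * (k : ℤ))) 2 := by
  apply memℓp_gen
  have hε0 : ε ≠ 0 := by
    rintro rfl
    simp at hε
  have hinj : Function.Injective (fun k : ℕ+ => ε * (k : ℤ)) := fun k l h => by
    have := mul_left_cancel₀ hε0 h
    exact_mod_cast this
  have hs := ((summable_pow_mul_fhat σ 1).comp_injective hinj).mul_left ‖σ.toC‖
  refine hs.of_nonneg_of_le (fun k => by positivity) (fun k => ?_)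
  simp only [ENNReal.toReal_ofNat, Real.rpow_ofNat, Function.comp]
  rw [norm_mul, mul_pow, Complex.norm_real, Real.norm_of_nonneg (Real.sqrt_nonneg _),
    Real.sq_sqrt (by positivity)]
  push_cast
  rw [abs_mul, hε, one_mul, pow_one, abs_of_nonneg (by positivity)]
  have h := norm_fhat_le σ (ε * (k : ℤ))
  have h0 : (0 : ℝ) ≤ (k : ℝ) * ‖fhat σ (ε * (k : ℤ))‖ := by positivity
  calc _ = ((k : ℝ) * ‖fhat σ (ε * (k : ℤ))‖) * ‖fhat σ (ε * (k : ℤ))‖ := by ring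
    _ ≤ ((k : ℝ) * ‖fhat σ (ε * (k : ℤ))‖) * ‖σ.toC‖ := mul_le_mul_of_nonneg_left h h0
    _ = _ := by ring

/-- The coordinates `(√k σ_{εk})_{k ≥ 1}` of `σ ∈ V_ℂ`, for a sign `ε`. -/
def coord (ε : ℤ) (hε : |(ε : ℝ)| = 1) : VC →ₗ[ℂ] Hilb :=
  constFun.liftQ
    { toFun := fun σ => ⟨_, memℓp_coord ε hε σ⟩
      map_add' := fun σ τ => by
        ext k
        change _ * fhat (σ + τ) _ = _ * fhat σ _ + _ * fhat τ _
        rw [fhat_add, mul_add]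
      map_smul' := fun c σ => by
        ext k
        change _ * fhat (c • σ) _ = c * (_ * fhat σ _)
        rw [fhat_smul]
        ring }
    (fun σ hσ => by
      rw [LinearMap.mem_ker]
      ext k
      change _ * fhat σ _ = 0
      have hε0 : ε ≠ 0 := by
        rintro rfl
        simp at hε
      rw [fhat_const hσ (mul_ne_zero hε0 (by exact_mod_cast k.ne_zero)), mul_zero])

/-- The projection `π₊ : V_ℂ → W₊`, in coordinates: `σ ↦ (√k σ_k)_{k ≥ 1}`. -/
def piPlus : VC →ₗ[ℂ] Hilb := coord 1 (by simp)

/-- The projection `π₋ : V_ℂ → W₋`, in coordinates: `σ ↦ (√k σ_{-k})_{k ≥ 1}`. -/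
def piMinus : VC →ₗ[ℂ] Hilb := coord (-1) (by simp)

theorem piPlus_apply (σ : CircleFun ℂ) (k : ℕ+) :
    piPlus (constFun.mkQ σ) k = ((√(k : ℝ) : ℝ) : ℂ) * fhat σ (k : ℤ) := by
  change _ * fhat σ (1 * (k : ℤ)) = _
  rw [one_mul]

theorem piMinus_apply (σ : CircleFun ℂ) (k : ℕ+) :
    piMinus (constFun.mkQ σ) k = ((√(k : ℝ) : ℝ) : ℂ) * fhat σ (-(k : ℤ)) := by
  change _ * fhat σ (-1 * (k : ℤ)) = _
  rw [neg_one_mul]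

/-- `V_ℂ → W₊ ⊕ W₋`, into the completion. -/
def split (σ : VC) : Hilb × Hilb := (piPlus σ, piMinus σ)

/-- The symplectic form `S(σ, τ) = ∫ σ (dτ/dθ) dθ` on functions. -/
def sympl (σ τ : CircleFun ℂ) : ℂ := ∫ x in (0 : ℝ)..2 * π, σ (x : S1) * τ.D (x : S1)

/-- The symplectic form `S` on the completion of `V_ℂ = W₊ ⊕ W₋` (see `sympl_eq`). -/
def symplHilb (p q : Hilb × Hilb) : ℂ :=
  2 * π * Complex.I * ∑' k : ℕ+, (p.2 k * q.1 k - p.1 k * q.2 k)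

theorem summable_norm_fhat (σ : CircleFun ℂ) : Summable fun n => ‖fhat σ n‖ := by
  simpa using summable_pow_mul_fhat σ 0

theorem hasSum_sympl (σ τ : CircleFun ℂ) :
    HasSum (fun n : ℤ => 2 * π * Complex.I * (-n * (fhat σ n * fhat τ (-n)))) (sympl σ τ) := by
  have hcont : ∀ n : ℤ, Continuous fun x : S1 => (fhat σ n * fourier (T := 2 * π) n x) * τ.D x :=
    fun n => by
      have := τ.D.continuous
      fun_prop
  have hint : ∀ n : ℤ, Integrable (fun x : S1 => (fhat σ n * fourier (T := 2 * π) n x) * τ.D x)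
      AddCircle.haarAddCircle := fun n =>
    (hcont n).integrable_of_hasCompactSupport (HasCompactSupport.of_compactSpace _)
  have hsum : Summable fun n : ℤ => ∫ x : S1, ‖(fhat σ n * fourier (T := 2 * π) n x) * τ.D x‖
      ∂AddCircle.haarAddCircle := by
    have : ∀ n : ℤ, ∫ x : S1, ‖(fhat σ n * fourier (T := 2 * π) n x) * τ.D x‖
        ∂AddCircle.haarAddCircle = ‖fhat σ n‖ * ∫ x : S1, ‖τ.D x‖ ∂AddCircle.haarAddCircle := by
      intro n
      rw [← integral_const_mul]
      congr 1
      funext x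
      rw [norm_mul, norm_mul, norm_fourier_apply, mul_one]
    simp only [this]
    exact (summable_norm_fhat σ).mul_right _
  have h := hasSum_integral_of_summable_integral_norm hint hsum
  have h1 : ∀ x : S1, ∑' n : ℤ, (fhat σ n * fourier (T := 2 * π) n x) * τ.D x = σ x * τ.D x := by
    intro x
    rw [tsum_mul_right]
    congr 1
    exact (has_pointwise_sum_fourier_series_of_summable (f := σ.toC)
      (summable_norm_fhat σ).of_norm x).tsum_eq
  simp only [h1] at h
  have h2 : sympl σ τ = (2 * π : ℂ) * ∫ x : S1, σ x * τ.D x ∂AddCircle.haarAddCircle := by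
    have e := fhat_eq (σ.mul τ.D) 0
    have e' : fhat (σ.mul τ.D) 0 = ∫ x : S1, σ x * τ.D x ∂AddCircle.haarAddCircle := by
      unfold fhat fourierCoeff
      congr 1
      funext x
      rw [neg_zero, fourier_zero, one_smul]
      rfl
    rw [← e', e, sympl]
    have hp : (π : ℂ) ≠ 0 := by exact_mod_cast Real.pi_ne_zero
    rw [zero_add, Complex.real_smul]
    push_cast
    rw [← mul_assoc, mul_one_div_cancel (by simp [hp]), one_mul]
    congr 1
    funext x
    rw [neg_zero, fourier_zero, one_smul]
    rfl
  rw [h2]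
  refine (h.mul_left (2 * π : ℂ)).congr_fun ?_
  intro n
  have h3 : ∫ x : S1, (fhat σ n * fourier (T := 2 * π) n x) * τ.D x ∂AddCircle.haarAddCircle
      = fhat σ n * fhat τ.D (-n) := by
    unfold fhat fourierCoeff
    rw [← integral_const_mul]
    congr 1
    funext x
    simp only [smul_eq_mul, neg_neg]
    ring
  rw [h3, fhat_D]
  push_cast
  ring

theorem sympl_eq (σ τ : CircleFun ℂ) :
    sympl σ τ = symplHilb (split (constFun.mkQ σ)) (split (constFun.mkQ τ)) := by
  have h := (hasSum_sympl σ τ).nat_add_neg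
  simp only [Int.cast_zero, neg_zero, zero_mul, mul_zero, add_zero] at h
  have h' := (PNat.coe_injective.hasSum_iff (fun n hn => by
    have : n = 0 := by
      by_contra h0
      exact hn ⟨⟨n, Nat.pos_of_ne_zero h0⟩, rfl⟩
    subst this
    simp)).2 h
  rw [← h'.tsum_eq, symplHilb, ← tsum_mul_left]
  congr 1
  funext k
  simp only [split, piPlus_apply, piMinus_apply, Function.comp]
  have hk : ((√(k : ℝ) : ℝ) : ℂ) * ((√(k : ℝ) : ℝ) : ℂ) = (k : ℂ) := by
    rw [← Complex.ofReal_mul, Real.mul_self_sqrt (by positivity)]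
    simp
  push_cast
  simp only [neg_neg]
  linear_combination (2 * π * Complex.I) *
    (fhat σ k * fhat τ (-k) - fhat σ (-k) * fhat τ k) * hk

/-! ### The infinite dimensional Siegel disc -/

/-- The Hilbert space of Hilbert–Schmidt operators from (the completion of) `W₊` to that of `W₋`,
an operator being given by its matrix `Z(r, s) = ⟨e_{-r}, Z e_s⟩`. -/
abbrev HS : Type := lp (fun _ : ℕ+ × ℕ+ => ℂ) 2

theorem summable_sq (x : Hilb) : Summable fun k => ‖x k‖ ^ 2 := by
  simpa using (lp.memℓp x).summable (by simp)

theorem summable_sq_HS (Z : HS) : Summable fun k => ‖Z k‖ ^ 2 := by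
  simpa using (lp.memℓp Z).summable (by simp)

/-- The `r`-th row of the matrix, conjugated. -/
def rowConj (Z : HS) (r : ℕ+) : Hilb :=
  ⟨fun s => conj (Z (r, s)), memℓp_gen <| by
    have h : Summable fun s => ‖Z (r, s)‖ ^ 2 :=
      (summable_sq_HS Z).comp_injective (i := fun s => (r, s)) (Prod.mk_right_injective r)
    simpa using h⟩

theorem norm_sq_eq {ι : Type} (x : lp (fun _ : ι => ℂ) 2) : ‖x‖ ^ 2 = ∑' i, ‖x i‖ ^ 2 := by
  have h := lp.norm_rpow_eq_tsum (p := 2) (by simp) x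
  simpa using h

theorem hasSum_row (Z : HS) (x : Hilb) (r : ℕ+) :
    HasSum (fun s => Z (r, s) * x s) (inner ℂ (rowConj Z r) x) := by
  refine (lp.hasSum_inner (rowConj Z r) x).congr_fun fun s => ?_
  rw [RCLike.inner_apply]
  change _ = x s * conj (conj (Z (r, s)))
  rw [Complex.conj_conj, mul_comm]

theorem norm_sq_row (Z : HS) (x : Hilb) (r : ℕ+) :
    ‖∑' s, Z (r, s) * x s‖ ^ 2 ≤ (∑' s, ‖Z (r, s)‖ ^ 2) * ‖x‖ ^ 2 := by
  rw [(hasSum_row Z x r).tsum_eq]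
  have h : ‖rowConj Z r‖ ^ 2 = ∑' s, ‖Z (r, s)‖ ^ 2 := by
    rw [norm_sq_eq]
    congr 1
    funext s
    change ‖conj (Z (r, s))‖ ^ 2 = _
    rw [RCLike.norm_conj]
  rw [← h, ← mul_pow]
  exact pow_le_pow_left₀ (norm_nonneg _) (norm_inner_le_norm _ _) 2

theorem summable_rows (Z : HS) : Summable fun r => ∑' s, ‖Z (r, s)‖ ^ 2 :=
  (summable_sq_HS Z).prod

theorem memℓp_opFun (Z : HS) (x : Hilb) : Memℓp (fun r => ∑' s, Z (r, s) * x s) 2 := by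
  apply memℓp_gen
  have h : Summable fun r => ‖∑' s, Z (r, s) * x s‖ ^ 2 :=
    ((summable_rows Z).mul_right (‖x‖ ^ 2)).of_nonneg_of_le (fun r => by positivity)
      (norm_sq_row Z x)
  simpa using h

/-- The bounded operator with matrix `Z`, i.e. `(Zx)(r) = ∑ₛ Z(r, s) x(s)`. -/
def toOp (Z : HS) : Hilb →L[ℂ] Hilb :=
  LinearMap.mkContinuous
    { toFun := fun x => ⟨fun r => ∑' s, Z (r, s) * x s, memℓp_opFun Z x⟩
      map_add' := fun x y => by
        ext r
        change ∑' s, Z (r, s) * (x s + y s) = ∑' s, Z (r, s) * x s + ∑' s, Z (r, s) * y s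
        rw [← (hasSum_row Z x r).summable.tsum_add (hasSum_row Z y r).summable]
        simp only [mul_add]
      map_smul' := fun c x => by
        ext r
        change ∑' s, Z (r, s) * (c * x s) = c * ∑' s, Z (r, s) * x s
        rw [← tsum_mul_left]
        congr 1
        funext s
        ring }
    ‖Z‖ (fun x => by
      refine le_of_sq_le_sq ?_ (by positivity)
      rw [norm_sq_eq, mul_pow, norm_sq_eq Z, (summable_sq_HS Z).tsum_prod, ← tsum_mul_right]
      exact Summable.tsum_le_tsum (norm_sq_row Z x)
        (((summable_rows Z).mul_right (‖x‖ ^ 2)).of_nonneg_of_le (fun r => by positivity)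
          (norm_sq_row Z x)) ((summable_rows Z).mul_right _))

theorem toOp_apply (Z : HS) (x : Hilb) (r : ℕ+) : toOp Z x r = ∑' s, Z (r, s) * x s := rfl

/-- The Siegel disc `D_∞`: the Hilbert–Schmidt operators `Z : W₊ → W₋` that are symmetric with
respect to `S` and such that `I - Z Z̄` is positive definite. Complex conjugation exchanges `e_k` and
`e_{-k}`, so `Z̄ : W₋ → W₊` is the operator with the conjugate matrix `star Z`. -/
def SiegelDisc : Set HS :=
  {Z | (∀ x y : Hilb, symplHilb (0, toOp Z x) (y, 0) = symplHilb (0, toOp Z y) (x, 0)) ∧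
    ∀ y : Hilb, y ≠ 0 → 0 < (inner ℂ y (y - toOp Z (toOp (star Z) y))).re}

/-! ### The period map -/

/-- `P` is the map `Π : M → D_∞` that sends the coset of `φ` to the operator `Z : W₊ → W₋` whose
graph is (the completion of) the positive polarization `T_φ(W₊)`. -/
def IsPeriodMap (P : M → SiegelDisc) : Prop :=
  ∀ φ : DiffS1, {p : Hilb × Hilb | p.2 = toOp (P (toM φ)) p.1} =
    closure (split '' (Submodule.map (T φ) Wplus : Set VC))

/-- `F` is continuously differentiable on the open subset `U` of the Fréchet space `C^∞(S¹, ℝ)`: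
all directional derivatives exist and depend continuously on the point and the direction. -/
def IsC1On (U : Set (CircleFun ℝ)) (F : CircleFun ℝ → HS) : Prop :=
  ∃ dF : CircleFun ℝ → CircleFun ℝ → HS,
    (∀ f ∈ U, ∀ g, HasDerivAt (fun t : ℝ => F (f + t • g)) (dF f g) 0) ∧
      ContinuousOn (fun p : CircleFun ℝ × CircleFun ℝ => dF p.1 p.2) (U ×ˢ Set.univ)

/-- `P` is continuously differentiable. Here `M` has the Fréchet manifold structure of a quotient
of `Diff(S¹)`, i.e. `diffDomain → Diff(S¹) → M` is a submersion onto `M`. -/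
def IsC1 (P : M → SiegelDisc) : Prop :=
  IsC1On diffDomain (fun f => (P (toM (toDiff f)) : HS))

/-- The derivative of `P` at the coset of `φ`, applied to the tangent vector `(R_φ)_* v`, the image
of the tangent vector `v` at the origin under the right translation `R_φ : [ψ] ↦ [ψ ∘ φ]` of `M`.
Indeed `t ↦ [(θ + t v(θ)) ∘ φ]` is a curve with this velocity at `t = 0`. Note that
`v ↦ (R_φ)_* v` is an isomorphism of the tangent space at the origin onto that at `[φ]`. -/
def tderiv (P : M → SiegelDisc) (φ : DiffS1) (v : TangentOrigin) : HS :=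
  deriv (fun t : ℝ => (P (toM (toDiff (t • (v : CircleFun ℝ)) * φ)) : HS)) 0

/-- `P` is holomorphic: it is `C¹` and its derivative at each point is complex linear, where the
complex structure on the tangent space of `M` at `[φ]` is `J` transported by `R_φ`. -/
structure IsHolomorphic (P : M → SiegelDisc) : Prop where
  isC1 : IsC1 P
  map_J : ∀ (φ : DiffS1) (v : TangentOrigin), tderiv P φ (J v) = Complex.I • tderiv P φ v

/-- `P` is an immersion: it is `C¹` and its derivative at each point is injective. -/
structure IsImmersion (P : M → SiegelDisc) : Prop where
  isC1 : IsC1 P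
  injective : ∀ φ : DiffS1, Function.Injective (tderiv P φ)

end PeriodMap

end

open PeriodMap

/-!
The period map sends the class of `φ` to the operator `Z` whose graph is the closure of
`T_φ(W₊)`, where `T_φ σ = σ ∘ φ`. Write `A = π₊ T_φ` and `C = π₋ T_φ` for the blocks of `T_φ` on
`W₊`, so that `Z = C A⁻¹`.

*The blocks.* The matrix of `C` consists of the Fourier coefficients of `e^{isφ}` at negative
indices `-r`. The phase `sφ + rθ` has slope at least a constant times `r + s`, so integration by
parts shows that these coefficients decay rapidly in `r + s` (`exists_osc_neg_bound`); hence `C` is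
Hilbert–Schmidt. The substitution rule shows that `T_φ` preserves the symplectic form `S`
(`sympl_precomp`), and since it commutes with complex conjugation it preserves the Hermitian form
`‖π₊ σ‖² - ‖π₋ σ‖²` (`krein_T`). On `W₊` this reads `‖Aσ‖² = ‖σ‖² + ‖Cσ‖²`: the block `A` is bounded
because `C` is, and `‖Zx‖ < ‖x‖`. Moreover `A† = A_{φ⁻¹}`, and `A A† = 1 + B B†` where `B` is the
complex conjugate of `C` (`opA_mul_adjoint`), so `A` is invertible. As `S` vanishes on `W₊`, it
vanishes on the graph of `Z`, which is the symmetry of `Z` (`Zmat_mem`). The polarization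
`T_φ(W₊)` depends on the class of `φ` only, because `T_m(W₊) = W₊` for a Möbius transformation `m` by
Cauchy's theorem (`map_T_Wplus`).

*Differentiability.* The block `A` is only strongly continuous in `φ`. But
`Z = (C A†)(1 + B B†)⁻¹`, and `C A† = (C Λ⁴)(A Λ⁻⁴)†` with `Λ e_k = k e_k`, where the matrices of
`C Λ⁴`, `A Λ⁻⁴` and `B` are families of oscillatory integrals that are dominated, together with
their derivatives, by square summable families, locally uniformly in `φ`. By dominated convergence they
are `C¹` maps into the Hilbert–Schmidt operators (`OscDominated.hasC1`), and so is `Z`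
(`exists_hasC1_Zmat`). The local uniformity of the bounds comes from the continuity of the
operations of calculus in the Fréchet topology and the compactness of a parameter interval
`[0, 1]` that interpolates between the frequencies.

*The derivative.* Differentiating `Z_t A_t e_k = C_t e_k` along `φ_t = (θ + t v) ∘ φ` gives
`Ż A e_k = i √k (π₋ - Z π₊) T_φ(v e^{ikθ})` (`toOp_deriv_opA`). The operator `(π₋ - Z π₊) T_φ` vanishes
exactly on `W₊` (`graphDefect_T_eq_zero_iff`), because the graph of `Z` is isotropic and contains
`T_φ(W₊)`. For `v = u ∂/∂θ` the function `(u* - i u) e^{ikθ}` has no components of negative index,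
so `Ż` is complex linear in `v`. If `Ż = 0`, then `u e^{iθ} ∈ W₊`, so all `u_m` with `m ≤ -2`
vanish, and `v = 0` as `u` is real and `u₋₁ = u₀ = u₁ = 0`. At the origin `Z = 0` and `A = 1`, and
the formula for `Ż` is the asserted one.
-/

noncomputable section

namespace PeriodMap

open CircleFun

/-! ### Calculus in the Fréchet space of smooth functions -/

namespace CircleFun

section Generic

variable {𝕜 : Type} [RCLike 𝕜]

theorem D_eq_of_hasDerivAt {f g : CircleFun 𝕜}
    (h : ∀ x : ℝ, HasDerivAt (fun x : ℝ => f (x : S1)) (g (x : S1)) x) : f.D = g :=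
  CircleFun.ext fun x => by rw [D_coe, (h x).deriv]

theorem D_add (f g : CircleFun 𝕜) : (f + g).D = f.D + g.D :=
  D_eq_of_hasDerivAt fun x => (f.hasDerivAt x).add (g.hasDerivAt x)

theorem D_smul (c : 𝕜) (f : CircleFun 𝕜) : (c • f).D = c • f.D :=
  D_eq_of_hasDerivAt fun x => (f.hasDerivAt x).const_mul c

theorem iterate_D_add (f g : CircleFun 𝕜) (j : ℕ) :
    D^[j] (f + g) = D^[j] f + D^[j] g := by
  induction j generalizing f g with
  | zero => rfl
  | succ j ih => rw [Function.iterate_succ_apply, D_add, ih]; rfl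

theorem iterate_D_smul (c : 𝕜) (f : CircleFun 𝕜) (j : ℕ) :
    D^[j] (c • f) = c • D^[j] f := by
  induction j generalizing f with
  | zero => rfl
  | succ j ih => rw [Function.iterate_succ_apply, D_smul, ih]; rfl

theorem toC_add (f g : CircleFun 𝕜) : (f + g).toC = f.toC + g.toC := rfl

theorem toC_smul (c : 𝕜) (f : CircleFun 𝕜) : (c • f).toC = c • f.toC := rfl

/-- The constant function `c` as a smooth function on the circle. -/
def const (c : 𝕜) : CircleFun 𝕜 := ofFun (fun _ => c) contDiff_const

/-- The pointwise product of smooth functions with values in `𝕜`. -/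
def pmul (f g : CircleFun 𝕜) : CircleFun 𝕜 :=
  ofFun (fun x => f x * g x) (ContDiff.mul f.contDiff g.contDiff)

@[simp] theorem const_apply (c : 𝕜) (x : S1) : const c x = c := rfl

@[simp] theorem pmul_apply (f g : CircleFun 𝕜) (x : S1) : pmul f g x = f x * g x := rfl

theorem D_pmul (f g : CircleFun 𝕜) : (pmul f g).D = pmul f.D g + pmul f g.D :=
  D_eq_of_hasDerivAt fun x => (f.hasDerivAt x).mul (g.hasDerivAt x)

theorem D_const (c : 𝕜) : (const c).D = 0 :=
  D_eq_of_hasDerivAt fun x => hasDerivAt_const x c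

theorem toC_pmul (f g : CircleFun 𝕜) : (pmul f g).toC = f.toC * g.toC := rfl

open Classical in
/-- The pointwise inverse of a nowhere vanishing smooth function (and `0` for other functions). -/
def pinv (f : CircleFun 𝕜) : CircleFun 𝕜 :=
  if h : ∀ x, f x ≠ 0 then ofFun (fun x => (f x)⁻¹) (f.contDiff.inv fun x => h x) else 0

theorem pinv_apply {f : CircleFun 𝕜} (h : ∀ x, f x ≠ 0) (x : S1) : pinv f x = (f x)⁻¹ := by
  rw [pinv, dif_pos h]; rfl

theorem D_pinv {f : CircleFun 𝕜} (h : ∀ x, f x ≠ 0) :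
    (pinv f).D = (-1 : 𝕜) • pmul f.D (pmul (pinv f) (pinv f)) :=
  D_eq_of_hasDerivAt fun x => by
    have h1 := (f.hasDerivAt x).inv (h x)
    have h2 : (fun x : ℝ => pinv f (x : S1)) = (fun x : ℝ => f (x : S1))⁻¹ :=
      funext fun y => pinv_apply h y
    rw [h2]
    convert h1 using 1
    simp only [smul_apply, pmul_apply, pinv_apply h]
    field_simp

variable {X : Type*} [TopologicalSpace X]

theorem continuous_iff {F : X → CircleFun 𝕜} :
    Continuous F ↔ ∀ j : ℕ, Continuous fun x => (D^[j] (F x)).toC := by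
  rw [continuous_induced_rng, continuous_pi_iff]
  rfl

/-- Continuity of a family of smooth functions with respect to the `C^n` topology. -/
def ContinuousC (n : ℕ) (F : X → CircleFun 𝕜) : Prop :=
  ∀ j ≤ n, Continuous fun x => (D^[j] (F x)).toC

theorem continuous_iff_continuousC {F : X → CircleFun 𝕜} :
    Continuous F ↔ ∀ n, ContinuousC n F :=
  continuous_iff.trans ⟨fun h _ j _ => h j, fun h j => h j j le_rfl⟩

theorem continuousC_zero {F : X → CircleFun 𝕜} :
    ContinuousC 0 F ↔ Continuous fun x => (F x).toC :=
  ⟨fun h => h 0 le_rfl, fun h j hj => by obtain rfl := Nat.le_zero.1 hj; exact h⟩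

theorem continuousC_succ {n : ℕ} {F : X → CircleFun 𝕜} :
    ContinuousC (n + 1) F ↔
      (Continuous fun x => (F x).toC) ∧ ContinuousC n fun x => (F x).D := by
  constructor
  · exact fun h => ⟨h 0 (Nat.zero_le _), fun j hj => h (j + 1) (by omega)⟩
  · rintro ⟨h0, h1⟩ j hj
    cases j with
    | zero => exact h0
    | succ j => exact h1 j (by omega)

theorem ContinuousC.toC {n : ℕ} {F : X → CircleFun 𝕜} (h : ContinuousC n F) :
    Continuous fun x => (F x).toC := h 0 (Nat.zero_le _)

theorem ContinuousC.of_succ {n : ℕ} {F : X → CircleFun 𝕜} (h : ContinuousC (n + 1) F) :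
    ContinuousC n F := fun j hj => h j (by omega)

theorem ContinuousC.add {n : ℕ} {F G : X → CircleFun 𝕜} (hF : ContinuousC n F)
    (hG : ContinuousC n G) : ContinuousC n fun x => F x + G x := fun j hj => by
  simp only [iterate_D_add, toC_add]
  exact (hF j hj).add (hG j hj)

theorem ContinuousC.smul {n : ℕ} {c : X → 𝕜} {F : X → CircleFun 𝕜} (hc : Continuous c)
    (hF : ContinuousC n F) : ContinuousC n fun x => c x • F x := fun j hj => by
  simp only [iterate_D_smul, toC_smul]
  exact hc.smul (hF j hj)

theorem ContinuousC.pmul {n : ℕ} {F G : X → CircleFun 𝕜} (hF : ContinuousC n F)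
    (hG : ContinuousC n G) : ContinuousC n fun x => pmul (F x) (G x) := by
  induction n generalizing F G with
  | zero =>
    rw [continuousC_zero]
    simp only [toC_pmul]
    exact hF.toC.mul hG.toC
  | succ n ih =>
    rw [continuousC_succ]
    refine ⟨?_, ?_⟩
    · simp only [toC_pmul]
      exact hF.toC.mul hG.toC
    · simp only [D_pmul]
      exact (ih (continuousC_succ.1 hF).2 hG.of_succ).add
        (ih hF.of_succ (continuousC_succ.1 hG).2)

theorem continuous_toC_pinv {F : X → CircleFun 𝕜} (hF : Continuous fun x => (F x).toC)
    (h0 : ∀ x y, F x y ≠ 0) : Continuous fun x => (pinv (F x)).toC := by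
  have hu : ∀ x, (F x).toC * (pinv (F x)).toC = 1 := fun x => by
    ext y
    exact (congrArg _ (pinv_apply (h0 x) y)).trans (mul_inv_cancel₀ (h0 x y))
  let u : X → (C(S1, 𝕜))ˣ := fun x => Units.mkOfMulEqOne _ _ (hu x)
  have he : (fun x => (pinv (F x)).toC) = fun x => Ring.inverse (F x).toC := funext fun x => by
    have : (F x).toC = u x := rfl
    rw [this, Ring.inverse_unit]
    rfl
  rw [he, continuous_iff_continuousAt]
  exact fun x => ContinuousAt.comp (f := fun x => (F x).toC)
    (NormedRing.inverse_continuousAt (u x)) hF.continuousAt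

theorem ContinuousC.pinv {n : ℕ} {F : X → CircleFun 𝕜} (hF : ContinuousC n F)
    (h0 : ∀ x y, F x y ≠ 0) : ContinuousC n fun x => pinv (F x) := by
  induction n with
  | zero => exact continuousC_zero.2 (continuous_toC_pinv hF.toC h0)
  | succ n ih =>
    rw [continuousC_succ]
    refine ⟨continuous_toC_pinv hF.toC h0, ?_⟩
    simp only [D_pinv (h0 _)]
    exact ((continuousC_succ.1 hF).2.pmul ((ih hF.of_succ).pmul (ih hF.of_succ))).smul
      continuous_const

theorem continuous_add {F G : X → CircleFun 𝕜} (hF : Continuous F) (hG : Continuous G) :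
    Continuous fun x => F x + G x := by
  rw [continuous_iff_continuousC] at *
  exact fun n => (hF n).add (hG n)

theorem continuous_smul {c : X → 𝕜} {F : X → CircleFun 𝕜} (hc : Continuous c)
    (hF : Continuous F) : Continuous fun x => c x • F x := by
  rw [continuous_iff_continuousC] at *
  exact fun n => (hF n).smul hc

theorem continuous_pmul {F G : X → CircleFun 𝕜} (hF : Continuous F) (hG : Continuous G) :
    Continuous fun x => pmul (F x) (G x) := by
  rw [continuous_iff_continuousC] at *
  exact fun n => (hF n).pmul (hG n)

theorem continuous_pinv {F : X → CircleFun 𝕜} (hF : Continuous F) (h0 : ∀ x y, F x y ≠ 0) :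
    Continuous fun x => pinv (F x) := by
  rw [continuous_iff_continuousC] at *
  exact fun n => (hF n).pinv h0

theorem continuous_D {F : X → CircleFun 𝕜} (hF : Continuous F) : Continuous fun x => (F x).D := by
  rw [continuous_iff] at *
  exact fun j => hF (j + 1)

theorem continuous_toC : Continuous (toC : CircleFun 𝕜 → C(S1, 𝕜)) :=
  continuous_iff.1 continuous_id 0

end Generic

theorem D_toComplex (f : CircleFun ℝ) : f.toComplex.D = f.D.toComplex :=
  D_eq_of_hasDerivAt fun x => (f.hasDerivAt x).ofReal_comp

@[simp] theorem toComplex_apply (f : CircleFun ℝ) (x : S1) : f.toComplex x = (f x : ℂ) := rfl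

theorem continuous_toComplex : Continuous (toComplex : CircleFun ℝ → CircleFun ℂ) := by
  rw [continuous_iff]
  intro j
  have : ∀ f : CircleFun ℝ, D^[j] f.toComplex = (D^[j] f).toComplex := fun f => by
    induction j generalizing f with
    | zero => rfl
    | succ j ih => rw [Function.iterate_succ_apply, D_toComplex, ih]; rfl
  simp only [this]
  exact (ContinuousMap.continuous_postcomp (⟨_, Complex.continuous_ofReal⟩ : C(ℝ, ℂ))).comp
    (continuous_iff.1 continuous_id j)

end CircleFun

theorem isOpen_diffDomain : IsOpen diffDomain := by
  have h := ContinuousMap.isOpen_setOfPred_mapsTo (isCompact_univ (X := S1))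
    (isOpen_Ioi (a := (-1 : ℝ)))
  have h' := h.preimage (continuous_toC.comp (continuous_D (𝕜 := ℝ) continuous_id))
  convert h' using 1
  ext f
  simp [diffDomain, Set.MapsTo, toC]

theorem zero_mem_diffDomain : (0 : CircleFun ℝ) ∈ diffDomain := fun x => by
  have : (0 : CircleFun ℝ).D = 0 := D_const 0
  rw [this]; simp

/-! ### Oscillatory integrals -/

/-- The function `e^{ik(θ + f(θ))}`. -/
def expo (k : ℤ) (f : CircleFun ℝ) : CircleFun ℂ :=
  pmul (ofFun (fun x => fourier (T := 2 * π) k x) (by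
      have : (fun x : ℝ => fourier (T := 2 * π) k (x : S1))
          = fun x : ℝ => Complex.exp ((Complex.I * k) * x) := funext fun x => fourier_expr k x
      rw [this]
      exact Complex.contDiff_exp.comp (contDiff_const.mul Complex.ofRealCLM.contDiff)))
    (ofFun (fun x => Complex.exp (Complex.I * k * f x))
      (Complex.contDiff_exp.comp (contDiff_const.mul (Complex.ofRealCLM.contDiff.comp f.contDiff))))

theorem expo_coe (k : ℤ) (f : CircleFun ℝ) (x : ℝ) :
    expo k f (x : S1) = Complex.exp (Complex.I * k * ((x + f (x : S1) : ℝ) : ℂ)) := by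
  change fourier (T := 2 * π) k (x : S1) * Complex.exp (Complex.I * k * f (x : S1)) = _
  rw [fourier_expr, ← Complex.exp_add]
  push_cast
  ring_nf

theorem expo_apply (k : ℤ) (f : CircleFun ℝ) (x : S1) :
    expo k f x = fourier (T := 2 * π) k x * Complex.exp (Complex.I * k * f x) := rfl

theorem expo_zero_right (k : ℤ) (x : S1) : expo k 0 x = fourier (T := 2 * π) k x := by
  rw [expo_apply]; simp

theorem expo_zero_left (f : CircleFun ℝ) : expo 0 f = const 1 := CircleFun.ext fun x => by
  rw [expo_coe]; simp

theorem norm_expo (k : ℤ) (f : CircleFun ℝ) (x : S1) : ‖expo k f x‖ = 1 := by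
  rw [expo_apply, norm_mul, norm_fourier_apply, one_mul, Complex.norm_exp]
  simp

theorem D_expo (k : ℤ) (f : CircleFun ℝ) :
    (expo k f).D = (Complex.I * k) • pmul (const 1 + f.D.toComplex) (expo k f) :=
  D_eq_of_hasDerivAt fun x => by
    have h1 : (fun x : ℝ => expo k f (x : S1))
        = fun x : ℝ => Complex.exp (Complex.I * k * ((x + f (x : S1) : ℝ) : ℂ)) :=
      funext (expo_coe k f)
    have h2 := ((((hasDerivAt_id x).add (f.hasDerivAt x)).ofReal_comp).const_mul
      (Complex.I * (k : ℂ))).cexp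
    rw [h1]
    refine h2.congr_deriv ?_
    rw [CircleFun.smul_apply, pmul_apply, CircleFun.add_apply, toComplex_apply, const_apply,
      expo_coe]
    simp only [Pi.add_apply, id]
    push_cast
    ring

theorem continuous_toC_expo (k : ℤ) : Continuous fun f : CircleFun ℝ => (expo k f).toC := by
  have h : Continuous fun f : CircleFun ℝ => (fourier (T := 2 * π) k : C(S1, ℂ)) *
      (⟨fun y : ℂ => Complex.exp (Complex.I * k * y), by fun_prop⟩ : C(ℂ, ℂ)).comp
        f.toComplex.toC :=
    continuous_const.mul ((ContinuousMap.continuous_postcomp _).comp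
      (continuous_toC.comp continuous_toComplex))
  exact h

/-- The oscillatory integral `(1/2π) ∫ h(θ) e^{ik(θ + f(θ))} e^{-imθ} dθ`. -/
def osc (h : CircleFun ℂ) (f : CircleFun ℝ) (k m : ℤ) : ℂ := fhat (pmul h (expo k f)) m

theorem pmul_add_left (f g h : CircleFun ℂ) : pmul (f + g) h = pmul f h + pmul g h :=
  CircleFun.ext fun _ => add_mul _ _ _

theorem pmul_smul_left (c : ℂ) (f g : CircleFun ℂ) : pmul (c • f) g = c • pmul f g :=
  CircleFun.ext fun _ => mul_assoc _ _ _

theorem osc_add (g h : CircleFun ℂ) (f : CircleFun ℝ) (k m : ℤ) :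
    osc (g + h) f k m = osc g f k m + osc h f k m := by
  rw [osc, pmul_add_left, fhat_add]; rfl

theorem osc_smul (c : ℂ) (h : CircleFun ℂ) (f : CircleFun ℝ) (k m : ℤ) :
    osc (c • h) f k m = c * osc h f k m := by
  rw [osc, pmul_smul_left, fhat_smul]; rfl

theorem norm_osc_le (h : CircleFun ℂ) (f : CircleFun ℝ) (k m : ℤ) : ‖osc h f k m‖ ≤ ‖h.toC‖ := by
  refine (norm_fhat_le _ _).trans ?_
  rw [ContinuousMap.norm_le _ (norm_nonneg _)]
  intro x
  change ‖h x * expo k f x‖ ≤ _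
  rw [norm_mul, norm_expo, mul_one]
  exact h.toC.norm_coe_le_norm x

/-- Integration by parts: the `m`-th Fourier coefficient of the derivative of
`h e^{ik(θ + f)}`. -/
theorem osc_by_parts (h : CircleFun ℂ) (f : CircleFun ℝ) (k m : ℤ) :
    osc h.D f k m + Complex.I * k * osc (pmul (const 1 + f.D.toComplex) h) f k m =
      Complex.I * m * osc h f k m := by
  rw [osc, osc, osc, ← fhat_D, D_pmul, D_expo, fhat_add, ← fhat_smul]
  congr 2
  exact CircleFun.ext fun x => by
    simp only [CircleFun.smul_apply, pmul_apply]; ring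

theorem fhat_sub_le (f g : CircleFun ℂ) (m : ℤ) : ‖fhat f m - fhat g m‖ ≤ ‖f.toC - g.toC‖ := by
  have h : fhat f m - fhat g m = fhat (f + (-1 : ℂ) • g) m := by
    rw [fhat_add, fhat_smul]; ring
  rw [h]
  refine (norm_fhat_le _ _).trans (le_of_eq ?_)
  rw [toC_add, toC_smul, neg_one_smul, sub_eq_add_neg]

theorem continuous_fhat {X : Type*} [TopologicalSpace X] {F : X → CircleFun ℂ}
    (hF : Continuous fun x => (F x).toC) (m : ℤ) : Continuous fun x => fhat (F x) m := by
  rw [continuous_iff_continuousAt]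
  intro x
  have h := (hF.tendsto x)
  rw [tendsto_iff_norm_sub_tendsto_zero] at h
  rw [ContinuousAt, tendsto_iff_norm_sub_tendsto_zero]
  exact squeeze_zero (fun _ => norm_nonneg _) (fun y => fhat_sub_le _ _ m) h

theorem continuous_osc (k m : ℤ) :
    Continuous fun p : CircleFun ℝ × CircleFun ℂ => osc p.2 p.1 k m := by
  apply continuous_fhat
  simp only [toC_pmul]
  exact (continuous_toC.comp continuous_snd).mul ((continuous_toC_expo k).comp continuous_fst)

/-- A function that depends continuously on a point and on a parameter in `[0, 1]` is bounded,
locally uniformly in the point. -/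
theorem eventually_forall_unitInterval_le {X : Type*} [TopologicalSpace X]
    {G : X × unitInterval → ℝ} (hG : Continuous G) (x₀ : X) :
    ∃ K : ℝ, 0 ≤ K ∧ ∀ᶠ x in 𝓝 x₀, ∀ t, G (x, t) ≤ K := by
  obtain ⟨K, hK⟩ := (isCompact_range (f := fun t => G (x₀, t)) (by fun_prop)).bddAbove
  refine ⟨max (K + 1) 0, le_max_right _ _, ?_⟩
  have h := (isCompact_univ (X := unitInterval)).eventually_forall_of_forall_eventually
    (x₀ := x₀) (P := fun x t => G (x, t) ≤ max (K + 1) 0) (fun t _ => by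
      have h1 : G (x₀, t) < K + 1 := (hK ⟨t, rfl⟩).trans_lt (by linarith)
      filter_upwards [(hG.tendsto (x₀, t)).eventually_lt_const h1] with z hz
      exact hz.le.trans (le_max_left _ _))
  filter_upwards [h] with x hx t using hx t (Set.mem_univ t)

/-- The weight `1 + τ f'`. -/
def phaseSlope (τ : ℝ) (f : CircleFun ℝ) : CircleFun ℂ :=
  const 1 + (τ : ℂ) • f.D.toComplex

theorem phaseSlope_ne_zero {f : CircleFun ℝ} (hf : f ∈ diffDomain) (τ : unitInterval) (x : S1) :
    phaseSlope τ f x ≠ 0 := by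
  have h : phaseSlope τ f x = ((1 + τ * f.D x : ℝ) : ℂ) := by
    rw [phaseSlope, CircleFun.add_apply, CircleFun.smul_apply, const_apply, toComplex_apply]
    push_cast
    rfl
  rw [h, Complex.ofReal_ne_zero]
  have h1 := hf x
  obtain ⟨τ, h2, h3⟩ := τ
  intro h4
  rcases h2.eq_or_lt with h5 | h5
  · simp [← h5] at h4
  · simp only at h4
    nlinarith

/-- The operator `h ↦ (h / (1 + τ f'))'`. One integration by parts in the integral of `h` against
`e^{in(θ + τ f)}` replaces `h` by its image and gains a factor `1 / n`. -/
def nonstatOp (τ : ℝ) (f : CircleFun ℝ) (h : CircleFun ℂ) : CircleFun ℂ :=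
  (pmul h (pinv (phaseSlope τ f))).D

/-- The operator `h ↦ κ h' + i (1 + f') h`. With `κ = 1 / k`, one integration by parts in the integral
of `h e^{ik(θ + f)}` against `e^{-isθ}` replaces `h` by its image and gains a factor `k / s`. -/
def transferOp (κ : ℝ) (f : CircleFun ℝ) (h : CircleFun ℂ) : CircleFun ℂ :=
  (κ : ℂ) • h.D + Complex.I • pmul (const 1 + f.D.toComplex) h

theorem continuous_iterate_nonstatOp (N : ℕ) :
    Continuous fun p : (diffDomain × CircleFun ℂ) × unitInterval =>
      (nonstatOp p.2 p.1.1)^[N] p.1.2 := by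
  induction N with
  | zero => exact continuous_snd.comp continuous_fst
  | succ N ih =>
    simp only [Function.iterate_succ_apply']
    refine continuous_D (continuous_pmul ih (continuous_pinv ?_ fun p =>
      phaseSlope_ne_zero p.1.1.2 p.2))
    refine continuous_add continuous_const (continuous_smul (by fun_prop)
      (continuous_toComplex.comp (continuous_D ?_)))
    exact continuous_subtype_val.comp (continuous_fst.comp continuous_fst)

theorem continuous_iterate_transferOp (N : ℕ) :
    Continuous fun p : (CircleFun ℝ × CircleFun ℂ) × unitInterval =>
      (transferOp p.2 p.1.1)^[N] p.1.2 := by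
  induction N with
  | zero => exact continuous_snd.comp continuous_fst
  | succ N ih =>
    simp only [Function.iterate_succ_apply']
    refine continuous_add (continuous_smul (by fun_prop) (continuous_D ih))
      (continuous_smul continuous_const (continuous_pmul (continuous_add continuous_const
        (continuous_toComplex.comp (continuous_D ?_))) ih))
    exact continuous_fst.comp continuous_fst

/-- One step of non-stationary phase: for `n = k + r` and `τ = k / n` the phase
`k (θ + f) + r θ` is `n (θ + τ f)`. -/
theorem norm_osc_nonstatOp {f : CircleFun ℝ} (hf : f ∈ diffDomain) (h : CircleFun ℂ) (k r : ℕ+)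
    (τ : unitInterval) (hτ : (τ : ℝ) * (k + r) = k) :
    ((k : ℝ) + r) * ‖osc h f k (-(r : ℤ))‖ = ‖osc (nonstatOp τ f h) f k (-(r : ℤ))‖ := by
  set g := pmul h (pinv (phaseSlope τ f)) with hg
  have hkr : h = pmul (phaseSlope τ f) g := CircleFun.ext fun x => by
    have := phaseSlope_ne_zero hf τ x
    simp only [hg, pmul_apply, pinv_apply (phaseSlope_ne_zero hf τ)]
    field_simp
  have h1 := osc_by_parts g f k (-(r : ℤ))
  have h2 : ((k : ℂ) + r) * osc h f k (-(r : ℤ))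
      = k * osc (pmul (const 1 + f.D.toComplex) g) f k (-(r : ℤ))
        + r * osc g f k (-(r : ℤ)) := by
    rw [hkr, ← osc_smul, ← osc_smul, ← osc_smul, ← osc_add]
    congr 1
    refine CircleFun.ext fun x => ?_
    simp only [phaseSlope, CircleFun.smul_apply, pmul_apply, CircleFun.add_apply, const_apply]
    have hτ' : (τ : ℂ) * (k + r) = k := by exact_mod_cast hτ
    linear_combination (f.D.toComplex (x : S1) * g (x : S1)) * hτ'
  have h3 : osc (nonstatOp τ f h) f k (-(r : ℤ))
      = -Complex.I * (((k : ℂ) + r) * osc h f k (-(r : ℤ))) := by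
    rw [h2]
    change osc g.D f k (-(r : ℤ)) = _
    push_cast at h1
    linear_combination h1
  rw [h3, norm_mul, norm_mul, norm_neg, Complex.norm_I, one_mul]
  congr 1
  rw [← Complex.norm_of_nonneg (by positivity : (0 : ℝ) ≤ (k : ℝ) + r)]
  push_cast
  rfl

theorem norm_osc_transferOp (f : CircleFun ℝ) (h : CircleFun ℂ) (k s : ℕ+) :
    ((s : ℝ) / k) * ‖osc h f k s‖ = ‖osc (transferOp (1 / k) f h) f k s‖ := by
  have h1 := osc_by_parts h f k s
  have hk : (k : ℂ) ≠ 0 := by exact_mod_cast k.ne_zero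
  have h2 : osc (transferOp (1 / k) f h) f k s = Complex.I * ((s : ℂ) / k * osc h f k s) := by
    rw [transferOp, osc_add, osc_smul, osc_smul]
    push_cast at h1 ⊢
    field_simp
    linear_combination h1
  rw [h2, norm_mul, norm_mul, Complex.norm_I, one_mul, norm_div]
  simp

/-- Non-stationary phase, locally uniformly: negative frequencies of `h e^{ik(θ + f)}` decay
rapidly in `k + r`, because the phase has slope at least `c (k + r)`. -/
theorem exists_osc_neg_bound (N : ℕ) {f₀ : CircleFun ℝ} (hf₀ : f₀ ∈ diffDomain)
    (h₀ : CircleFun ℂ) :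
    ∃ K : ℝ, 0 ≤ K ∧ ∀ᶠ p : CircleFun ℝ × CircleFun ℂ in 𝓝 (f₀, h₀),
      ∀ k r : ℕ+, ((k : ℝ) + r) ^ N * ‖osc p.2 p.1 k (-(r : ℤ))‖ ≤ K := by
  obtain ⟨K, hK0, hK⟩ := eventually_forall_unitInterval_le
    (continuous_norm.comp (continuous_toC.comp (continuous_iterate_nonstatOp N))) (⟨f₀, hf₀⟩, h₀)
  refine ⟨K, hK0, ?_⟩
  have hemb : IsOpenEmbedding
      (fun q : diffDomain × CircleFun ℂ => ((q.1 : CircleFun ℝ), q.2)) :=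
    isOpen_diffDomain.isOpenEmbedding_subtypeVal.prodMap IsOpenEmbedding.id
  have := hemb.map_nhds_eq (⟨f₀, hf₀⟩, h₀)
  rw [← this, eventually_map]
  filter_upwards [hK] with q hq k r
  have hpos : (0 : ℝ) < (k : ℝ) + r := by positivity
  let τ : unitInterval := ⟨(k : ℝ) / (k + r), by positivity, by
    rw [div_le_one hpos]; exact le_add_of_nonneg_right (by positivity)⟩
  have hτ : (τ : ℝ) * (k + r) = k := by simp only [τ]; field_simp
  refine le_trans (le_of_eq ?_) ((norm_osc_le _ q.1 k (-(r : ℤ))).trans (hq τ))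
  clear hq hK
  dsimp only
  induction N with
  | zero => simp
  | succ N ih =>
    have e := norm_osc_nonstatOp q.1.2 ((nonstatOp τ q.1)^[N] q.2) k r τ hτ
    rw [Function.iterate_succ_apply', ← e, ← ih, pow_succ]
    ring

/-- The positive frequencies `s` of `h e^{ik(θ + f)}` are `O((k/s)^N)`, locally uniformly. -/
theorem exists_osc_pos_bound (N : ℕ) (f₀ : CircleFun ℝ) (h₀ : CircleFun ℂ) :
    ∃ K : ℝ, 0 ≤ K ∧ ∀ᶠ p : CircleFun ℝ × CircleFun ℂ in 𝓝 (f₀, h₀),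
      ∀ k s : ℕ+, ((s : ℝ) / k) ^ N * ‖osc p.2 p.1 k s‖ ≤ K := by
  obtain ⟨K, hK0, hK⟩ := eventually_forall_unitInterval_le
    (continuous_norm.comp (continuous_toC.comp (continuous_iterate_transferOp N))) (f₀, h₀)
  refine ⟨K, hK0, ?_⟩
  filter_upwards [hK] with q hq k s
  let τ : unitInterval := ⟨1 / (k : ℝ), by positivity, by
    rw [div_le_one (by positivity)]; exact_mod_cast k.pos⟩
  refine le_trans (le_of_eq ?_) ((norm_osc_le _ q.1 k s).trans (hq τ))
  clear hq hK
  dsimp only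
  induction N with
  | zero => simp
  | succ N ih =>
    have e := norm_osc_transferOp q.1 ((transferOp τ q.1)^[N] q.2) k s
    rw [Function.iterate_succ_apply', ← e, ← ih, pow_succ]
    ring

/-! ### Continuously differentiable maps on the space of diffeomorphisms -/

/-- `F` is continuous and continuously differentiable on `diffDomain`, with the directional
derivatives `dF f g`. -/
structure HasC1 {E : Type*} [NormedAddCommGroup E] [NormedSpace ℝ E] (F : CircleFun ℝ → E)
    (dF : CircleFun ℝ → CircleFun ℝ → E) : Prop where
  continuousOn : ContinuousOn F diffDomain
  hasDerivAt : ∀ f ∈ diffDomain, ∀ g, HasDerivAt (fun t : ℝ => F (f + t • g)) (dF f g) 0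
  continuousOn_deriv : ContinuousOn (fun p : CircleFun ℝ × CircleFun ℝ => dF p.1 p.2)
    (diffDomain ×ˢ Set.univ)

theorem continuous_line (f g : CircleFun ℝ) : Continuous fun t : ℝ => f + t • g :=
  continuous_add continuous_const (continuous_smul continuous_id continuous_const)

theorem add_zero_smul (f g : CircleFun ℝ) : f + (0 : ℝ) • g = f := by
  rw [zero_smul, add_zero]

theorem eventually_line_mem {f : CircleFun ℝ} (hf : f ∈ diffDomain) (g : CircleFun ℝ) :
    ∀ᶠ t : ℝ in 𝓝 0, f + t • g ∈ diffDomain := by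
  have h := (continuous_line f g).tendsto 0
  rw [add_zero_smul] at h
  exact h.eventually (isOpen_diffDomain.mem_nhds hf)

namespace HasC1

variable {E E' : Type*} [NormedAddCommGroup E] [NormedSpace ℝ E] [NormedAddCommGroup E']
  [NormedSpace ℝ E'] {F : CircleFun ℝ → E} {dF : CircleFun ℝ → CircleFun ℝ → E}

theorem congr (h : HasC1 F dF) {G : CircleFun ℝ → E} (hG : ∀ f ∈ diffDomain, G f = F f) :
    HasC1 G dF where
  continuousOn := h.continuousOn.congr hG
  hasDerivAt f hf g := (h.hasDerivAt f hf g).congr_of_eventuallyEq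
    ((eventually_line_mem hf g).mono fun _ ht => hG _ ht)
  continuousOn_deriv := h.continuousOn_deriv

theorem prodMk (h : HasC1 F dF) {G : CircleFun ℝ → E'} {dG : CircleFun ℝ → CircleFun ℝ → E'}
    (hG : HasC1 G dG) : HasC1 (fun f => (F f, G f)) fun f g => (dF f g, dG f g) where
  continuousOn := h.continuousOn.prodMk hG.continuousOn
  hasDerivAt f hf g := (h.hasDerivAt f hf g).prodMk (hG.hasDerivAt f hf g)
  continuousOn_deriv := h.continuousOn_deriv.prodMk hG.continuousOn_deriv

theorem comp (h : HasC1 F dF) {Φ : E → E'} (hΦ : ∀ f ∈ diffDomain, ContDiffAt ℝ 1 Φ (F f)) :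
    HasC1 (fun f => Φ (F f)) fun f g => fderiv ℝ Φ (F f) (dF f g) where
  continuousOn f hf := (hΦ f hf).continuousAt.comp_continuousWithinAt (h.continuousOn f hf)
  hasDerivAt f hf g := by
    have h1 : HasFDerivAt Φ (fderiv ℝ Φ (F f)) (F (f + (0 : ℝ) • g)) := by
      rw [add_zero_smul]
      exact ((hΦ f hf).differentiableAt (by simp)).hasFDerivAt
    exact h1.comp_hasDerivAt (0 : ℝ) (h.hasDerivAt f hf g)
  continuousOn_deriv := by
    rintro ⟨f, g⟩ ⟨hf, -⟩
    have h1 : ContinuousAt (fderiv ℝ Φ) (F f) :=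
      ((hΦ f hf).fderiv_right (m := 0) (by simp)).continuousAt
    have h2 : ContinuousWithinAt (fun p : CircleFun ℝ × CircleFun ℝ => F p.1)
        (diffDomain ×ˢ Set.univ) (f, g) :=
      (h.continuousOn f hf).comp continuous_fst.continuousWithinAt fun p hp => hp.1
    have h3 := h1.comp_continuousWithinAt (f := fun p : CircleFun ℝ × CircleFun ℝ => F p.1) h2
    exact h3.clm_apply (h.continuousOn_deriv (f, g) ⟨hf, trivial⟩)

end HasC1

/-! ### Square summable families of oscillatory integrals -/

section Lp

variable {ι : Type}

theorem memℓp_of_norm_le {c : ι → ℂ} {b : ι → ℝ} (hb : Summable fun i => b i ^ 2)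
    (h : ∀ i, ‖c i‖ ≤ b i) : Memℓp c 2 := by
  apply memℓp_gen
  have : Summable fun i => ‖c i‖ ^ 2 := hb.of_nonneg_of_le (fun i => by positivity)
    fun i => pow_le_pow_left₀ (norm_nonneg _) (h i) 2
  simpa using this

open Classical in
/-- A square summable family as an element of `ℓ²` (and `0` for other families). -/
def toLp (c : ι → ℂ) : lp (fun _ : ι => ℂ) 2 := if h : Memℓp c 2 then ⟨c, h⟩ else 0

theorem toLp_apply {c : ι → ℂ} (h : Memℓp c 2) (i : ι) : toLp c i = c i := by
  rw [toLp, dif_pos h]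

/-- Dominated convergence in `ℓ²`. -/
theorem tendsto_lp_of_dominated {α : Type*} {l : Filter α} {F : α → lp (fun _ : ι => ℂ) 2}
    {F₀ : lp (fun _ : ι => ℂ) 2} {b : ι → ℝ} (hb : Summable fun i => b i ^ 2)
    (hF : ∀ i, Tendsto (fun a => F a i) l (𝓝 (F₀ i))) (hle : ∀ᶠ a in l, ∀ i, ‖F a i‖ ≤ b i)
    (hle₀ : ∀ i, ‖F₀ i‖ ≤ b i) : Tendsto F l (𝓝 F₀) := by
  rw [tendsto_iff_norm_sub_tendsto_zero]
  have h : Tendsto (fun a => ∑' i, ‖(F a - F₀) i‖ ^ 2) l (𝓝 (∑' _ : ι, (0 : ℝ))) := by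
    refine tendsto_tsum_of_dominated_convergence (bound := fun i => 4 * b i ^ 2)
      (hb.mul_left 4) (fun i => ?_) ?_
    · have h1 := (tendsto_iff_norm_sub_tendsto_zero.1 (hF i)).pow 2
      simpa using h1
    · filter_upwards [hle] with a ha i
      have h2 : ‖(F a - F₀) i‖ ≤ 2 * b i := by
        refine (norm_sub_le (F a i) (F₀ i)).trans ?_
        linarith [ha i, hle₀ i]
      rw [Real.norm_of_nonneg (by positivity)]
      calc _ ≤ (2 * b i) ^ 2 := pow_le_pow_left₀ (norm_nonneg _) h2 2
        _ = _ := by ring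
  simp only [← norm_sq_eq, tsum_zero] at h
  have h3 := h.sqrt
  simpa using h3

/-- The family `w_i · osc h f κ_i m_i`. -/
def oscFamily (w : ι → ℂ) (κ m : ι → ℤ) (f : CircleFun ℝ) (h : CircleFun ℂ) :
    lp (fun _ : ι => ℂ) 2 :=
  toLp fun i => w i * osc h f (κ i) (m i)

/-- The weighted oscillatory integrals and their derivatives with respect to the phase are
locally uniformly dominated by a square summable family. -/
def OscDominated (w : ι → ℂ) (κ m : ι → ℤ) : Prop :=
  ∀ f₀ ∈ diffDomain, ∀ h₀ : CircleFun ℂ, ∃ b : ι → ℝ, (Summable fun i => b i ^ 2) ∧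
    ∀ᶠ p : CircleFun ℝ × CircleFun ℂ in 𝓝 (f₀, h₀),
      ∀ i, ‖w i‖ * (1 + |(κ i : ℝ)|) * ‖osc p.2 p.1 (κ i) (m i)‖ ≤ b i

variable {w w' : ι → ℂ} {κ m : ι → ℤ}

theorem OscDominated.mono (hd : OscDominated w κ m) (hw : ∀ i, ‖w' i‖ ≤ ‖w i‖ * (1 + |(κ i : ℝ)|))
    {f₀ : CircleFun ℝ} (hf₀ : f₀ ∈ diffDomain) (h₀ : CircleFun ℂ) :
    ∃ b : ι → ℝ, (Summable fun i => b i ^ 2) ∧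
    ∀ᶠ p : CircleFun ℝ × CircleFun ℂ in 𝓝 (f₀, h₀),
      ∀ i, ‖w' i * osc p.2 p.1 (κ i) (m i)‖ ≤ b i := by
  obtain ⟨b, hb, h⟩ := hd f₀ hf₀ h₀
  refine ⟨b, hb, h.mono fun p hp i => le_trans ?_ (hp i)⟩
  rw [norm_mul]
  exact mul_le_mul_of_nonneg_right (hw i) (norm_nonneg _)

theorem OscDominated.oscFamily_apply (hd : OscDominated w κ m)
    (hw : ∀ i, ‖w' i‖ ≤ ‖w i‖ * (1 + |(κ i : ℝ)|)) {f : CircleFun ℝ} (hf : f ∈ diffDomain)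
    (h : CircleFun ℂ) (i : ι) : oscFamily w' κ m f h i = w' i * osc h f (κ i) (m i) := by
  obtain ⟨b, hb, h1⟩ := hd.mono hw hf h
  rw [oscFamily, toLp_apply (memℓp_of_norm_le hb h1.self_of_nhds)]

theorem OscDominated.continuousOn (hd : OscDominated w κ m)
    (hw : ∀ i, ‖w' i‖ ≤ ‖w i‖ * (1 + |(κ i : ℝ)|)) :
    ContinuousOn (fun p : CircleFun ℝ × CircleFun ℂ => oscFamily w' κ m p.1 p.2)
      (diffDomain ×ˢ Set.univ) := by
  rintro ⟨f, h⟩ ⟨hf, -⟩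
  obtain ⟨b, hb, h1⟩ := hd.mono hw hf h
  have h2 := h1.filter_mono (nhdsWithin_le_nhds (s := diffDomain ×ˢ Set.univ))
  have h3 : ∀ᶠ p : CircleFun ℝ × CircleFun ℂ in 𝓝[diffDomain ×ˢ Set.univ] (f, h),
      p.1 ∈ diffDomain := by
    filter_upwards [self_mem_nhdsWithin] with p hp using hp.1
  refine tendsto_lp_of_dominated hb (fun i => ?_) ?_ fun i => ?_
  · have h4 : ContinuousAt (fun p : CircleFun ℝ × CircleFun ℂ => w' i * osc p.2 p.1 (κ i) (m i))
        (f, h) := (continuous_const.mul (continuous_osc _ _)).continuousAt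
    rw [hd.oscFamily_apply hw hf]
    refine (h4.tendsto.mono_left nhdsWithin_le_nhds).congr' ?_
    filter_upwards [h3] with p hp
    rw [hd.oscFamily_apply hw hp]
  · filter_upwards [h2, h3] with p hp hp' i
    rw [hd.oscFamily_apply hw hp']
    exact hp i
  · rw [hd.oscFamily_apply hw hf]
    exact h1.self_of_nhds i

end Lp

/-- Differentiation of an oscillatory integral with respect to its phase. -/
theorem hasDerivAt_osc (f g : CircleFun ℝ) (k m : ℤ) (t₀ : ℝ) :
    HasDerivAt (fun t : ℝ => osc (const 1) (f + t • g) k m)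
      (Complex.I * k * osc g.toComplex (f + t₀ • g) k m) t₀ := by
  have hfun : ∀ (h : CircleFun ℂ) (t : ℝ), osc h (f + t • g) k m =
      ∫ x : S1, fourier (T := 2 * π) (-m) x * (h x * expo k (f + t • g) x)
        ∂AddCircle.haarAddCircle := fun h t => rfl
  have hcont : ∀ (h : CircleFun ℂ) (t : ℝ), Continuous fun x : S1 =>
      fourier (T := 2 * π) (-m) x * (h x * expo k (f + t • g) x) := fun h t =>
    (map_continuous _).mul (h.continuous.mul (expo k (f + t • g)).continuous)
  have hint : ∀ (h : CircleFun ℂ) (t : ℝ), Integrable (fun x : S1 =>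
      fourier (T := 2 * π) (-m) x * (h x * expo k (f + t • g) x)) AddCircle.haarAddCircle :=
    fun h t => (hcont h t).integrable_of_hasCompactSupport (HasCompactSupport.of_compactSpace _)
  simp only [hfun]
  rw [← integral_const_mul]
  refine (hasDerivAt_integral_of_dominated_loc_of_deriv_le (s := Set.univ) univ_mem
    (F' := fun t x => Complex.I * k * (fourier (T := 2 * π) (-m) x *
      (g.toComplex x * expo k (f + t • g) x)))
    (bound := fun _ => |(k : ℝ)| * ‖g.toComplex.toC‖)
    (Eventually.of_forall fun t => (hint _ t).aestronglyMeasurable) (hint _ t₀)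
    ((hint _ t₀).const_mul _).aestronglyMeasurable ?_ (integrable_const _) ?_).2
  · refine Eventually.of_forall fun x t _ => ?_
    rw [norm_mul, norm_mul, norm_mul, norm_mul, norm_fourier_apply, norm_expo, Complex.norm_I,
      one_mul, one_mul, mul_one, Complex.norm_intCast]
    exact mul_le_mul_of_nonneg_left (g.toComplex.toC.norm_coe_le_norm x) (abs_nonneg _)
  · refine Eventually.of_forall fun x t _ => ?_
    have h1 : HasDerivAt (fun t : ℝ => expo k (f + t • g) x)
        (Complex.I * k * (g x : ℂ) * expo k (f + t • g) x) t := by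
      simp only [expo_apply, CircleFun.add_apply, CircleFun.smul_apply]
      have h2 := (((((hasDerivAt_id t).mul_const (g x)).const_add (f x)).ofReal_comp).const_mul
        (Complex.I * (k : ℂ))).cexp.const_mul (fourier (T := 2 * π) k x)
      refine h2.congr_deriv ?_
      simp only [id]
      push_cast
      ring
    refine ((h1.const_mul (const 1 x)).const_mul (fourier (T := 2 * π) (-m) x)).congr_deriv ?_
    simp only [const_apply, toComplex_apply]
    ring

/-- A dominated family of oscillatory integrals depends continuously differentiably on its phase,
as an element of `ℓ²`. -/
theorem OscDominated.hasC1 {ι : Type} {w : ι → ℂ} {κ m : ι → ℤ} (hd : OscDominated w κ m) :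
    HasC1 (fun f => oscFamily w κ m f (const 1))
      (fun f g => oscFamily (fun i => w i * (Complex.I * κ i)) κ m f g.toComplex) := by
  have hw : ∀ i, ‖w i‖ ≤ ‖w i‖ * (1 + |(κ i : ℝ)|) := fun i =>
    le_mul_of_one_le_right (norm_nonneg _) (by linarith [abs_nonneg (κ i : ℝ)])
  have hw' : ∀ i, ‖w i * (Complex.I * κ i)‖ ≤ ‖w i‖ * (1 + |(κ i : ℝ)|) := fun i => by
    rw [norm_mul, norm_mul, Complex.norm_I, one_mul, Complex.norm_intCast]
    exact mul_le_mul_of_nonneg_left (by linarith) (norm_nonneg _)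
  refine ⟨?_, fun f hf g => ?_, ?_⟩
  · exact (hd.continuousOn hw).comp (f := fun f => (f, const 1)) (by fun_prop)
      fun f hf => ⟨hf, trivial⟩
  · obtain ⟨b, hb, h1⟩ := hd.mono hw' hf g.toComplex
    have hline : Tendsto (fun t : ℝ => (f + t • g, g.toComplex)) (𝓝 0) (𝓝 (f, g.toComplex)) := by
      have := ((continuous_line f g).prodMk (continuous_const (y := g.toComplex))).tendsto 0
      rwa [add_zero_smul] at this
    have h2 := (hline.eventually h1).and (eventually_line_mem hf g)
    obtain ⟨ε, hε, hball⟩ := Metric.eventually_nhds_iff_ball.1 h2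
    rw [hasDerivAt_iff_tendsto_slope]
    have hderiv : ∀ i t, HasDerivAt (fun t : ℝ => w i * osc (const 1) (f + t • g) (κ i) (m i))
        (w i * (Complex.I * κ i) * osc g.toComplex (f + t • g) (κ i) (m i)) t := fun i t => by
      have := (hasDerivAt_osc f g (κ i) (m i) t).const_mul (w i)
      rwa [← mul_assoc] at this
    have hslope : ∀ t ∈ Metric.ball (0 : ℝ) ε, ∀ i,
        slope (fun t : ℝ => oscFamily w κ m (f + t • g) (const 1)) 0 t i =
          slope (fun t : ℝ => w i * osc (const 1) (f + t • g) (κ i) (m i)) 0 t := fun t ht i => by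
      rw [slope_def_module, slope_def_module, ← hd.oscFamily_apply hw (hball t ht).2,
        ← hd.oscFamily_apply hw (hball 0 (Metric.mem_ball_self hε)).2]
      rfl
    have hev : ∀ᶠ t in 𝓝[≠] (0 : ℝ), t ∈ Metric.ball (0 : ℝ) ε :=
      nhdsWithin_le_nhds (Metric.ball_mem_nhds 0 hε)
    -- The difference quotients of the entries are bounded by the bound for their derivatives
    -- (mean value inequality), which is square summable.
    refine tendsto_lp_of_dominated hb (fun i => ?_) ?_ fun i => ?_
    · have h3 := hasDerivAt_iff_tendsto_slope.1 (hderiv i 0)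
      rw [hd.oscFamily_apply hw' hf]
      rw [add_zero_smul] at h3
      refine h3.congr' ?_
      filter_upwards [hev] with t ht
      rw [hslope t ht]
    · filter_upwards [hev, self_mem_nhdsWithin] with t ht ht0 i
      rw [hslope t ht, slope_def_module, norm_smul, norm_inv, sub_zero]
      have h4 := (convex_ball (0 : ℝ) ε).norm_image_sub_le_of_norm_hasDerivWithin_le
        (fun s _ => (hderiv i s).hasDerivWithinAt) (fun s hs => (hball s hs).1 i)
        (Metric.mem_ball_self hε) ht
      rw [sub_zero] at h4
      have h5 : 0 < ‖t‖ := norm_pos_iff.2 ht0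
      rw [inv_mul_le_iff₀ h5, mul_comm ‖t‖]
      exact h4
    · rw [hd.oscFamily_apply hw' hf]
      exact h1.self_of_nhds i
  · exact (hd.continuousOn hw').comp
      (f := fun p : CircleFun ℝ × CircleFun ℝ => (p.1, p.2.toComplex))
      (continuous_fst.prodMk (continuous_toComplex.comp continuous_snd)).continuousOn
      fun p hp => ⟨hp.1, trivial⟩

/-! ### Hilbert–Schmidt operators -/

/-- The `k`-th basis vector of `ℓ²`. -/
def basisVec (k : ℕ+) : Hilb := lp.single 2 k 1

theorem basisVec_apply (k l : ℕ+) : basisVec k l = if l = k then 1 else 0 := by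
  rw [basisVec, lp.single_apply, Pi.single_apply]

theorem inner_basisVec (k : ℕ+) (x : Hilb) : inner ℂ (basisVec k) x = x k := by
  rw [basisVec, lp.inner_single_left]; simp

theorem toOp_basisVec (Z : HS) (r s : ℕ+) : toOp Z (basisVec s) r = Z (r, s) := by
  rw [toOp_apply, tsum_eq_single s]
  · simp [basisVec_apply]
  · intro k hk; simp [basisVec_apply, hk]

theorem hasSum_basisVec (x : Hilb) : HasSum (fun k => x k • basisVec k) x := by
  have h := lp.hasSum_single (p := 2) (by simp) x
  refine h.congr_fun fun k => ?_
  rw [basisVec, ← lp.single_smul, smul_eq_mul, mul_one]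

theorem ext_basisVec {E : Type*} [NormedAddCommGroup E] [NormedSpace ℂ E] {A B : Hilb →L[ℂ] E}
    (h : ∀ k, A (basisVec k) = B (basisVec k)) : A = B := by
  ext1 x
  have hA := A.hasSum (hasSum_basisVec x)
  have hB := B.hasSum (hasSum_basisVec x)
  simp only [map_smul, h] at hA hB
  exact hA.unique hB

theorem toOp_injective : Function.Injective toOp := fun Z W h => by
  ext ⟨r, s⟩
  rw [← toOp_basisVec, h, toOp_basisVec]

theorem norm_toOp_le (Z : HS) : ‖toOp Z‖ ≤ ‖Z‖ :=
  LinearMap.mkContinuous_norm_le _ (norm_nonneg _) _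

/-- `toOp` as a continuous linear map. -/
def toOpL : HS →L[ℂ] Hilb →L[ℂ] Hilb :=
  LinearMap.mkContinuous
    { toFun := toOp
      map_add' := fun Z W => ext_basisVec fun k => by
        ext r
        change toOp (Z + W) (basisVec k) r = toOp Z (basisVec k) r + toOp W (basisVec k) r
        simp only [toOp_basisVec]; rfl
      map_smul' := fun c Z => ext_basisVec fun k => by
        ext r
        change toOp (c • Z) (basisVec k) r = c • toOp Z (basisVec k) r
        simp only [toOp_basisVec]; rfl }
    1 fun Z => by rw [one_mul]; exact norm_toOp_le Z

@[simp] theorem toOpL_apply (Z : HS) : toOpL Z = toOp Z := rfl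

theorem toOp_conjTranspose (Z : HS) (x : Hilb) (s : ℕ+) :
    (ContinuousLinearMap.adjoint (toOp Z) x) s = ∑' r, conj (Z (r, s)) * x r := by
  rw [← inner_basisVec, ContinuousLinearMap.adjoint_inner_right,
    ← (lp.hasSum_inner (toOp Z (basisVec s)) x).tsum_eq]
  congr 1
  funext r
  rw [toOp_basisVec, RCLike.inner_apply, mul_comm]

theorem rowConj_apply (Z : HS) (r s : ℕ+) : rowConj Z r s = conj (Z (r, s)) := rfl

theorem norm_sq_rowConj (Z : HS) (r : ℕ+) : ‖rowConj Z r‖ ^ 2 = ∑' s, ‖Z (r, s)‖ ^ 2 := by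
  rw [norm_sq_eq]
  congr 1
  funext s
  rw [rowConj_apply, RCLike.norm_conj]

theorem norm_sq_HS (Z : HS) : ‖Z‖ ^ 2 = ∑' r, ‖rowConj Z r‖ ^ 2 := by
  rw [norm_sq_eq, (summable_sq_HS Z).tsum_prod]
  congr 1
  funext r
  rw [norm_sq_rowConj]

theorem hasSum_sq (x : Hilb) : HasSum (fun k => ‖x k‖ ^ 2) (‖x‖ ^ 2) := by
  rw [norm_sq_eq]; exact (summable_sq x).hasSum

/-- The matrix of `Z ∘ A`: its conjugated rows are the images of those of `Z` under `A†`. -/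
def mulRFun (Z : HS) (A : Hilb →L[ℂ] Hilb) (i : ℕ+ × ℕ+) : ℂ :=
  conj ((ContinuousLinearMap.adjoint A (rowConj Z i.1)) i.2)

theorem summable_mulRFun_row (Z : HS) (A : Hilb →L[ℂ] Hilb) (r : ℕ+) :
    HasSum (fun s => ‖mulRFun Z A (r, s)‖ ^ 2)
      (‖ContinuousLinearMap.adjoint A (rowConj Z r)‖ ^ 2) := by
  refine (hasSum_sq _).congr_fun fun s => ?_
  rw [mulRFun, RCLike.norm_conj]

theorem norm_adjoint_rowConj_le (Z : HS) (A : Hilb →L[ℂ] Hilb) (r : ℕ+) :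
    ‖ContinuousLinearMap.adjoint A (rowConj Z r)‖ ^ 2 ≤ ‖A‖ ^ 2 * ‖rowConj Z r‖ ^ 2 := by
  rw [← mul_pow]
  refine pow_le_pow_left₀ (norm_nonneg _) ?_ 2
  refine ((ContinuousLinearMap.adjoint A).le_opNorm _).trans (le_of_eq ?_)
  rw [LinearIsometryEquiv.norm_map]

theorem summable_rowConj (Z : HS) : Summable fun r => ‖rowConj Z r‖ ^ 2 := by
  simpa only [norm_sq_rowConj] using summable_rows Z

theorem summable_mulRFun (Z : HS) (A : Hilb →L[ℂ] Hilb) :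
    Summable fun i => ‖mulRFun Z A i‖ ^ 2 := by
  rw [summable_prod_of_nonneg (fun i => by positivity)]
  refine ⟨fun r => (summable_mulRFun_row Z A r).summable, ?_⟩
  simp only [(summable_mulRFun_row Z A _).tsum_eq]
  exact ((summable_rowConj Z).mul_left (‖A‖ ^ 2)).of_nonneg_of_le (fun r => by positivity)
    (norm_adjoint_rowConj_le Z A)

/-- The Hilbert–Schmidt operator `Z ∘ A`. -/
def mulR (Z : HS) (A : Hilb →L[ℂ] Hilb) : HS :=
  ⟨mulRFun Z A, memℓp_gen <| by simpa using summable_mulRFun Z A⟩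

theorem mulR_apply (Z : HS) (A : Hilb →L[ℂ] Hilb) (r s : ℕ+) :
    mulR Z A (r, s) = toOp Z (A (basisVec s)) r := by
  change mulRFun Z A (r, s) = _
  rw [mulRFun, ← inner_basisVec, ContinuousLinearMap.adjoint_inner_right, inner_conj_symm,
    ← (hasSum_row Z _ r).tsum_eq]
  rfl

theorem toOp_mulR (Z : HS) (A : Hilb →L[ℂ] Hilb) : toOp (mulR Z A) = (toOp Z).comp A :=
  ext_basisVec fun s => by
    ext r
    rw [toOp_basisVec, mulR_apply]; rfl

theorem norm_mulR_le (Z : HS) (A : Hilb →L[ℂ] Hilb) : ‖mulR Z A‖ ≤ ‖Z‖ * ‖A‖ := by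
  refine le_of_sq_le_sq ?_ (by positivity)
  rw [mul_pow, norm_sq_eq (mulR Z A), norm_sq_HS Z, mul_comm, ← tsum_mul_left]
  change ∑' i, ‖mulRFun Z A i‖ ^ 2 ≤ _
  rw [(summable_mulRFun Z A).tsum_prod]
  simp only [(summable_mulRFun_row Z A _).tsum_eq]
  have h := (summable_rowConj Z).mul_left (‖A‖ ^ 2)
  exact Summable.tsum_le_tsum (norm_adjoint_rowConj_le Z A)
    (h.of_nonneg_of_le (fun r => by positivity) (norm_adjoint_rowConj_le Z A)) h

theorem isBoundedBilinearMap_mulR :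
    IsBoundedBilinearMap ℂ fun p : HS × (Hilb →L[ℂ] Hilb) => mulR p.1 p.2 where
  add_left Z W A := by
    ext ⟨r, s⟩
    change mulR (Z + W) A (r, s) = mulR Z A (r, s) + mulR W A (r, s)
    simp only [mulR_apply, ← toOpL_apply, map_add]; rfl
  smul_left c Z A := by
    ext ⟨r, s⟩
    change mulR (c • Z) A (r, s) = c • mulR Z A (r, s)
    simp only [mulR_apply, ← toOpL_apply, map_smul]; rfl
  add_right Z A B := by
    ext ⟨r, s⟩
    change mulR Z (A + B) (r, s) = mulR Z A (r, s) + mulR Z B (r, s)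
    simp only [mulR_apply, _root_.add_apply, map_add]; rfl
  smul_right c Z A := by
    ext ⟨r, s⟩
    change mulR Z (c • A) (r, s) = c • mulR Z A (r, s)
    simp only [mulR_apply, _root_.smul_apply, map_smul]; rfl
  bound := ⟨1, one_pos, fun Z A => by rw [one_mul]; exact norm_mulR_le Z A⟩

/-- The adjoint as a real linear map. -/
def adjointL : (Hilb →L[ℂ] Hilb) →L[ℝ] (Hilb →L[ℂ] Hilb) :=
  LinearMap.mkContinuous
    { toFun := fun A => ContinuousLinearMap.adjoint A
      map_add' := fun A B => map_add _ A B
      map_smul' := fun c A => by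
        have h1 : ∀ T : Hilb →L[ℂ] Hilb, c • T = (c : ℂ) • T := fun T => by
          ext x i
          exact Complex.real_smul
        rw [RingHom.id_apply, h1, h1, map_smulₛₗ, Complex.conj_ofReal] }
    1 fun A => by
      rw [one_mul]
      exact (LinearIsometryEquiv.norm_map _ A).le

@[simp] theorem adjointL_apply (A : Hilb →L[ℂ] Hilb) :
    adjointL A = ContinuousLinearMap.adjoint A := rfl

theorem isUnit_one_add_mul_adjoint (B : Hilb →L[ℂ] Hilb) :
    IsUnit (1 + B * ContinuousLinearMap.adjoint B) := by
  refine ContinuousLinearMap.isUnit_of_forall_le_norm_inner_map _ (c := 1) one_pos fun x => ?_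
  have h : inner ℂ ((1 + B * ContinuousLinearMap.adjoint B) x) x
      = ((‖x‖ ^ 2 + ‖ContinuousLinearMap.adjoint B x‖ ^ 2 : ℝ) : ℂ) := by
    rw [_root_.add_apply, inner_add_left, one_apply_eq_self,
      mul_apply_eq_comp, ← ContinuousLinearMap.adjoint_inner_right,
      inner_self_eq_norm_sq_to_K, inner_self_eq_norm_sq_to_K]
    push_cast
    rfl
  rw [h, Complex.norm_of_nonneg (by positivity)]
  simp only [NNReal.coe_one, mul_one]
  linarith [sq_nonneg ‖ContinuousLinearMap.adjoint B x‖]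

theorem contDiff_opMul :
    ContDiff ℝ 1 fun p : (Hilb →L[ℂ] Hilb) × (Hilb →L[ℂ] Hilb) => p.1 * p.2 :=
  ContDiff.restrict_scalars ℝ (𝕜' := ℂ) isBoundedBilinearMap_comp.contDiff

theorem contDiffAt_opInverse {A : Hilb →L[ℂ] Hilb} (hA : IsUnit A) :
    ContDiffAt ℝ 1 (Ring.inverse : (Hilb →L[ℂ] Hilb) → _) A := by
  obtain ⟨u, rfl⟩ := hA
  exact ContDiffAt.restrict_scalars ℝ (𝕜' := ℂ) (contDiffAt_ringInverse ℂ u)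

theorem contDiff_toOp : ContDiff ℝ 1 (fun Z : HS => toOp Z) :=
  ContDiff.restrict_scalars ℝ (f := fun Z : HS => toOp Z) (𝕜' := ℂ) toOpL.contDiff

theorem contDiff_mulR : ContDiff ℝ 1 (fun p : HS × (Hilb →L[ℂ] Hilb) => mulR p.1 p.2) :=
  ContDiff.restrict_scalars ℝ (𝕜' := ℂ) isBoundedBilinearMap_mulR.contDiff

theorem contDiff_adjoint :
    ContDiff ℝ 1 (fun A : Hilb →L[ℂ] Hilb => ContinuousLinearMap.adjoint A) :=
  adjointL.contDiff

/-- The positive operator `1 + W̄ W̄†`. -/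
def posOp (W : HS) : Hilb →L[ℂ] Hilb :=
  1 + toOp (star W) * ContinuousLinearMap.adjoint (toOp (star W))

theorem isUnit_posOp (W : HS) : IsUnit (posOp W) := isUnit_one_add_mul_adjoint _

theorem contDiff_posOp : ContDiff ℝ 1 posOp := by
  have hstar : ContDiff ℝ 1 (fun Z : HS => star Z) := (starL' ℝ : HS ≃L[ℝ] HS).contDiff
  have hB : ContDiff ℝ 1 (fun W : HS => toOp (star W)) := contDiff_toOp.comp hstar
  have hB' : ContDiff ℝ 1 (fun W : HS => ContinuousLinearMap.adjoint (toOp (star W))) :=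
    contDiff_adjoint.comp hB
  exact contDiff_const.add (contDiff_opMul.comp (hB.prodMk hB'))

/-- The map `(X, Y, W) ↦ X Y† (1 + W̄ W̄†)⁻¹` on Hilbert–Schmidt matrices. -/
def graphMap (p : HS × HS × HS) : HS :=
  mulR p.1 (ContinuousLinearMap.adjoint (toOp p.2.1) * Ring.inverse (posOp p.2.2))

theorem contDiffAt_graphMap (p : HS × HS × HS) : ContDiffAt ℝ 1 graphMap p := by
  have hY : ContDiff ℝ 1 (fun p : HS × HS × HS => ContinuousLinearMap.adjoint (toOp p.2.1)) :=
    contDiff_adjoint.comp (contDiff_toOp.comp (contDiff_fst.comp contDiff_snd))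
  have hW : ContDiff ℝ 1 (fun p : HS × HS × HS => posOp p.2.2) :=
    contDiff_posOp.comp (contDiff_snd.comp contDiff_snd)
  have hI : ContDiffAt ℝ 1 (fun p : HS × HS × HS => Ring.inverse (posOp p.2.2)) p :=
    ContDiffAt.comp (f := fun p : HS × HS × HS => posOp p.2.2) p
      (contDiffAt_opInverse (isUnit_posOp p.2.2)) hW.contDiffAt
  have hM : ContDiffAt ℝ 1 (fun p : HS × HS × HS =>
      ContinuousLinearMap.adjoint (toOp p.2.1) * Ring.inverse (posOp p.2.2)) p :=
    ContDiffAt.comp (g := fun q : (Hilb →L[ℂ] Hilb) × (Hilb →L[ℂ] Hilb) => q.1 * q.2) p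
      contDiff_opMul.contDiffAt (hY.contDiffAt.prodMk hI)
  exact ContDiffAt.comp (f := fun p : HS × HS × HS =>
      (p.1, ContinuousLinearMap.adjoint (toOp p.2.1) * Ring.inverse (posOp p.2.2)))
    (g := fun q : HS × (Hilb →L[ℂ] Hilb) => mulR q.1 q.2) p
    contDiff_mulR.contDiffAt (contDiff_fst.contDiffAt.prodMk hM)

/-! ### The matrices of a diffeomorphism -/

theorem summable_sq_inv_mul (K : ℝ) :
    Summable fun i : ℕ+ × ℕ+ => (K / ((i.1 : ℝ) * i.2)) ^ 2 := by
  have h1 : Summable fun k : ℕ+ => 1 / ((k : ℕ) : ℝ) ^ 2 :=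
    (Real.summable_one_div_nat_pow.2 one_lt_two).comp_injective PNat.coe_injective
  have h := (h1.mul_of_nonneg h1 (fun k => by positivity) (fun k => by positivity)).mul_left (K ^ 2)
  refine h.congr fun i => ?_
  field_simp

theorem oscDominated_of_le {w : ℕ+ × ℕ+ → ℂ} {κ m : ℕ+ × ℕ+ → ℤ}
    (h : ∀ f₀ ∈ diffDomain, ∀ h₀ : CircleFun ℂ, ∃ K : ℝ,
      ∀ᶠ p : CircleFun ℝ × CircleFun ℂ in 𝓝 (f₀, h₀), ∀ r s : ℕ+,
        (r : ℝ) * s * (‖w (r, s)‖ * (1 + |(κ (r, s) : ℝ)|) *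
          ‖osc p.2 p.1 (κ (r, s)) (m (r, s))‖) ≤ K) :
    OscDominated w κ m := by
  intro f₀ hf₀ h₀
  obtain ⟨K, hK⟩ := h f₀ hf₀ h₀
  refine ⟨_, summable_sq_inv_mul K, hK.mono ?_⟩
  rintro p hp ⟨r, s⟩
  rw [le_div_iff₀ (by positivity), mul_comm]
  exact hp r s

theorem OscDominated.of_norm_le {ι : Type} {w w' : ι → ℂ} {κ m : ι → ℤ} (hd : OscDominated w κ m)
    (hw : ∀ i, ‖w' i‖ ≤ ‖w i‖) : OscDominated w' κ m := by
  intro f₀ hf₀ h₀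
  obtain ⟨b, hb, h⟩ := hd f₀ hf₀ h₀
  refine ⟨b, hb, h.mono fun p hp i => le_trans ?_ (hp i)⟩
  gcongr
  exact hw i

theorem pnat_one_le (k : ℕ+) : (1 : ℝ) ≤ k := by exact_mod_cast k.pos

/-- The square root `√k` as a complex number. -/
def rt (k : ℕ+) : ℂ := ((√(k : ℝ) : ℝ) : ℂ)

theorem rt_mul_self (k : ℕ+) : rt k * rt k = k := by
  rw [rt, ← Complex.ofReal_mul, Real.mul_self_sqrt (by positivity)]
  simp

theorem rt_ne_zero (k : ℕ+) : rt k ≠ 0 := by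
  rw [rt, Complex.ofReal_ne_zero]
  have : (0 : ℝ) < k := by positivity
  positivity

theorem norm_rt (k : ℕ+) : ‖rt k‖ = √(k : ℝ) := by
  rw [rt, Complex.norm_of_nonneg (Real.sqrt_nonneg _)]

theorem conj_rt (k : ℕ+) : conj (rt k) = rt k := Complex.conj_ofReal _

theorem norm_rt_le (k : ℕ+) : ‖rt k‖ ≤ k := by
  rw [norm_rt, Real.sqrt_le_left (by positivity)]
  nlinarith [pnat_one_le k]

theorem one_le_norm_rt (k : ℕ+) : 1 ≤ ‖rt k‖ := by
  rw [norm_rt, Real.one_le_sqrt]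
  exact pnat_one_le k

theorem norm_rt_div_le (r s : ℕ+) : ‖rt r / rt s‖ ≤ r := by
  rw [norm_div]
  exact (div_le_self (norm_nonneg _) (one_le_norm_rt s)).trans (norm_rt_le r)

/-- Domination of the matrix of `C Λ⁴`. The exponent `8` of the decay suffices for the weight
`√(r/s) s⁴`, the factor `s` lost by differentiation, and the factor `r s` that leaves a square
summable bound. -/
theorem oscDominated_neg :
    OscDominated (fun i : ℕ+ × ℕ+ => rt i.1 / rt i.2 * (i.2 : ℂ) ^ 4) (fun i => i.2)
      (fun i => -(i.1 : ℤ)) := by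
  refine oscDominated_of_le fun f₀ hf₀ h₀ => ?_
  obtain ⟨K, hK0, hK⟩ := exists_osc_neg_bound 8 hf₀ h₀
  refine ⟨2 * K, hK.mono fun p hp r s => ?_⟩
  have h := hp s r
  have h1 := pnat_one_le s
  have h2 := pnat_one_le r
  have h3 : ‖rt r / rt s * (s : ℂ) ^ 4‖ ≤ r * (s : ℝ) ^ 4 := by
    rw [norm_mul, norm_pow]
    simp only [Complex.norm_natCast]
    gcongr
    exact norm_rt_div_le r s
  have h4 : 1 + |(((s : ℕ) : ℤ) : ℝ)| ≤ 2 * s := by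
    rw [abs_of_nonneg (by positivity)]; push_cast; linarith
  set o := ‖osc p.2 p.1 s (-(r : ℤ))‖ with ho
  have ho0 : 0 ≤ o := norm_nonneg _
  have h5 : (r : ℝ) ^ 2 * (s : ℝ) ^ 6 ≤ ((s : ℝ) + r) ^ 8 := by
    calc (r : ℝ) ^ 2 * (s : ℝ) ^ 6 ≤ ((s : ℝ) + r) ^ 2 * ((s : ℝ) + r) ^ 6 := by
          gcongr <;> linarith
      _ = _ := by ring
  calc (r : ℝ) * s * (‖rt r / rt s * (s : ℂ) ^ 4‖ * (1 + |(((s : ℕ) : ℤ) : ℝ)|) * o)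
      ≤ (r : ℝ) * s * ((r * (s : ℝ) ^ 4) * (2 * s) * o) := by gcongr
    _ = 2 * ((r : ℝ) ^ 2 * (s : ℝ) ^ 6 * o) := by ring
    _ ≤ 2 * (((s : ℝ) + r) ^ 8 * o) := by gcongr
    _ ≤ 2 * K := by linarith

theorem oscDominated_neg_zero :
    OscDominated (fun i : ℕ+ × ℕ+ => rt i.1 / rt i.2) (fun i => i.2) (fun i => -(i.1 : ℤ)) := by
  refine oscDominated_neg.of_norm_le fun i => ?_
  rw [norm_mul, norm_pow]
  simp only [Complex.norm_natCast]
  exact le_mul_of_one_le_right (norm_nonneg _) (one_le_pow₀ (pnat_one_le _))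

/-- Domination of the matrix of `A Λ⁻⁴`. The decay `O((k/s)²)` of the entries makes the bound square
summable in `s`, and `Λ⁻⁴` compensates for the growth in `k`, including the factor `k` lost by
differentiation. -/
theorem oscDominated_pos :
    OscDominated (fun i : ℕ+ × ℕ+ => rt i.1 / rt i.2 / (i.2 : ℂ) ^ 4) (fun i => i.2)
      (fun i => (i.1 : ℤ)) := by
  refine oscDominated_of_le fun f₀ hf₀ h₀ => ?_
  obtain ⟨K, hK0, hK⟩ := exists_osc_pos_bound 2 f₀ h₀
  refine ⟨2 * K, hK.mono fun p hp s k => ?_⟩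
  have h := hp k s
  have h1 := pnat_one_le s
  have h2 := pnat_one_le k
  have h3 : ‖rt s / rt k / (k : ℂ) ^ 4‖ ≤ s / (k : ℝ) ^ 4 := by
    rw [norm_div _ ((k : ℂ) ^ 4), norm_pow]
    simp only [Complex.norm_natCast]
    gcongr
    exact norm_rt_div_le s k
  have h4 : 1 + |(((k : ℕ) : ℤ) : ℝ)| ≤ 2 * k := by
    rw [abs_of_nonneg (by positivity)]; push_cast; linarith
  set o := ‖osc p.2 p.1 k s‖ with ho
  have ho0 : 0 ≤ o := norm_nonneg _
  calc (s : ℝ) * k * (‖rt s / rt k / (k : ℂ) ^ 4‖ * (1 + |(((k : ℕ) : ℤ) : ℝ)|) * o)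
      ≤ (s : ℝ) * k * ((s / (k : ℝ) ^ 4) * (2 * k) * o) := by gcongr
    _ = 2 * (((s : ℝ) / k) ^ 2 * o) := by field_simp
    _ ≤ 2 * K := by linarith

/-- The matrix of `C = π₋ T_φ : W₊ → W₋` for `φ = θ + f`. -/
def cMat (f : CircleFun ℝ) : HS :=
  oscFamily (fun i : ℕ+ × ℕ+ => rt i.1 / rt i.2) (fun i => i.2) (fun i => -(i.1 : ℤ)) f (const 1)

/-- The matrix of `π₋ T_φ Λ⁴`, where `Λ e_k = k e_k`. -/
def cpMat (f : CircleFun ℝ) : HS :=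
  oscFamily (fun i : ℕ+ × ℕ+ => rt i.1 / rt i.2 * (i.2 : ℂ) ^ 4) (fun i => i.2)
    (fun i => -(i.1 : ℤ)) f (const 1)

/-- The matrix of `π₊ T_φ Λ⁻⁴ : W₊ → W₊`, where `Λ e_k = k e_k`. -/
def apMat (f : CircleFun ℝ) : HS :=
  oscFamily (fun i : ℕ+ × ℕ+ => rt i.1 / rt i.2 / (i.2 : ℂ) ^ 4) (fun i => i.2)
    (fun i => (i.1 : ℤ)) f (const 1)

theorem le_mul_one_add_abs (a : ℝ) (ha : 0 ≤ a) (k : ℤ) : a ≤ a * (1 + |(k : ℝ)|) :=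
  le_mul_of_one_le_right ha (by linarith [abs_nonneg (k : ℝ)])

theorem cMat_apply {f : CircleFun ℝ} (hf : f ∈ diffDomain) (r s : ℕ+) :
    cMat f (r, s) = rt r / rt s * osc (const 1) f s (-(r : ℤ)) :=
  oscDominated_neg_zero.oscFamily_apply (fun _ => le_mul_one_add_abs _ (norm_nonneg _) _) hf
    _ (r, s)

theorem cpMat_apply {f : CircleFun ℝ} (hf : f ∈ diffDomain) (r s : ℕ+) :
    cpMat f (r, s) = rt r / rt s * (s : ℂ) ^ 4 * osc (const 1) f s (-(r : ℤ)) :=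
  oscDominated_neg.oscFamily_apply (fun _ => le_mul_one_add_abs _ (norm_nonneg _) _) hf _ (r, s)

theorem apMat_apply {f : CircleFun ℝ} (hf : f ∈ diffDomain) (r s : ℕ+) :
    apMat f (r, s) = rt r / rt s / (s : ℂ) ^ 4 * osc (const 1) f s r :=
  oscDominated_pos.oscFamily_apply (fun _ => le_mul_one_add_abs _ (norm_nonneg _) _) hf _ (r, s)

/-! ### Composition with a diffeomorphism -/

theorem coe_induction {p : S1 → Prop} (h : ∀ x : ℝ, p (x : S1)) (x : S1) : p x := by
  induction x using QuotientAddGroup.induction_on with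
  | H x => exact h x

theorem exists_toDiff (φ : DiffS1) : ∃ f ∈ diffDomain, toDiff f = φ := by
  obtain ⟨ψ, hψ, h⟩ := φ.2
  have hper : Function.Periodic (fun x => ψ x - x) (2 * π) := fun x => by
    simp only [hψ.period]; ring
  let f : CircleFun ℝ := ofFun hper.lift (hψ.smooth.sub contDiff_id)
  have hfx : ∀ x : ℝ, f (x : S1) = ψ x - x := fun x => rfl
  have hf : f ∈ diffDomain := coe_induction fun x => by
    have h1 : HasDerivAt (fun x : ℝ => f (x : S1)) (deriv ψ x - 1) x :=
      (((hψ.smooth.differentiable (by simp)) x).hasDerivAt).sub (hasDerivAt_id' x)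
    rw [D_coe, h1.deriv]
    linarith [hψ.deriv_pos x]
  refine ⟨f, hf, Subtype.ext (Equiv.ext (coe_induction fun x => ?_))⟩
  refine (toDiff_apply hf x).trans ?_
  rw [hfx, add_sub_cancel]
  exact (h x).symm

theorem precomp_apply (φ : DiffS1) (σ : CircleFun ℂ) (x : S1) : precomp φ σ x = σ (φ x) := rfl

theorem precomp_expo {f : CircleFun ℝ} (hf : f ∈ diffDomain) (k : ℤ) :
    precomp (toDiff f) (expo k 0) = expo k f := CircleFun.ext fun x => by
  rw [precomp_apply, toDiff_apply hf, expo_coe, expo_coe]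
  simp

theorem T_mk (φ : DiffS1) (σ : CircleFun ℂ) :
    T φ (constFun.mkQ σ) = constFun.mkQ (precomp φ σ) := rfl

theorem T_mul (φ ψ : DiffS1) (σ : VC) : T (φ * ψ) σ = T ψ (T φ σ) := by
  obtain ⟨σ, rfl⟩ := constFun.mkQ_surjective σ
  rfl

theorem T_one (σ : VC) : T 1 σ = σ := by
  obtain ⟨σ, rfl⟩ := constFun.mkQ_surjective σ
  rfl

theorem T_T_inv (φ : DiffS1) (σ : VC) : T φ (T φ⁻¹ σ) = σ := by
  rw [← T_mul, inv_mul_cancel, T_one]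

theorem fhat_expo_zero (k m : ℤ) : fhat (expo k 0) m = if m = k then 1 else 0 := by
  have h : (expo k 0 : S1 → ℂ) = fourier (T := 2 * π) k := funext (expo_zero_right k)
  rw [fhat, h, fourierCoeff_fourier, Pi.single_apply]

theorem hasSum_fourier (σ : CircleFun ℂ) (x : S1) :
    HasSum (fun k : ℤ => fhat σ k * fourier (T := 2 * π) k x) (σ x) :=
  has_pointwise_sum_fourier_series_of_summable (f := σ.toC) (summable_norm_fhat σ).of_norm x

theorem ext_fhat {σ τ : CircleFun ℂ} (h : ∀ n, fhat σ n = fhat τ n) : σ = τ :=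
  CircleFun.ext fun x => by
    have h1 := hasSum_fourier σ x
    simp only [h] at h1
    exact h1.unique (hasSum_fourier τ x)

/-- The Fourier coefficients of `h · (σ ∘ φ)` for `φ = θ + f`. -/
theorem hasSum_fhat_pmul_precomp {f : CircleFun ℝ} (hf : f ∈ diffDomain) (h σ : CircleFun ℂ)
    (m : ℤ) :
    HasSum (fun k : ℤ => fhat σ k * osc h f k m) (fhat (pmul h (precomp (toDiff f) σ)) m) := by
  have hcont : ∀ k : ℤ, Continuous fun x : S1 =>
      fhat σ k * (fourier (T := 2 * π) (-m) x * (h x * expo k f x)) := fun k =>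
    continuous_const.mul ((map_continuous _).mul (h.continuous.mul (expo k f).continuous))
  have hint : ∀ k : ℤ, Integrable (fun x : S1 =>
      fhat σ k * (fourier (T := 2 * π) (-m) x * (h x * expo k f x))) AddCircle.haarAddCircle :=
    fun k => (hcont k).integrable_of_hasCompactSupport (HasCompactSupport.of_compactSpace _)
  have hsum : Summable fun k : ℤ => ∫ x : S1,
      ‖fhat σ k * (fourier (T := 2 * π) (-m) x * (h x * expo k f x))‖
        ∂AddCircle.haarAddCircle := by
    simp only [norm_mul, norm_fourier_apply, norm_expo, one_mul, mul_one, integral_const_mul]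
    exact (summable_norm_fhat σ).mul_right _
  have h1 := hasSum_integral_of_summable_integral_norm hint hsum
  have h2 : ∀ x : S1, ∑' k : ℤ, fhat σ k * (fourier (T := 2 * π) (-m) x * (h x * expo k f x))
      = fourier (T := 2 * π) (-m) x * (h x * precomp (toDiff f) σ x) := fun x => by
    have h3 := (hasSum_fourier σ (toDiff f x)).mul_left (fourier (T := 2 * π) (-m) x * h x)
    rw [← mul_assoc, precomp_apply, ← h3.tsum_eq]
    congr 1
    funext k
    have h4 : fourier (T := 2 * π) k (toDiff f x) = expo k f x := by
      rw [← precomp_expo hf, precomp_apply, expo_zero_right]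
    rw [h4]
    ring
  simp only [h2, integral_const_mul] at h1
  exact h1

theorem const_one_pmul (σ : CircleFun ℂ) : pmul (const 1) σ = σ :=
  CircleFun.ext fun _ => one_mul _

theorem osc_one (f : CircleFun ℝ) (k m : ℤ) : osc (const 1) f k m = fhat (expo k f) m := by
  rw [osc, const_one_pmul]

/-! ### The symplectic and the Hermitian form -/

/-- Complex conjugation of functions. -/
def conjF (σ : CircleFun ℂ) : CircleFun ℂ :=
  ofFun (fun x => conj (σ x)) (Complex.conjCLE.contDiff.comp σ.contDiff)

theorem fhat_conjF (σ : CircleFun ℂ) (n : ℤ) : fhat (conjF σ) n = conj (fhat σ (-n)) := by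
  unfold fhat fourierCoeff
  rw [← integral_conj]
  congr 1
  funext x
  simp only [smul_eq_mul, map_mul, ← fourier_neg, neg_neg]
  rfl

/-- The Hermitian form `⟨p₊, q₊⟩ - ⟨p₋, q₋⟩`. -/
def krein (p q : Hilb × Hilb) : ℂ := inner ℂ p.1 q.1 - inner ℂ p.2 q.2

theorem symplHilb_eq_inner (p q : Hilb × Hilb) :
    symplHilb p q = 2 * π * Complex.I * (inner ℂ (star p.2) q.1 - inner ℂ (star p.1) q.2) := by
  have h1 := (lp.hasSum_inner (𝕜 := ℂ) (star p.2) q.1).sub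
    (lp.hasSum_inner (𝕜 := ℂ) (star p.1) q.2)
  rw [symplHilb, ← h1.tsum_eq]
  congr 2
  funext k
  simp only [RCLike.inner_apply, lp.star_apply, RCLike.star_def, Complex.conj_conj]
  ring

theorem continuous_symplHilb :
    Continuous fun p : (Hilb × Hilb) × (Hilb × Hilb) => symplHilb p.1 p.2 := by
  simp only [symplHilb_eq_inner]
  fun_prop

theorem split_mk_fst (σ : CircleFun ℂ) (k : ℕ+) :
    (split (constFun.mkQ σ)).1 k = rt k * fhat σ k := piPlus_apply σ k

theorem split_mk_snd (σ : CircleFun ℂ) (k : ℕ+) :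
    (split (constFun.mkQ σ)).2 k = rt k * fhat σ (-(k : ℤ)) := piMinus_apply σ k

theorem sympl_conjF (σ τ : CircleFun ℂ) : sympl (conjF σ) τ =
    2 * π * Complex.I * krein (split (constFun.mkQ σ)) (split (constFun.mkQ τ)) := by
  have h1 : star (split (constFun.mkQ (conjF σ))).2 = (split (constFun.mkQ σ)).1 := by
    ext k
    simp only [lp.star_apply, split_mk_fst, split_mk_snd, fhat_conjF, RCLike.star_def, map_mul,
      conj_rt, Complex.conj_conj, neg_neg]
  have h2 : star (split (constFun.mkQ (conjF σ))).1 = (split (constFun.mkQ σ)).2 := by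
    ext k
    simp only [lp.star_apply, split_mk_fst, split_mk_snd, fhat_conjF, RCLike.star_def, map_mul,
      conj_rt, Complex.conj_conj]
  rw [sympl_eq, symplHilb_eq_inner, h1, h2, krein]

/-- The symplectic form is invariant under diffeomorphisms (substitution rule). -/
theorem sympl_precomp (φ : DiffS1) (σ τ : CircleFun ℂ) :
    sympl (precomp φ σ) (precomp φ τ) = sympl σ τ := by
  obtain ⟨ψ, hψ, h⟩ := φ.2
  have hd : ∀ x, HasDerivAt ψ (deriv ψ x) x := fun x =>
    ((hψ.smooth.differentiable (by simp)) x).hasDerivAt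
  have hτ : ∀ x : ℝ, (precomp φ τ).D (x : S1) = deriv ψ x • τ.D ((ψ x : ℝ) : S1) := fun x => by
    have h1 := (τ.hasDerivAt (ψ x)).scomp x (hd x)
    have h2 : (fun x : ℝ => precomp φ τ (x : S1)) = (fun x : ℝ => τ (x : S1)) ∘ ψ :=
      funext fun x => congrArg τ.toFun (h x)
    rw [D_coe, h2, h1.deriv]
  have hc : Continuous fun x : ℝ => σ (x : S1) * τ.D (x : S1) :=
    σ.contDiff.continuous.mul τ.D.contDiff.continuous
  have hp : Function.Periodic (fun x : ℝ => σ (x : S1) * τ.D (x : S1)) (2 * π) := fun x => by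
    simp only [AddCircle.coe_add_period]
  have e := intervalIntegral.integral_deriv_smul_comp (a := 0) (b := 2 * π)
    (g := fun x : ℝ => σ (x : S1) * τ.D (x : S1)) (fun x _ => hd x)
    ((hψ.smooth.continuous_deriv (by simp)).continuousOn) hc
  have e2 : ψ (2 * π) = ψ 0 + 2 * π := by rw [← hψ.period, zero_add]
  rw [e2, hp.intervalIntegral_add_eq (ψ 0) 0, zero_add] at e
  rw [sympl, sympl, ← e]
  congr 1
  funext x
  have h3 : precomp φ σ (x : S1) = σ ((ψ x : ℝ) : S1) := congrArg σ.toFun (h x)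
  rw [h3, hτ, mul_smul_comm]
  rfl

theorem symplHilb_T (φ : DiffS1) (σ τ : VC) :
    symplHilb (split (T φ σ)) (split (T φ τ)) = symplHilb (split σ) (split τ) := by
  obtain ⟨σ, rfl⟩ := constFun.mkQ_surjective σ
  obtain ⟨τ, rfl⟩ := constFun.mkQ_surjective τ
  rw [T_mk, T_mk, ← sympl_eq, ← sympl_eq, sympl_precomp]

theorem two_pi_I_ne_zero : (2 * π * Complex.I : ℂ) ≠ 0 := by
  have : (π : ℂ) ≠ 0 := by exact_mod_cast Real.pi_ne_zero
  simp [this]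

theorem krein_T (φ : DiffS1) (σ τ : VC) :
    krein (split (T φ σ)) (split (T φ τ)) = krein (split σ) (split τ) := by
  obtain ⟨σ, rfl⟩ := constFun.mkQ_surjective σ
  obtain ⟨τ, rfl⟩ := constFun.mkQ_surjective τ
  have h := sympl_precomp φ (conjF σ) τ
  have h1 : precomp φ (conjF σ) = conjF (precomp φ σ) := rfl
  rw [h1, sympl_conjF, sympl_conjF] at h
  exact mul_left_cancel₀ two_pi_I_ne_zero h

theorem mem_Wplus_iff (σ : CircleFun ℂ) : constFun.mkQ σ ∈ Wplus ↔ ∀ n < 0, fhat σ n = 0 := by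
  constructor
  · rintro ⟨τ, hτ, h⟩ n hn
    have h1 : τ - σ ∈ constFun := (Submodule.Quotient.eq _).1 h
    have h2 := fhat_const h1 hn.ne
    have h3 : fhat (τ - σ) n = fhat τ n - fhat σ n := by
      have : τ - σ = τ + (-1 : ℂ) • σ := by rw [neg_one_smul, sub_eq_add_neg]
      rw [this, fhat_add, fhat_smul]; ring
    rw [h3, hτ n hn, zero_sub, neg_eq_zero] at h2
    exact h2
  · exact fun h => ⟨σ, h, rfl⟩

theorem expo_mem_Wplus (k : ℕ+) : constFun.mkQ (expo k 0) ∈ Wplus := by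
  rw [mem_Wplus_iff]
  intro n hn
  rw [fhat_expo_zero, if_neg]
  have := k.pos
  omega

theorem piMinus_of_mem {σ : VC} (hσ : σ ∈ Wplus) : piMinus σ = 0 := by
  obtain ⟨σ, rfl⟩ := constFun.mkQ_surjective σ
  ext k
  rw [piMinus_apply, (mem_Wplus_iff σ).1 hσ _ (by have := k.pos; omega), mul_zero]
  rfl

theorem piPlus_expo (k : ℕ+) : piPlus (constFun.mkQ (expo k 0)) = rt k • basisVec k := by
  ext l
  rw [piPlus_apply, fhat_expo_zero]
  change _ = rt k * basisVec k l
  rw [basisVec_apply]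
  by_cases h : l = k
  · subst h; simp [rt]
  · have : (l : ℤ) ≠ k := by exact_mod_cast fun h' => h (PNat.coe_injective h')
    simp [h]

/-- `π₊` restricted to `W₊`. -/
def plusW : Wplus →ₗ[ℂ] Hilb := piPlus ∘ₗ Wplus.subtype

theorem denseRange_plusW : DenseRange plusW := by
  intro x
  have hk : ∀ k, basisVec k ∈ LinearMap.range plusW := fun k => by
    refine ⟨(rt k)⁻¹ • ⟨_, expo_mem_Wplus k⟩, ?_⟩
    rw [map_smul]
    change (rt k)⁻¹ • piPlus (constFun.mkQ (expo k 0)) = _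
    rw [piPlus_expo, inv_smul_smul₀ (rt_ne_zero k)]
  refine mem_closure_of_tendsto (hasSum_basisVec x) (Eventually.of_forall fun s => ?_)
  have := Submodule.sum_mem (LinearMap.range plusW) (t := s) (f := fun k => x k • basisVec k)
    fun k _ => Submodule.smul_mem _ _ (hk k)
  exact this

/-! ### The blocks of the composition operator -/

/-- The matrix `cMat f` is that of `π₋ T_φ` on `W₊`. -/
theorem toOp_cMat {f : CircleFun ℝ} (hf : f ∈ diffDomain) (σ : VC) (hσ : σ ∈ Wplus) :
    toOp (cMat f) (piPlus σ) = piMinus (T (toDiff f) σ) := by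
  obtain ⟨σ, rfl⟩ := constFun.mkQ_surjective σ
  rw [mem_Wplus_iff] at hσ
  ext r
  rw [T_mk, piMinus_apply, toOp_apply]
  have h := hasSum_fhat_pmul_precomp hf (const 1) σ (-(r : ℤ))
  rw [const_one_pmul] at h
  have h0 : osc (const 1) f 0 (-(r : ℤ)) = 0 := by
    rw [osc_one, expo_zero_left, fhat_const ⟨1, fun _ => rfl⟩ (by simp)]
  have hinj : Function.Injective fun k : ℕ+ => ((k : ℕ) : ℤ) := fun k l h => by
    have h' : ((k : ℕ) : ℤ) = (l : ℕ) := h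
    exact PNat.coe_injective (by exact_mod_cast h')
  have h1 := (hinj.hasSum_iff fun k hk => ?_).2 h
  · refine Eq.trans ?_ (h1.mul_left (rt r)).tsum_eq
    congr 1
    funext k
    rw [cMat_apply hf, piPlus_apply]
    change rt r / rt k * osc (const 1) f k (-(r : ℤ)) * (rt k * fhat σ k)
      = rt r * (fhat σ k * osc (const 1) f k (-(r : ℤ)))
    have := rt_ne_zero k
    field_simp
  · rcases lt_trichotomy k 0 with h2 | h2 | h2
    · rw [hσ k h2, zero_mul]
    · rw [h2, h0, mul_zero]
    · exact absurd ⟨⟨k.toNat, by omega⟩, by simp [h2.le]⟩ hk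

theorem krein_self (p : Hilb × Hilb) : krein p p = ((‖p.1‖ ^ 2 - ‖p.2‖ ^ 2 : ℝ) : ℂ) := by
  rw [krein, inner_self_eq_norm_sq_to_K, inner_self_eq_norm_sq_to_K]
  push_cast
  rfl

theorem norm_sq_piPlus_T (φ : DiffS1) {σ : VC} (hσ : σ ∈ Wplus) :
    ‖piPlus (T φ σ)‖ ^ 2 = ‖piPlus σ‖ ^ 2 + ‖piMinus (T φ σ)‖ ^ 2 := by
  have h := krein_T φ σ σ
  rw [krein_self, krein_self, Complex.ofReal_inj] at h
  simp only [split, piMinus_of_mem hσ, norm_zero] at h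
  linarith

/-- The block `π₊ T_φ : W₊ → W₊`, extended to the completion. -/
def opA (φ : DiffS1) : Hilb →L[ℂ] Hilb :=
  (piPlus ∘ₗ T φ ∘ₗ Wplus.subtype).extendOfNorm plusW

/-- The block `π₊ T_φ` of `T_φ` is bounded because the block `π₋ T_φ` is. -/
theorem opA_piPlus (φ : DiffS1) {σ : VC} (hσ : σ ∈ Wplus) :
    opA φ (piPlus σ) = piPlus (T φ σ) := by
  refine LinearMap.extendOfNorm_eq (f := piPlus ∘ₗ T φ ∘ₗ Wplus.subtype) denseRange_plusW
    ?_ ⟨σ, hσ⟩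
  obtain ⟨f, hf, rfl⟩ := exists_toDiff φ
  refine ⟨1 + ‖cMat f‖, fun τ => ?_⟩
  change ‖piPlus (T (toDiff f) τ)‖ ≤ (1 + ‖cMat f‖) * ‖piPlus (τ : VC)‖
  refine le_of_sq_le_sq ?_ (by positivity)
  rw [norm_sq_piPlus_T _ τ.2, ← toOp_cMat hf _ τ.2]
  have h1 : ‖toOp (cMat f) (piPlus (τ : VC))‖ ≤ ‖cMat f‖ * ‖piPlus (τ : VC)‖ :=
    (toOp (cMat f)).le_of_opNorm_le (norm_toOp_le _) _
  have h2 := pow_le_pow_left₀ (norm_nonneg _) h1 2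
  nlinarith [norm_nonneg (cMat f), norm_nonneg (piPlus (τ : VC)),
    mul_nonneg (norm_nonneg (cMat f)) (sq_nonneg ‖piPlus (τ : VC)‖)]

theorem opA_basisVec {f : CircleFun ℝ} (hf : f ∈ diffDomain) (k s : ℕ+) :
    opA (toDiff f) (basisVec k) s = rt s / rt k * osc (const 1) f k s := by
  have h1 : basisVec k = (rt k)⁻¹ • piPlus (constFun.mkQ (expo k 0)) := by
    rw [piPlus_expo, inv_smul_smul₀ (rt_ne_zero k)]
  rw [h1, map_smul, opA_piPlus _ (expo_mem_Wplus k), T_mk, precomp_expo hf]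
  change (rt k)⁻¹ * piPlus (constFun.mkQ (expo k f)) s = _
  rw [piPlus_apply, osc_one]
  change (rt k)⁻¹ * (rt s * _) = _
  ring

theorem norm_sq_opA {f : CircleFun ℝ} (hf : f ∈ diffDomain) (x : Hilb) :
    ‖opA (toDiff f) x‖ ^ 2 = ‖x‖ ^ 2 + ‖toOp (cMat f) x‖ ^ 2 := by
  refine denseRange_plusW.induction_on x (isClosed_eq (by fun_prop) (by fun_prop)) fun σ => ?_
  change ‖opA (toDiff f) (piPlus (σ : VC))‖ ^ 2 = ‖piPlus (σ : VC)‖ ^ 2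
    + ‖toOp (cMat f) (piPlus (σ : VC))‖ ^ 2
  rw [opA_piPlus _ σ.2, toOp_cMat hf _ σ.2, norm_sq_piPlus_T _ σ.2]

/-- The invariance of the Hermitian form makes `T_{φ⁻¹}` the adjoint of `T_φ` with respect to it.
-/
theorem adjoint_opA (φ : DiffS1) : ContinuousLinearMap.adjoint (opA φ) = opA φ⁻¹ := by
  symm
  rw [ContinuousLinearMap.eq_adjoint_iff]
  intro x y
  refine denseRange_plusW.induction_on₂ (p := fun x y => inner ℂ (opA φ⁻¹ x) y
    = inner ℂ x (opA φ y)) (isClosed_eq (by fun_prop) (by fun_prop)) (fun σ τ => ?_) x y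
  change inner ℂ (opA φ⁻¹ (piPlus (σ : VC))) (piPlus (τ : VC))
    = inner ℂ (piPlus (σ : VC)) (opA φ (piPlus (τ : VC)))
  have h := krein_T φ (T φ⁻¹ σ) τ
  rw [T_T_inv] at h
  simp only [krein, split, piMinus_of_mem σ.2, piMinus_of_mem τ.2, inner_zero_left,
    inner_zero_right, sub_zero] at h
  rw [opA_piPlus _ σ.2, opA_piPlus _ τ.2, h]

theorem sympl_expo_right (σ : CircleFun ℂ) (r : ℕ+) :
    sympl σ (expo r 0) = 2 * π * Complex.I * (r * fhat σ (-(r : ℤ))) := by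
  have h := hasSum_sympl σ (expo r 0)
  have h1 := hasSum_single (f := fun n : ℤ =>
    2 * π * Complex.I * (-n * (fhat σ n * fhat (expo r 0) (-n)))) (-(r : ℤ)) fun n hn => by
      rw [fhat_expo_zero, if_neg (by omega)]; simp
  rw [h.unique h1, fhat_expo_zero, if_pos (by simp)]
  push_cast
  ring

theorem sympl_expo_left (τ : CircleFun ℂ) (s : ℕ+) :
    sympl (expo s 0) τ = -(2 * π * Complex.I * (s * fhat τ (-(s : ℤ)))) := by
  have h := hasSum_sympl (expo s 0) τ
  have h1 := hasSum_single (f := fun n : ℤ =>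
    2 * π * Complex.I * (-n * (fhat (expo s 0) n * fhat τ (-n)))) (s : ℤ) fun n hn => by
      rw [fhat_expo_zero, if_neg hn]; simp
  rw [h.unique h1, fhat_expo_zero, if_pos rfl]
  push_cast
  ring

/-- Invariance of the symplectic form relates the matrices of `φ` and `φ⁻¹`. -/
theorem cMat_inv {f g : CircleFun ℝ} (hf : f ∈ diffDomain) (hg : g ∈ diffDomain)
    (hfg : toDiff g = (toDiff f)⁻¹) (r s : ℕ+) : cMat g (r, s) = -cMat f (s, r) := by
  have h := sympl_precomp (toDiff f) (precomp (toDiff g) (expo s 0)) (expo r 0)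
  have h1 : precomp (toDiff f) (precomp (toDiff g) (expo s 0)) = expo s 0 := by
    rw [hfg]
    exact CircleFun.ext fun x => congrArg (expo s 0).toFun ((toDiff f).1.symm_apply_apply x)
  rw [h1, precomp_expo hf, precomp_expo hg, sympl_expo_left, sympl_expo_right, ← mul_neg] at h
  have h2 := mul_left_cancel₀ two_pi_I_ne_zero h
  rw [cMat_apply hf, cMat_apply hg, osc_one, osc_one]
  have hr := rt_ne_zero r
  have hs := rt_ne_zero s
  have hr' := rt_mul_self r
  have hs' := rt_mul_self s
  field_simp
  linear_combination (fhat (expo s g) (-(r : ℤ))) * hr' + (fhat (expo r f) (-(s : ℤ))) * hs' - h2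

theorem norm_toOp_cMat_inv {f g : CircleFun ℝ} (hf : f ∈ diffDomain) (hg : g ∈ diffDomain)
    (hfg : toDiff g = (toDiff f)⁻¹) (x : Hilb) :
    ‖toOp (cMat g) x‖ = ‖ContinuousLinearMap.adjoint (toOp (star (cMat f))) x‖ := by
  have h : toOp (cMat g) x = -ContinuousLinearMap.adjoint (toOp (star (cMat f))) x := by
    ext r
    change _ = -(ContinuousLinearMap.adjoint (toOp (star (cMat f))) x r)
    rw [toOp_conjTranspose, toOp_apply, ← tsum_neg]
    congr 1
    funext s
    rw [cMat_inv hf hg hfg, lp.star_apply, RCLike.star_def, Complex.conj_conj, neg_mul]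
  rw [h, norm_neg]

theorem inner_apply_adjoint_self (B : Hilb →L[ℂ] Hilb) (x : Hilb) :
    inner ℂ (B (ContinuousLinearMap.adjoint B x)) x
      = ((‖ContinuousLinearMap.adjoint B x‖ ^ 2 : ℝ) : ℂ) := by
  rw [← ContinuousLinearMap.adjoint_inner_right B, inner_self_eq_norm_sq_to_K]
  push_cast
  rfl

/-- `A A† = 1 + B B†`, where `B` is the block `π₊ T_φ : W₋ → W₊`. -/
theorem opA_mul_adjoint {f : CircleFun ℝ} (hf : f ∈ diffDomain) :
    opA (toDiff f) * ContinuousLinearMap.adjoint (opA (toDiff f)) = posOp (cMat f) := by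
  obtain ⟨g, hg, hfg⟩ := exists_toDiff (toDiff f)⁻¹
  have hlin : ((opA (toDiff f) * ContinuousLinearMap.adjoint (opA (toDiff f)) :
      Hilb →L[ℂ] Hilb) : Hilb →ₗ[ℂ] Hilb) = (posOp (cMat f) : Hilb →ₗ[ℂ] Hilb) := by
    rw [← ext_inner_map]
    intro x
    change inner ℂ (opA (toDiff f) (ContinuousLinearMap.adjoint (opA (toDiff f)) x)) x
      = inner ℂ (x + toOp (star (cMat f))
        (ContinuousLinearMap.adjoint (toOp (star (cMat f))) x)) x
    have hx : inner ℂ x x = ((‖x‖ ^ 2 : ℝ) : ℂ) := by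
      rw [inner_self_eq_norm_sq_to_K]; push_cast; rfl
    rw [inner_add_left, inner_apply_adjoint_self, inner_apply_adjoint_self, hx,
      adjoint_opA, ← hfg, ← norm_toOp_cMat_inv hf hg hfg, norm_sq_opA hg x]
    push_cast
    rfl
  exact ContinuousLinearMap.coe_injective hlin

/-- Both `A A†` and `A† A` are of the form `1 + B B†`, hence invertible. -/
theorem isUnit_opA {f : CircleFun ℝ} (hf : f ∈ diffDomain) : IsUnit (opA (toDiff f)) := by
  obtain ⟨g, hg, hfg⟩ := exists_toDiff (toDiff f)⁻¹
  obtain ⟨u, hu⟩ := isUnit_posOp (cMat f)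
  obtain ⟨v, hv⟩ := isUnit_posOp (cMat g)
  rw [← opA_mul_adjoint hf, adjoint_opA, ← hfg] at hu
  rw [← opA_mul_adjoint hg, adjoint_opA, hfg, inv_inv, ← hfg] at hv
  have h1 : opA (toDiff f) * (opA (toDiff g) * ↑u⁻¹) = 1 := by
    rw [← mul_assoc, ← hu, Units.mul_inv]
  have h2 : (↑v⁻¹ * opA (toDiff g)) * opA (toDiff f) = 1 := by
    rw [mul_assoc, ← hv, Units.inv_mul]
  have h3 := left_inv_eq_right_inv h2 h1
  rw [h3] at h2
  exact ⟨⟨_, _, h1, h2⟩, rfl⟩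

theorem surjective_opA {f : CircleFun ℝ} (hf : f ∈ diffDomain) :
    Function.Surjective (opA (toDiff f)) := fun x => by
  obtain ⟨u, hu⟩ := isUnit_opA hf
  refine ⟨(↑u⁻¹ : Hilb →L[ℂ] Hilb) x, ?_⟩
  rw [← hu]
  exact congrArg (fun T : Hilb →L[ℂ] Hilb => T x) u.mul_inv

theorem toOp_apMat_basisVec {f : CircleFun ℝ} (hf : f ∈ diffDomain) (k : ℕ+) :
    toOp (apMat f) (basisVec k) = ((k : ℂ) ^ 4)⁻¹ • opA (toDiff f) (basisVec k) := by
  ext s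
  change _ = ((k : ℂ) ^ 4)⁻¹ * opA (toDiff f) (basisVec k) s
  rw [toOp_basisVec, apMat_apply hf, opA_basisVec hf]
  ring

/-- `(C Λ⁴) (A Λ⁻⁴)† = C A†`. -/
theorem toOp_cpMat_adjoint {f : CircleFun ℝ} (hf : f ∈ diffDomain) :
    toOp (cpMat f) * ContinuousLinearMap.adjoint (toOp (apMat f)) =
      toOp (cMat f) * ContinuousLinearMap.adjoint (opA (toDiff f)) := by
  ext x r
  change toOp (cpMat f) (ContinuousLinearMap.adjoint (toOp (apMat f)) x) r
    = toOp (cMat f) (ContinuousLinearMap.adjoint (opA (toDiff f)) x) r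
  rw [toOp_apply, toOp_apply]
  congr 1
  funext k
  have hk : (k : ℂ) ≠ 0 := by exact_mod_cast k.ne_zero
  rw [← inner_basisVec k (ContinuousLinearMap.adjoint _ x), ← inner_basisVec k
    (ContinuousLinearMap.adjoint _ x), ContinuousLinearMap.adjoint_inner_right,
    ContinuousLinearMap.adjoint_inner_right, toOp_apMat_basisVec hf, inner_smul_left,
    cpMat_apply hf, cMat_apply hf]
  simp only [map_inv₀, map_pow, Complex.conj_natCast]
  field_simp

/-! ### The operator whose graph is the polarization -/

/-- The operator `Z = C A⁻¹ = (C A†) (A A†)⁻¹`, where `A` and `C` are the blocks of `T_φ` on `W₊`.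
It is written as `(C Λ⁴) (A Λ⁻⁴)† (1 + B B†)⁻¹`, whose factors depend differentiably on `φ`, while `A`
alone is only strongly continuous in `φ`. -/
def Zmat (f : CircleFun ℝ) : HS := graphMap (cpMat f, apMat f, cMat f)

/-- `Z A = C`, because `Z (A A†) = C A†` and `A†` is invertible. -/
theorem toOp_Zmat_opA {f : CircleFun ℝ} (hf : f ∈ diffDomain) :
    toOp (Zmat f) * opA (toDiff f) = toOp (cMat f) := by
  have h1 : toOp (Zmat f) = toOp (cMat f) * ContinuousLinearMap.adjoint (opA (toDiff f)) *
      Ring.inverse (posOp (cMat f)) := by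
    rw [← toOp_cpMat_adjoint hf, Zmat, graphMap, toOp_mulR]
    rfl
  obtain ⟨u, hu⟩ := isUnit_opA hf
  have h2 : toOp (Zmat f) * posOp (cMat f)
      = toOp (cMat f) * ContinuousLinearMap.adjoint (opA (toDiff f)) := by
    rw [h1, mul_assoc, Ring.inverse_mul_cancel _ (isUnit_posOp _), mul_one]
  rw [← opA_mul_adjoint hf, ← mul_assoc] at h2
  obtain ⟨g, hg, hfg⟩ := exists_toDiff (toDiff f)⁻¹
  have h3 := isUnit_opA hg
  rw [hfg, ← adjoint_opA] at h3
  exact h3.mul_right_cancel h2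

theorem Zmat_apply_opA {f : CircleFun ℝ} (hf : f ∈ diffDomain) (x : Hilb) :
    toOp (Zmat f) (opA (toDiff f) x) = toOp (cMat f) x :=
  congrArg (fun T : Hilb →L[ℂ] Hilb => T x) (toOp_Zmat_opA hf)

theorem Zmat_apply_T {f : CircleFun ℝ} (hf : f ∈ diffDomain) {σ : VC} (hσ : σ ∈ Wplus) :
    toOp (Zmat f) (piPlus (T (toDiff f) σ)) = piMinus (T (toDiff f) σ) := by
  rw [← opA_piPlus _ hσ, Zmat_apply_opA hf, toOp_cMat hf _ hσ]

theorem graph_Zmat {f : CircleFun ℝ} (hf : f ∈ diffDomain) :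
    {p : Hilb × Hilb | p.2 = toOp (Zmat f) p.1} =
      closure (split '' (Submodule.map (T (toDiff f)) Wplus : Set VC)) := by
  apply Set.Subset.antisymm
  · rintro ⟨x, y⟩ (rfl : y = toOp (Zmat f) x)
    obtain ⟨w, rfl⟩ := surjective_opA hf x
    refine denseRange_plusW.induction_on (p := fun w => (opA (toDiff f) w,
      toOp (Zmat f) (opA (toDiff f) w)) ∈ closure (split '' (Submodule.map (T (toDiff f)) Wplus :
        Set VC))) w (isClosed_closure.preimage (by fun_prop)) fun σ => subset_closure ?_
    refine ⟨_, ⟨σ, σ.2, rfl⟩, ?_⟩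
    change (piPlus _, piMinus _) = (opA _ (piPlus (σ : VC)), toOp _ (opA _ (piPlus (σ : VC))))
    rw [opA_piPlus _ σ.2, Zmat_apply_T hf σ.2]
  · refine closure_minimal ?_ (isClosed_eq (by fun_prop) (by fun_prop))
    rintro _ ⟨_, ⟨σ, hσ, rfl⟩, rfl⟩
    exact (Zmat_apply_T hf hσ).symm

theorem symplHilb_W {σ τ : VC} (hσ : σ ∈ Wplus) (hτ : τ ∈ Wplus) :
    symplHilb (split σ) (split τ) = 0 := by
  rw [symplHilb_eq_inner]
  simp only [split, piMinus_of_mem hσ, piMinus_of_mem hτ]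
  simp

theorem symplHilb_closure {S : Set (Hilb × Hilb)} (h : ∀ p ∈ S, ∀ q ∈ S, symplHilb p q = 0)
    {p q : Hilb × Hilb} (hp : p ∈ closure S) (hq : q ∈ closure S) : symplHilb p q = 0 := by
  have h1 : (p, q) ∈ closure (S ×ˢ S) := by
    rw [closure_prod_eq]; exact ⟨hp, hq⟩
  have h2 : IsClosed {z : (Hilb × Hilb) × (Hilb × Hilb) | symplHilb z.1 z.2 = 0} :=
    isClosed_eq continuous_symplHilb continuous_const
  have h3 : S ×ˢ S ⊆ {z : (Hilb × Hilb) × (Hilb × Hilb) | symplHilb z.1 z.2 = 0} :=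
    fun z hz => h z.1 hz.1 z.2 hz.2
  exact closure_minimal h3 h2 h1

/-- The graph of `Zmat f` is isotropic. -/
theorem symplHilb_graph {f : CircleFun ℝ} (hf : f ∈ diffDomain) (x y : Hilb) :
    symplHilb (x, toOp (Zmat f) x) (y, toOp (Zmat f) y) = 0 := by
  have hmem : ∀ x, (x, toOp (Zmat f) x) ∈
      closure (split '' (Submodule.map (T (toDiff f)) Wplus : Set VC)) := fun x => by
    rw [← graph_Zmat hf]; rfl
  refine symplHilb_closure ?_ (hmem x) (hmem y)
  rintro _ ⟨_, ⟨σ, hσ, rfl⟩, rfl⟩ _ ⟨_, ⟨τ, hτ, rfl⟩, rfl⟩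
  exact (symplHilb_T _ _ _).trans (symplHilb_W hσ hτ)

theorem Zmat_symm {f : CircleFun ℝ} (hf : f ∈ diffDomain) (x y : Hilb) :
    inner ℂ (star (toOp (Zmat f) x)) y = inner ℂ (star x) (toOp (Zmat f) y) := by
  have h := symplHilb_graph hf x y
  rw [symplHilb_eq_inner] at h
  exact sub_eq_zero.1 ((mul_eq_zero.1 h).resolve_left two_pi_I_ne_zero)

theorem star_toOp (Z : HS) (x : Hilb) : star (toOp Z x) = toOp (star Z) (star x) := by
  ext r
  rw [lp.star_apply, toOp_apply, toOp_apply, RCLike.star_def, Complex.conj_tsum]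
  congr 1
  funext s
  rw [map_mul, lp.star_apply, lp.star_apply]
  rfl

theorem inner_star_star (x y : Hilb) : inner ℂ (star x) (star y) = inner ℂ y x := by
  rw [← (lp.hasSum_inner (star x) (star y)).tsum_eq, ← (lp.hasSum_inner y x).tsum_eq]
  congr 1
  funext k
  simp only [RCLike.inner_apply, lp.star_apply, RCLike.star_def, Complex.conj_conj]
  ring

/-- `‖A w‖² - ‖Z A w‖² = ‖A w‖² - ‖C w‖² = ‖w‖²`. -/
theorem norm_Zmat_apply_lt {f : CircleFun ℝ} (hf : f ∈ diffDomain) {x : Hilb} (hx : x ≠ 0) :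
    ‖toOp (Zmat f) x‖ < ‖x‖ := by
  obtain ⟨w, rfl⟩ := surjective_opA hf x
  have hw : w ≠ 0 := by
    rintro rfl
    simp at hx
  have h := norm_sq_opA hf w
  rw [Zmat_apply_opA hf]
  have h1 : 0 < ‖w‖ := norm_pos_iff.2 hw
  refine lt_of_pow_lt_pow_left₀ 2 (norm_nonneg _) ?_
  rw [h]
  have : 0 < ‖w‖ ^ 2 := by positivity
  linarith

theorem Zmat_mem {f : CircleFun ℝ} (hf : f ∈ diffDomain) : Zmat f ∈ SiegelDisc := by
  refine ⟨fun x y => ?_, fun y hy => ?_⟩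
  · rw [symplHilb_eq_inner, symplHilb_eq_inner]
    congr 1
    simp only [star_zero, inner_zero_left, sub_zero]
    rw [Zmat_symm hf, ← inner_star_star, star_star]
  · -- As `Z` is symmetric, `⟨y, Z Z̄ y⟩ = ‖Z̄ y‖² = ‖Z ȳ‖² < ‖y‖²`.
    have h1 : inner ℂ y (toOp (Zmat f) (toOp (star (Zmat f)) y))
        = ((‖toOp (star (Zmat f)) y‖ ^ 2 : ℝ) : ℂ) := by
      have h2 := Zmat_symm hf (star y) (toOp (star (Zmat f)) y)
      rw [star_toOp, star_star] at h2
      rw [← h2, inner_self_eq_norm_sq_to_K]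
      push_cast
      rfl
    have h3 : ‖toOp (star (Zmat f)) y‖ < ‖y‖ := by
      have h4 := norm_Zmat_apply_lt hf (x := star y) (star_ne_zero.2 hy)
      rwa [norm_star, ← norm_star (toOp _ _), star_toOp, star_star] at h4
    have h5 : ‖toOp (star (Zmat f)) y‖ ^ 2 < ‖y‖ ^ 2 :=
      pow_lt_pow_left₀ h3 (norm_nonneg _) two_ne_zero
    rw [inner_sub_right, h1, inner_self_eq_norm_sq_to_K, Complex.sub_re, Complex.ofReal_re]
    have h6 : (((‖y‖ : ℝ) : ℂ) ^ 2).re = ‖y‖ ^ 2 := by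
      rw [← Complex.ofReal_pow, Complex.ofReal_re]
    change 0 < (((‖y‖ : ℝ) : ℂ) ^ 2).re - _
    rw [h6]
    linarith

theorem exists_hasC1_Zmat : ∃ dZ, HasC1 Zmat dZ :=
  ⟨_, (oscDominated_neg.hasC1.prodMk (oscDominated_pos.hasC1.prodMk
    oscDominated_neg_zero.hasC1)).comp fun _ _ => contDiffAt_graphMap _⟩

/-! ### Möbius transformations preserve `W₊` -/

/-- The boundary values of a function that is holomorphic on the closed disc have no Fourier
components of negative index (Cauchy's theorem). -/
theorem fhat_eq_zero_of_holomorphic {G : ℂ → ℂ}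
    (hG : DifferentiableOn ℂ G (Metric.closedBall 0 1)) {τ : CircleFun ℂ}
    (hτ : ∀ x : ℝ, τ (x : S1) = G (Complex.exp (x * Complex.I))) {n : ℤ} (hn : n < 0) :
    fhat τ n = 0 := by
  obtain ⟨r, rfl⟩ : ∃ r : ℕ, n = -((r : ℤ) + 1) := ⟨(-n - 1).toNat, by omega⟩
  have h := Complex.circleIntegral_eq_zero_of_differentiable_on_off_countable (zero_le_one' ℝ)
    (f := fun z => z ^ r * G z) (c := 0) Set.countable_empty
    ((continuous_pow r).continuousOn.mul hG.continuousOn) fun z hz =>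
      (differentiableAt_pow r).mul (hG.differentiableAt
        (mem_of_superset (Metric.isOpen_ball.mem_nhds hz.1) Metric.ball_subset_closedBall))
  rw [circleIntegral] at h
  rw [fhat_eq]
  have h1 : ∀ x : ℝ, deriv (circleMap 0 1) x • (fun z => z ^ r * G z) (circleMap 0 1 x) =
      Complex.I * (fourier (T := 2 * π) (-(-((r : ℤ) + 1))) (x : S1) • τ (x : S1)) := fun x => by
    have h2 : circleMap 0 1 x = Complex.exp (x * Complex.I) := by simp [circleMap]
    have h3 : fourier (T := 2 * π) (-(-((r : ℤ) + 1))) (x : S1)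
        = Complex.exp (x * Complex.I) ^ (r + 1) := by
      rw [fourier_expr, ← Complex.exp_nat_mul]
      congr 1
      push_cast
      ring
    rw [deriv_circleMap, h2, h3, hτ]
    simp only [smul_eq_mul]
    ring
  simp only [h1, intervalIntegral.integral_const_mul] at h
  rw [zero_add, (mul_eq_zero.1 h).resolve_left Complex.I_ne_zero, smul_zero]

theorem toCircle_coe (x : ℝ) : (AddCircle.toCircle (x : S1) : ℂ) = Complex.exp (x * Complex.I) := by
  have h := fourier_expr 1 x
  rw [fourier_apply, one_zsmul] at h
  rw [h]
  push_cast
  ring_nf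

theorem T_mem_Wplus_of_mem_Moeb {m : DiffS1} (hm : m ∈ Moeb) {σ : VC} (hσ : σ ∈ Wplus) :
    T m σ ∈ Wplus := by
  obtain ⟨a, b, hab, hF⟩ := hm
  obtain ⟨f, hf, rfl⟩ := exists_toDiff m
  obtain ⟨σ, rfl⟩ := constFun.mkQ_surjective σ
  rw [mem_Wplus_iff] at hσ
  rw [T_mk, mem_Wplus_iff]
  intro n hn
  have h := hasSum_fhat_pmul_precomp hf (const 1) σ n
  rw [const_one_pmul] at h
  refine h.unique ?_
  convert! hasSum_zero using 1
  funext k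
  rcases lt_or_ge k 0 with hk | hk
  · rw [hσ k hk, zero_mul]
  · lift k to ℕ using hk
    rw [osc_one, fhat_eq_zero_of_holomorphic (G := fun z =>
      ((a * z + b) / (conj b * z + conj a)) ^ k) ?_ ?_ hn, mul_zero]
    · have hd : ∀ z ∈ Metric.closedBall (0 : ℂ) 1, conj b * z + conj a ≠ 0 := by
        intro z hz h0
        have h1 : conj a = -(conj b * z) := by linear_combination h0
        have h2 := congrArg norm h1
        rw [norm_neg, norm_mul, RCLike.norm_conj, RCLike.norm_conj] at h2
        have h3 : ‖z‖ ≤ 1 := by simpa using hz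
        have h4 : ‖b‖ * ‖z‖ ≤ ‖b‖ := mul_le_of_le_one_right (norm_nonneg _) h3
        linarith
      exact DifferentiableOn.pow (DifferentiableOn.div (by fun_prop) (by fun_prop) hd) k
    · intro x
      rw [← precomp_expo hf, precomp_apply, expo_zero_right, fourier_apply,
        AddCircle.toCircle_zsmul, ← toCircle_coe, ← hF]
      push_cast
      rfl

theorem map_T_Wplus {m : DiffS1} (hm : m ∈ Moeb) : Submodule.map (T m) Wplus = Wplus := by
  apply le_antisymm
  · rintro _ ⟨σ, hσ, rfl⟩
    exact T_mem_Wplus_of_mem_Moeb hm hσ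
  · intro σ hσ
    exact ⟨_, T_mem_Wplus_of_mem_Moeb (Moeb.inv_mem hm) hσ, T_T_inv m σ⟩

theorem map_T_eq_of_toM_eq {φ ψ : DiffS1} (h : toM φ = toM ψ) :
    Submodule.map (T φ) Wplus = Submodule.map (T ψ) Wplus := by
  have h1 : ψ * φ⁻¹ ∈ Moeb := QuotientGroup.rightRel_apply.1 (Quotient.exact h)
  have h2 : T ψ = T φ ∘ₗ T (ψ * φ⁻¹) := LinearMap.ext fun σ => by
    rw [LinearMap.comp_apply, ← T_mul, inv_mul_cancel_right]
  rw [h2, Submodule.map_comp, map_T_Wplus h1]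

/-! ### The period map -/

theorem graph_injective {Z W : HS} (h : {p : Hilb × Hilb | p.2 = toOp Z p.1} =
    {p : Hilb × Hilb | p.2 = toOp W p.1}) : Z = W :=
  toOp_injective <| ContinuousLinearMap.ext fun x => by
    have h1 : (x, toOp Z x) ∈ {p : Hilb × Hilb | p.2 = toOp Z p.1} := rfl
    rw [h] at h1
    exact h1

/-- A vector field `f` such that `θ + f` represents a given point of `M`. -/
def repField (q : M) : CircleFun ℝ := (exists_toDiff (Quotient.out q)).choose

theorem repField_mem (q : M) : repField q ∈ diffDomain :=
  (exists_toDiff (Quotient.out q)).choose_spec.1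

theorem toM_repField (q : M) : toM (toDiff (repField q)) = q := by
  rw [repField, (exists_toDiff (Quotient.out q)).choose_spec.2]
  exact Quotient.out_eq q

/-- The period map. -/
def periodMap (q : M) : SiegelDisc := ⟨Zmat (repField q), Zmat_mem (repField_mem q)⟩

theorem periodMap_toDiff {f : CircleFun ℝ} (hf : f ∈ diffDomain) :
    (periodMap (toM (toDiff f)) : HS) = Zmat f := by
  apply graph_injective
  change {p : Hilb × Hilb | p.2 = toOp (Zmat (repField (toM (toDiff f)))) p.1} = _
  rw [graph_Zmat hf, graph_Zmat (repField_mem _), map_T_eq_of_toM_eq (toM_repField _)]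

theorem isPeriodMap_periodMap : IsPeriodMap periodMap := fun φ => by
  obtain ⟨f, hf, rfl⟩ := exists_toDiff φ
  rw [periodMap_toDiff hf, graph_Zmat hf]

theorem IsPeriodMap.eq {P P' : M → SiegelDisc} (h : IsPeriodMap P) (h' : IsPeriodMap P') :
    P' = P := by
  funext q
  obtain ⟨φ, rfl⟩ : ∃ φ, toM φ = q := Quotient.exists_rep q
  exact Subtype.ext (graph_injective ((h' φ).trans (h φ).symm))

theorem isC1_periodMap : IsC1 periodMap := by
  obtain ⟨dZ, h⟩ := exists_hasC1_Zmat
  have h1 := h.congr (G := fun f => (periodMap (toM (toDiff f)) : HS)) fun f hf =>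
    periodMap_toDiff hf
  exact ⟨dZ, h1.hasDerivAt, h1.continuousOn_deriv⟩

/-! ### The derivative of the period map -/

/-- The vector field `v ∘ φ`. -/
def pullField (φ : DiffS1) (v : CircleFun ℝ) : CircleFun ℝ :=
  ofFun (fun x => v (φ x)) <| by
    obtain ⟨ψ, hψ, h⟩ := φ.2
    have : (fun x : ℝ => v (φ (x : S1))) = (fun x : ℝ => v (x : S1)) ∘ ψ := by
      funext x
      exact congrArg v.toFun (h x)
    rw [this]
    exact v.contDiff.comp hψ.smooth

/-- `(θ + t v) ∘ φ = θ + f + t (v ∘ φ)` for `φ = θ + f`. -/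
theorem toDiff_smul_mul {f v : CircleFun ℝ} (hf : f ∈ diffDomain) {t : ℝ}
    (h1 : t • v ∈ diffDomain) (h2 : f + t • pullField (toDiff f) v ∈ diffDomain) :
    toDiff (t • v) * toDiff f = toDiff (f + t • pullField (toDiff f) v) := by
  refine Subtype.ext (Equiv.ext (coe_induction fun x => ?_))
  have e1 : toDiff (t • v) (toDiff f (x : S1))
      = toDiff (f + t • pullField (toDiff f) v) (x : S1) := by
    have e2 : pullField (toDiff f) v (x : S1) = v ((x + f (x : S1) : ℝ) : S1) :=
      congrArg v.toFun (toDiff_apply hf x)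
    rw [toDiff_apply hf, toDiff_apply h1, toDiff_apply h2, CircleFun.add_apply,
      CircleFun.smul_apply, CircleFun.smul_apply, e2, add_assoc]
  exact e1

theorem tderiv_periodMap {dZ : CircleFun ℝ → CircleFun ℝ → HS} (h : HasC1 Zmat dZ)
    {f : CircleFun ℝ} (hf : f ∈ diffDomain) (v : TangentOrigin) :
    tderiv periodMap (toDiff f) v = dZ f (pullField (toDiff f) v) := by
  refine HasDerivAt.deriv ((h.hasDerivAt f hf (pullField (toDiff f) v)).congr_of_eventuallyEq ?_)
  have h1 := eventually_line_mem zero_mem_diffDomain (v : CircleFun ℝ)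
  filter_upwards [h1, eventually_line_mem hf (pullField (toDiff f) v)] with t ht1 ht2
  rw [zero_add] at ht1
  rw [toDiff_smul_mul hf ht1 ht2, periodMap_toDiff ht2]

/-- The defect `π₋ - Z π₊`, whose kernel is the graph of `Z`. -/
def graphDefect (f : CircleFun ℝ) : VC →ₗ[ℂ] Hilb :=
  piMinus - (toOp (Zmat f) : Hilb →ₗ[ℂ] Hilb) ∘ₗ piPlus

theorem graphDefect_apply (f : CircleFun ℝ) (σ : VC) :
    graphDefect f σ = piMinus σ - toOp (Zmat f) (piPlus σ) := rfl

/-- The graph of `Z` is isotropic and contains `T_φ(W₊)`, and `W₊` is its own annihilator with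
respect to `S`. Hence `T_φ σ` lies in the graph of `Z` only if `σ ∈ W₊`. -/
theorem graphDefect_T_eq_zero_iff {f : CircleFun ℝ} (hf : f ∈ diffDomain) (σ : VC) :
    graphDefect f (T (toDiff f) σ) = 0 ↔ σ ∈ Wplus := by
  rw [graphDefect_apply, sub_eq_zero]
  constructor
  · intro h
    have h1 : ∀ τ ∈ Wplus, symplHilb (split σ) (split τ) = 0 := fun τ hτ => by
      have h2 := symplHilb_graph hf (piPlus (T (toDiff f) σ)) (piPlus (T (toDiff f) τ))
      rw [← h, Zmat_apply_T hf hτ] at h2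
      exact (symplHilb_T (toDiff f) σ τ).symm.trans h2
    obtain ⟨σ, rfl⟩ := constFun.mkQ_surjective σ
    rw [mem_Wplus_iff]
    intro n hn
    obtain ⟨r, rfl⟩ : ∃ r : ℕ+, n = -(r : ℤ) := ⟨⟨(-n).toNat, by omega⟩, by simp [hn.le]⟩
    have h2 := h1 _ (expo_mem_Wplus r)
    rw [← sympl_eq, sympl_expo_right] at h2
    have hr : (r : ℂ) ≠ 0 := by exact_mod_cast r.ne_zero
    exact (mul_eq_zero.1 ((mul_eq_zero.1 h2).resolve_left two_pi_I_ne_zero)).resolve_left hr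
  · exact fun h => (Zmat_apply_T hf h).symm

theorem pmul_pullField (f v : CircleFun ℝ) (hf : f ∈ diffDomain) (k : ℤ) :
    pmul (pullField (toDiff f) v).toComplex (expo k f)
      = precomp (toDiff f) (pmul v.toComplex (expo k 0)) := by
  rw [← precomp_expo hf]; rfl

theorem norm_mul_I_le (a : ℂ) (k : ℤ) : ‖a * (Complex.I * k)‖ ≤ ‖a‖ * (1 + |(k : ℝ)|) := by
  rw [norm_mul, norm_mul, Complex.norm_I, one_mul, Complex.norm_intCast]
  exact mul_le_mul_of_nonneg_left (by linarith) (norm_nonneg _)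

/-- The velocity of `A_t e_k = k⁴ (A_t Λ⁻⁴) e_k` at `t = 0`, for `φ_t = (θ + t v) ∘ φ`. -/
theorem hasDerivAt_opA_basisVec {f : CircleFun ℝ} (hf : f ∈ diffDomain) (v : CircleFun ℝ)
    (k : ℕ+) :
    HasDerivAt (fun t : ℝ => (k : ℂ) ^ 4 •
        toOp (apMat (f + t • pullField (toDiff f) v)) (basisVec k))
      ((Complex.I * rt k) •
        piPlus (T (toDiff f) (constFun.mkQ (pmul v.toComplex (expo k 0))))) 0 := by
  let Φ : HS →L[ℂ] Hilb := (k : ℂ) ^ 4 • toOpL.flip (basisVec k)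
  have h := (Φ.restrictScalars ℝ).hasFDerivAt.comp_hasDerivAt (0 : ℝ)
    (oscDominated_pos.hasC1.hasDerivAt f hf (pullField (toDiff f) v))
  refine h.congr_deriv ?_
  ext s
  change (k : ℂ) ^ 4 * toOp (oscFamily _ _ _ _ _) (basisVec k) s
    = Complex.I * rt k * piPlus (T (toDiff f) (constFun.mkQ (pmul v.toComplex (expo k 0)))) s
  rw [toOp_basisVec, oscDominated_pos.oscFamily_apply (fun _ => norm_mul_I_le _ _) hf, T_mk,
    ← pmul_pullField f v hf, piPlus_apply]
  change (k : ℂ) ^ 4 * (rt s / rt k / (k : ℂ) ^ 4 * (Complex.I * ((k : ℕ) : ℤ)) * fhat _ _)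
    = Complex.I * rt k * (rt s * fhat _ _)
  have hk : (k : ℂ) ≠ 0 := by exact_mod_cast k.ne_zero
  have hr := rt_ne_zero k
  have hr2 := rt_mul_self k
  push_cast
  field_simp
  linear_combination
    -(rt s * fhat (pmul (pullField (toDiff f) v).toComplex (expo k f)) s) * hr2

/-- The velocity of `C_t e_k` at `t = 0`, for `φ_t = (θ + t v) ∘ φ`. -/
theorem hasDerivAt_opC_basisVec {f : CircleFun ℝ} (hf : f ∈ diffDomain) (v : CircleFun ℝ)
    (k : ℕ+) :
    HasDerivAt (fun t : ℝ => toOp (cMat (f + t • pullField (toDiff f) v)) (basisVec k))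
      ((Complex.I * rt k) •
        piMinus (T (toDiff f) (constFun.mkQ (pmul v.toComplex (expo k 0))))) 0 := by
  let Φ : HS →L[ℂ] Hilb := toOpL.flip (basisVec k)
  have h := (Φ.restrictScalars ℝ).hasFDerivAt.comp_hasDerivAt (0 : ℝ)
    (oscDominated_neg_zero.hasC1.hasDerivAt f hf (pullField (toDiff f) v))
  refine h.congr_deriv ?_
  ext r
  change toOp (oscFamily _ _ _ _ _) (basisVec k) r
    = Complex.I * rt k * piMinus (T (toDiff f) (constFun.mkQ (pmul v.toComplex (expo k 0)))) r
  rw [toOp_basisVec, oscDominated_neg_zero.oscFamily_apply (fun _ => norm_mul_I_le _ _) hf, T_mk,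
    ← pmul_pullField f v hf, piMinus_apply]
  change (rt r / rt k * (Complex.I * ((k : ℕ) : ℤ)) * fhat _ _)
    = Complex.I * rt k * (rt r * fhat _ _)
  have hr := rt_ne_zero k
  have hr2 := rt_mul_self k
  push_cast
  field_simp
  linear_combination
    -(rt r * fhat (pmul (pullField (toDiff f) v).toComplex (expo k f)) (-(r : ℤ))) * hr2

/-- The derivative of the period map, obtained by differentiating `Z_t A_t e_k = C_t e_k`. -/
theorem toOp_deriv_opA {dZ : CircleFun ℝ → CircleFun ℝ → HS} (h : HasC1 Zmat dZ)
    {f : CircleFun ℝ} (hf : f ∈ diffDomain) (v : CircleFun ℝ) (k : ℕ+) :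
    toOp (dZ f (pullField (toDiff f) v)) (opA (toDiff f) (basisVec k)) =
      (Complex.I * rt k) • graphDefect f
        (T (toDiff f) (constFun.mkQ (pmul v.toComplex (expo k 0)))) := by
  set w := pullField (toDiff f) v with hw
  have hA : ∀ g ∈ diffDomain,
      (k : ℂ) ^ 4 • toOp (apMat g) (basisVec k) = opA (toDiff g) (basisVec k) := fun g hg => by
    have hk : (k : ℂ) ^ 4 ≠ 0 := pow_ne_zero _ (by exact_mod_cast k.ne_zero)
    rw [toOp_apMat_basisVec hg, smul_inv_smul₀ hk]
  have hb := (toOpL.isBoundedBilinearMap.hasFDerivAt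
    (Zmat (f + (0 : ℝ) • w), (k : ℂ) ^ 4 • toOp (apMat (f + (0 : ℝ) • w)) (basisVec k))
    ).restrictScalars ℝ
  have h1 := hb.comp_hasDerivAt (0 : ℝ)
    ((h.hasDerivAt f hf w).prodMk (hasDerivAt_opA_basisVec hf v k))
  have h2 := hasDerivAt_opC_basisVec hf v k
  have h3 := h1.unique (h2.congr_of_eventuallyEq (by
    filter_upwards [eventually_line_mem hf w] with t ht
    change toOp (Zmat (f + t • w)) ((k : ℂ) ^ 4 • toOp (apMat (f + t • w)) (basisVec k)) = _
    rw [hA _ ht, Zmat_apply_opA ht]))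
  change toOp (Zmat (f + (0 : ℝ) • w)) ((Complex.I * rt k) • piPlus _)
    + toOp (dZ f w) ((k : ℂ) ^ 4 • toOp (apMat (f + (0 : ℝ) • w)) (basisVec k)) = _ at h3
  rw [add_zero_smul, hA f hf, map_smul] at h3
  rw [graphDefect_apply, smul_sub, ← h3, add_sub_cancel_left]

theorem fhat_pmul_expo (g : CircleFun ℂ) (k n : ℤ) :
    fhat (pmul g (expo k 0)) n = fhat g (n - k) := by
  unfold fhat fourierCoeff
  congr 1
  funext x
  rw [pmul_apply, expo_zero_right, neg_sub, sub_eq_add_neg, fourier_add]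
  simp only [smul_eq_mul]
  ring

theorem ext_opA_basisVec {f : CircleFun ℝ} (hf : f ∈ diffDomain) {Z W : HS}
    (h : ∀ k, toOp Z (opA (toDiff f) (basisVec k)) = toOp W (opA (toDiff f) (basisVec k))) :
    Z = W := by
  have h1 : (toOp Z).comp (opA (toDiff f)) = (toOp W).comp (opA (toDiff f)) := ext_basisVec h
  refine toOp_injective (ContinuousLinearMap.ext fun x => ?_)
  obtain ⟨y, rfl⟩ := surjective_opA hf x
  exact congrArg (fun T : Hilb →L[ℂ] Hilb => T y) h1

/-- In `(J v - i v) e^{ikθ}` only the Fourier components of `v` of nonnegative index survive. -/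
theorem mk_J_sub_mem_Wplus (v : TangentOrigin) (k : ℕ+) :
    constFun.mkQ (pmul (toComplex (J v)) (expo k 0)
      - Complex.I • pmul (toComplex v) (expo k 0)) ∈ Wplus := by
  rw [mem_Wplus_iff]
  intro n hn
  rw [sub_eq_add_neg, ← neg_one_smul ℂ, fhat_add, fhat_smul, fhat_smul, fhat_pmul_expo,
    fhat_pmul_expo]
  have h2 : fhat (toComplex (J v : CircleFun ℝ)) (n - k) = Complex.I * rhat v (n - k) := by
    refine (rhat_conjFun v.1 _).trans ?_
    have hk := k.pos
    rw [Int.sign_eq_neg_one_of_neg (by omega)]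
    push_cast
    ring
  rw [h2, rhat]
  ring

theorem tderiv_J (φ : DiffS1) (v : TangentOrigin) :
    tderiv periodMap φ (J v) = Complex.I • tderiv periodMap φ v := by
  obtain ⟨dZ, hZ⟩ := exists_hasC1_Zmat
  obtain ⟨f, hf, rfl⟩ := exists_toDiff φ
  rw [tderiv_periodMap hZ hf, tderiv_periodMap hZ hf]
  refine ext_opA_basisVec hf fun k => ?_
  have h1 : ∀ Z : HS, toOp (Complex.I • Z) = Complex.I • toOp Z := fun Z => map_smul toOpL _ Z
  have h3 : graphDefect f (T (toDiff f) (constFun.mkQ (pmul (toComplex (J v)) (expo k 0))))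
      = Complex.I •
        graphDefect f (T (toDiff f) (constFun.mkQ (pmul (toComplex v) (expo k 0)))) := by
    rw [← map_smul (graphDefect f), ← map_smul (T _), ← map_smul constFun.mkQ, ← sub_eq_zero,
      ← map_sub, ← map_sub, ← map_sub, graphDefect_T_eq_zero_iff hf]
    exact mk_J_sub_mem_Wplus v k
  rw [h1, _root_.smul_apply, toOp_deriv_opA hZ hf, toOp_deriv_opA hZ hf, h3, smul_comm]

theorem toComplex_injective : Function.Injective toComplex := fun _ _ h =>
  CircleFun.ext fun x => Complex.ofReal_injective (congrArg (fun σ : CircleFun ℂ => σ (x : S1)) h)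

theorem tderiv_injective (φ : DiffS1) : Function.Injective (tderiv periodMap φ) := by
  intro u v huv
  obtain ⟨dZ, hZ⟩ := exists_hasC1_Zmat
  obtain ⟨f, hf, rfl⟩ := exists_toDiff φ
  rw [tderiv_periodMap hZ hf, tderiv_periodMap hZ hf] at huv
  have h1 := toOp_deriv_opA hZ hf u 1
  rw [huv, toOp_deriv_opA hZ hf v 1] at h1
  have hI : Complex.I * rt 1 ≠ 0 := mul_ne_zero Complex.I_ne_zero (rt_ne_zero 1)
  have h2 := smul_right_injective Hilb hI h1
  rw [← sub_eq_zero, ← map_sub, ← map_sub, ← map_sub, graphDefect_T_eq_zero_iff hf,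
    mem_Wplus_iff] at h2
  -- The component of index `m + 1` of `(u - v) e^{iθ}` is `u_m - v_m`.
  have h3 : ∀ m < -1, rhat (u : CircleFun ℝ) m = rhat (v : CircleFun ℝ) m := fun m hm => by
    have h4 := h2 (m + 1) (by omega)
    rw [sub_eq_add_neg, ← neg_one_smul ℂ, fhat_add, fhat_smul, fhat_pmul_expo,
      fhat_pmul_expo] at h4
    simp only [PNat.one_coe, Nat.cast_one, add_sub_cancel_right] at h4
    rw [rhat, rhat]
    linear_combination -h4
  obtain ⟨a, b, c⟩ := u.2
  obtain ⟨a', b', c'⟩ := v.2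
  refine Subtype.ext (toComplex_injective (ext_fhat fun m => ?_))
  change rhat (u : CircleFun ℝ) m = rhat (v : CircleFun ℝ) m
  rcases lt_or_ge m (-1) with h | h
  · exact h3 m h
  rcases lt_or_ge 1 m with h' | h'
  · rw [← neg_neg m, rhat_neg, rhat_neg (v : CircleFun ℝ), h3 (-m) (by omega)]
  · obtain rfl | rfl | rfl : m = -1 ∨ m = 0 ∨ m = 1 := by omega
    · rw [a, a']
    · rw [b, b']
    · rw [c, c']

/-! ### The derivative at the origin -/

theorem toDiff_zero : toDiff 0 = 1 :=
  Subtype.ext (Equiv.ext (coe_induction fun x =>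
    (toDiff_apply zero_mem_diffDomain x).trans (by simp)))

theorem opA_one_basisVec (k : ℕ+) : opA 1 (basisVec k) = basisVec k := by
  ext s
  rw [← toDiff_zero, opA_basisVec zero_mem_diffDomain, osc_one, fhat_expo_zero, basisVec_apply]
  by_cases h : s = k
  · subst h; simp [rt_ne_zero]
  · have h' : ¬((s : ℕ) : ℤ) = (k : ℕ) := fun h' => h (PNat.coe_injective (by exact_mod_cast h'))
    rw [if_neg h, if_neg h', mul_zero]

theorem toOp_Zmat_zero : toOp (Zmat 0) = 0 := ext_basisVec fun k => by
  have h := Zmat_apply_opA zero_mem_diffDomain (basisVec k)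
  rw [toDiff_zero, opA_one_basisVec] at h
  rw [h]
  ext r
  rw [toOp_basisVec, cMat_apply zero_mem_diffDomain, osc_one, fhat_expo_zero, if_neg, mul_zero]
  · rfl
  · have := r.pos
    have := k.pos
    omega

theorem toOp_tderiv_one (v : TangentOrigin) (σ : CircleFun ℂ) (hσ : constFun.mkQ σ ∈ Wplus) :
    toOp (tderiv periodMap 1 v) (piPlus (constFun.mkQ σ)) =
      piMinus (constFun.mkQ ((CircleFun.toComplex v).mul σ.D)) := by
  obtain ⟨dZ, hZ⟩ := exists_hasC1_Zmat
  have h0 := zero_mem_diffDomain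
  rw [mem_Wplus_iff] at hσ
  have hent : ∀ r k, tderiv periodMap 1 v (r, k)
      = Complex.I * rt k * (rt r * osc (toComplex v) 0 k (-(r : ℤ))) := fun r k => by
    have h := toOp_deriv_opA hZ h0 v k
    rw [← tderiv_periodMap hZ h0 v, toDiff_zero, opA_one_basisVec, T_one, graphDefect_apply,
      toOp_Zmat_zero] at h
    rw [← toOp_basisVec, h, _root_.zero_apply, sub_zero]
    change Complex.I * rt k * (piMinus _ r) = _
    rw [piMinus_apply]
    rfl
  ext r
  rw [piMinus_apply, toOp_apply]
  have h := hasSum_fhat_pmul_precomp h0 (toComplex v) σ.D (-(r : ℤ))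
  have hone : precomp (toDiff 0) σ.D = σ.D := by rw [toDiff_zero]; rfl
  rw [hone] at h
  have hinj : Function.Injective fun k : ℕ+ => ((k : ℕ) : ℤ) := fun k l h => by
    have h' : ((k : ℕ) : ℤ) = (l : ℕ) := h
    exact PNat.coe_injective (by exact_mod_cast h')
  have h1 := (hinj.hasSum_iff fun k hk => ?_).2 h
  · refine Eq.trans ?_ (h1.mul_left (rt r)).tsum_eq
    congr 1
    funext k
    rw [hent, piPlus_apply]
    change Complex.I * rt k * (rt r * osc (toComplex v) 0 k (-(r : ℤ))) * (rt k * fhat σ k)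
      = rt r * (fhat σ.D k * osc (toComplex v) 0 k (-(r : ℤ)))
    rw [fhat_D]
    push_cast
    linear_combination (Complex.I * rt r * osc (toComplex v) 0 k (-(r : ℤ)) * fhat σ k) *
      rt_mul_self k
  · rw [fhat_D]
    rcases lt_trichotomy k 0 with h2 | h2 | h2
    · rw [hσ k h2, mul_zero, zero_mul]
    · rw [h2]; simp
    · exact absurd ⟨⟨k.toNat, by omega⟩, by simp [h2.le]⟩ hk

end PeriodMap

end

theorem mainTheorem2 :
    ∃ P : M → SiegelDisc,
      -- `P` is the map `Π`, which is thereby well defined and unique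
      IsPeriodMap P ∧ (∀ P' : M → SiegelDisc, IsPeriodMap P' → P' = P) ∧
      -- `Π` is a holomorphic immersion
      IsHolomorphic P ∧ IsImmersion P ∧
      -- its derivative at the origin is `v ↦ η_v`, where `η_v(σ) = π₋(u σ')` for `v = u ∂/∂θ`
      ∀ (v : TangentOrigin) (σ : CircleFun ℂ), constFun.mkQ σ ∈ Wplus →
        toOp (tderiv P 1 v) (piPlus (constFun.mkQ σ)) =
          piMinus (constFun.mkQ ((CircleFun.toComplex v).mul σ.D)) :=
  ⟨periodMap, isPeriodMap_periodMap, fun _ h => isPeriodMap_periodMap.eq h,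
    ⟨isC1_periodMap, tderiv_J⟩, ⟨isC1_periodMap, tderiv_injective⟩, toOp_tderiv_one⟩
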